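/- Let $L,\rho,\alpha_1,\beta,\mu,c>0$ and $\gamma,\delta\in\mathbb R\setminus\{0\}$, and put $\alpha=\alpha_1+\gamma^2\beta$. Let $\sigma:(0,\infty)\to[0,\infty)$ satisfy (H) $\sigma\in L^1(0,\infty)\cap C^1(0,\infty)$, $\int_0^\infty\sigma(r)\,dr>0$, the limit $\sigma(0)=\lim_{s\to0^+}\sigma(s)$ exists and is finite, and there is $d_\sigma>0$ such that $\sigma'(s)\le-d_\sigma\,\sigma(s)$ for all $s>0$. All functions are complex valued. Let $H^1_L(0,L)=\{u\in H^1(0,L):u(0)=0\}$ and $H^1_0(0,L)$ carry the inner product $\int_0^L u_x\overline{v_x}\,dx$, let $W=L^2_\sigma((0,\infty);H^1_0(0,L))$ be the space of $H^1_0(0,L)$-valued functions of $s$ that are square integrable with respect to $\sigma(s)\,ds$, and let $$\mathcal H=\big(H^1_L(0,L)\times L^2(0,L)\big)^2\times L^2(0,L)\times W$$ be the Hilbert space of all $U=(u,v,y,z,w,\eta)$ with the inner product associated with $$\|U\|_{\mathcal H}^2=\int_0^L\big(\rho|v|^2+\alpha_1|u_x|^2+\mu|z|^2+\beta|\gamma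 u_x-y_x|^2+|w|^2\big)dx+c\int_0^L\int_0^\infty\sigma(s)|\eta_x|^2\,ds\,dx .$$ For $\eta\in W$ put $\Lambda^1=\int_0^\infty\sigma(s)\eta(s)\,ds$. Let $\mathcal A_1:D(\mathcal A_1)\subset\mathcal H\to\mathcal H$ be the unbounded operator $$\mathcal A_1U=\Big(v,\ \tfrac1\rho(\alpha u_{xx}-\gamma\beta y_{xx}-\delta w_x),\ z,\ \tfrac1\mu(\beta y_{xx}-\gamma\beta u_{xx}),\ c\Lambda^1_{xx}-\delta v_x,\ -\eta_s+w\Big)$$ whose domain $D(\mathcal A_1)$ consists of all $U\in\mathcal H$ with $v,z\in H^1_L(0,L)$; $u,y\in H^2(0,L)\cap H^1_L(0,L)$; $u_x(L)=y_x(L)=0$; $w\in H^1_0(0,L)$; $\Lambda^1_x\in H^1(0,L)$; $\eta_s\in W$ and $\eta(\cdot,0)=0$. Then $i\mathbb R\subset\rho(\mathcal A_1)$: for every $\lambda\in\mathbb R$ the operator $i\lambda I-\mathcal A_1:D(\mathcal A_1)\to\mathcal H$ is bijective and its inverse is bounded on $\mathcal H$. -/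

import Mathlib

open Set MeasureTheory Filter Topology
open scoped ContDiff InnerProductSpace ENNReal

namespace Piezo

section Trace

variable {E : Type*} [NormedAddCommGroup E]

/-- The trace of (the class of) `f` at the boundary point `a` of `S` is zero: `f` agrees almost
everywhere on `S` with a function that is continuous on `S ∪ {a}` and vanishes at `a`. -/
def VanishesAt (S : Set ℝ) (a : ℝ) (f : ℝ → E) : Prop :=
  ∃ f' : ℝ → E, ContinuousOn f' (insert a S) ∧ f' =ᵐ[volume.restrict S] f ∧ f' a = 0

theorem VanishesAt.congr {S : Set ℝ} {a : ℝ} {f g : ℝ → E} (h : VanishesAt S a f)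
    (hf : f =ᵐ[volume.restrict S] g) : VanishesAt S a g := by
  obtain ⟨k, h1, h2, h3⟩ := h
  exact ⟨k, h1, h2.trans hf, h3⟩

theorem VanishesAt.add {S : Set ℝ} {a : ℝ} {f g : ℝ → E} (h : VanishesAt S a f)
    (h' : VanishesAt S a g) : VanishesAt S a (f + g) := by
  obtain ⟨k, h1, h2, h3⟩ := h
  obtain ⟨k', h1', h2', h3'⟩ := h'
  exact ⟨k + k', h1.add h1', h2.add h2', by simp [h3, h3']⟩

theorem VanishesAt.smul {𝕜 : Type*} [NormedField 𝕜] [NormedSpace 𝕜 E]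
    {S : Set ℝ} {a : ℝ} {f : ℝ → E} (c : 𝕜) (h : VanishesAt S a f) :
    VanishesAt S a (c • f) := by
  obtain ⟨k, h1, h2, h3⟩ := h
  exact ⟨c • k, h1.const_smul c, h2.const_smul c, by simp [h3]⟩

theorem VanishesAt.zero (S : Set ℝ) (a : ℝ) : VanishesAt S a (0 : ℝ → E) :=
  ⟨0, continuousOn_const, ae_eq_rfl, rfl⟩

end Trace

section WeakDerivative

variable {E : Type*} [NormedAddCommGroup E] [NormedSpace ℝ E]

/-- `φ` is a real test function on the open set `S`: an element of `C_c^∞(S)`. -/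
def IsTest (S : Set ℝ) (φ : ℝ → ℝ) : Prop :=
  ContDiff ℝ ∞ φ ∧ HasCompactSupport φ ∧ tsupport φ ⊆ S

/-- `g` is the weak (distributional) derivative of `f` on the open set `S`. -/
def HasWeakDerivOn (S : Set ℝ) (f g : ℝ → E) : Prop :=
  ∀ φ : ℝ → ℝ, IsTest S φ → ∫ x in S, deriv φ x • f x = -∫ x in S, φ x • g x

theorem IsTest.deriv {S : Set ℝ} {φ : ℝ → ℝ} (h : IsTest S φ) : IsTest S (deriv φ) :=
  ⟨h.1.deriv' , h.2.1.deriv, (closure_minimal support_deriv_subset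
    isClosed_closure).trans h.2.2⟩

theorem IsTest.integrable {S : Set ℝ} {φ : ℝ → ℝ} (h : IsTest S φ) {f : ℝ → E}
    (hf : LocallyIntegrableOn f S (volume.restrict S)) :
    Integrable (fun x => φ x • f x) (volume.restrict S) := by
  have hK : IsCompact (tsupport φ) := h.2.1
  have h1 : IntegrableOn (fun x => φ x • f x) (tsupport φ) (volume.restrict S) :=
    (hf.integrableOn_compact_subset h.2.2 hK).continuousOn_smul h.1.continuous.continuousOn hK
  refine (integrableOn_iff_integrable_of_support_subset ?_).1 h1
  intro x hx
  by_contra hn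
  exact hx (by simp [image_eq_zero_of_notMem_tsupport hn])

theorem HasWeakDerivOn.congr {S : Set ℝ} {f g f' g' : ℝ → E} (h : HasWeakDerivOn S f g)
    (hf : f =ᵐ[volume.restrict S] f') (hg : g =ᵐ[volume.restrict S] g') :
    HasWeakDerivOn S f' g' := by
  intro φ hφ
  have h1 : ∫ x in S, _root_.deriv φ x • f x = ∫ x in S, _root_.deriv φ x • f' x :=
    integral_congr_ae (hf.mono fun x hx => by simp only [hx])
  have h2 : ∫ x in S, φ x • g x = ∫ x in S, φ x • g' x :=
    integral_congr_ae (hg.mono fun x hx => by simp only [hx])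
  rw [← h1, ← h2]
  exact h φ hφ

theorem HasWeakDerivOn.add {S : Set ℝ} {f g f' g' : ℝ → E}
    (hf : LocallyIntegrableOn f S (volume.restrict S))
    (hg : LocallyIntegrableOn g S (volume.restrict S))
    (hf' : LocallyIntegrableOn f' S (volume.restrict S))
    (hg' : LocallyIntegrableOn g' S (volume.restrict S))
    (h : HasWeakDerivOn S f g) (h' : HasWeakDerivOn S f' g') :
    HasWeakDerivOn S (f + f') (g + g') := by
  intro φ hφ
  simp only [Pi.add_apply, smul_add]
  rw [integral_add (hφ.deriv.integrable hf) (hφ.deriv.integrable hf'),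
    integral_add (hφ.integrable hg) (hφ.integrable hg'), h φ hφ, h' φ hφ]
  abel

theorem HasWeakDerivOn.smul {𝕜 : Type*} [NormedField 𝕜] [NormedSpace 𝕜 E] [SMulCommClass ℝ 𝕜 E]
    {S : Set ℝ} {f g : ℝ → E} (c : 𝕜) (h : HasWeakDerivOn S f g) :
    HasWeakDerivOn S (c • f) (c • g) := by
  intro φ hφ
  simp only [Pi.smul_apply, smul_comm _ c, integral_smul, h φ hφ, smul_neg]

theorem HasWeakDerivOn.unique [CompleteSpace E] {S : Set ℝ} (hS : IsOpen S) {f g g' : ℝ → E}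
    (hg : LocallyIntegrableOn g S (volume.restrict S))
    (hg' : LocallyIntegrableOn g' S (volume.restrict S))
    (h : HasWeakDerivOn S f g) (h' : HasWeakDerivOn S f g') :
    g =ᵐ[volume.restrict S] g' := by
  have := hS.ae_eq_zero_of_integral_contDiff_smul_eq_zero (hg.sub hg') (fun φ h1 h2 h3 => by
    have hφ : IsTest S φ := ⟨h1, h2, h3⟩
    simp only [Pi.sub_apply, smul_sub]
    rw [integral_sub (hφ.integrable hg) (hφ.integrable hg'), sub_eq_zero]
    exact neg_injective ((h φ hφ).symm.trans (h' φ hφ)))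
  filter_upwards [this, ae_restrict_mem hS.measurableSet] with x hx hxS
  exact sub_eq_zero.1 (hx hxS)

/-- A function with zero weak derivative on a bounded interval is almost everywhere constant. -/
theorem HasWeakDerivOn.ae_const [CompleteSpace E] {a b : ℝ} {f : ℝ → E}
    (hf : LocallyIntegrableOn f (Ioo a b) (volume.restrict (Ioo a b)))
    (h : HasWeakDerivOn (Ioo a b) f 0) :
    ∃ k : E, f =ᵐ[volume.restrict (Ioo a b)] fun _ => k := by
  rcases le_or_gt b a with hab | hab
  · exact ⟨0, by rw [Ioo_eq_empty_of_le hab, Measure.restrict_empty]; simp [Filter.EventuallyEq]⟩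
  -- a test function of integral one
  let B : ContDiffBump ((a + b) / 2 : ℝ) := ⟨(b - a) / 8, (b - a) / 4, by linarith, by linarith⟩
  let ψ : ℝ → ℝ := B.normed volume
  have hψ : IsTest (Ioo a b) ψ := by
    refine ⟨B.contDiff_normed, B.hasCompactSupport_normed, ?_⟩
    rw [B.tsupport_normed_eq, Real.closedBall_eq_Icc]
    intro x hx
    simp only [mem_Icc, B] at hx
    constructor <;> linarith [hx.1, hx.2]
  have hψ1 : ∫ x, ψ x = 1 := B.integral_normed
  refine ⟨∫ x in Ioo a b, ψ x • f x, ?_⟩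
  set k := ∫ x in Ioo a b, ψ x • f x with hk
  have hc : LocallyIntegrableOn (fun _ : ℝ => k) (Ioo a b) (volume.restrict (Ioo a b)) :=
    (locallyIntegrable_const k).locallyIntegrableOn _
  have := isOpen_Ioo.ae_eq_zero_of_integral_contDiff_smul_eq_zero (hf.sub hc)
    (fun φ h1 h2 h3 => by
    have hφ : IsTest (Ioo a b) φ := ⟨h1, h2, h3⟩
    simp only [Pi.sub_apply, smul_sub]
    rw [integral_sub (hφ.integrable hf) (hφ.integrable hc), sub_eq_zero]
    set c := ∫ x, φ x with hcdef
    let θ : ℝ → ℝ := fun x => φ x - c * ψ x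
    have hθ : ContDiff ℝ ∞ θ := h1.sub (contDiff_const.mul hψ.1)
    have hθi : Integrable θ :=
      (h1.continuous.integrable_of_hasCompactSupport h2).sub
        ((hψ.1.continuous.integrable_of_hasCompactSupport hψ.2.1).const_mul c)
    have hθ0 : ∫ x, θ x = 0 := by
      rw [integral_sub (h1.continuous.integrable_of_hasCompactSupport h2)
        ((hψ.1.continuous.integrable_of_hasCompactSupport hψ.2.1).const_mul c),
        integral_const_mul, hψ1]
      simp [hcdef]
    let K := tsupport φ ∪ tsupport ψ
    have hKc : IsCompact K := IsCompact.union h2 hψ.2.1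
    have hKs : K ⊆ Ioo a b := union_subset h3 hψ.2.2
    have hθK : ∀ x, x ∉ K → θ x = 0 := fun x hx => by
      simp only [K, mem_union, not_or] at hx
      simp [θ, image_eq_zero_of_notMem_tsupport hx.1, image_eq_zero_of_notMem_tsupport hx.2]
    -- the primitive of `θ` is a test function
    let χ : ℝ → ℝ := fun x => ∫ t in a..x, θ t
    have hχd : ∀ x, HasDerivAt χ (θ x) x := fun x =>
      intervalIntegral.integral_hasDerivAt_right (hθ.continuous.intervalIntegrable _ _)
        (hθ.continuous.stronglyMeasurableAtFilter _ _) hθ.continuous.continuousAt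
    have hχ' : _root_.deriv χ = θ := funext fun x => (hχd x).deriv
    have hχs : ContDiff ℝ ∞ χ := by
      rw [contDiff_infty_iff_deriv]
      exact ⟨fun x => (hχd x).differentiableAt, by rw [hχ']; exact hθ⟩
    obtain ⟨a', b', hab', hKab⟩ : ∃ a' b', Icc a' b' ⊆ Ioo a b ∧ K ⊆ Icc a' b' := by
      have hne : K.Nonempty := by
        rw [nonempty_iff_ne_empty]
        intro h0
        have : ψ = 0 := by
          ext x
          have hx : x ∉ K := by simp [h0]
          simp only [K, mem_union, not_or] at hx
          simp [image_eq_zero_of_notMem_tsupport hx.2]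
        simp [this] at hψ1
      refine ⟨sInf K, sSup K, ?_, fun x hx =>
        ⟨csInf_le hKc.bddBelow hx, le_csSup hKc.bddAbove hx⟩⟩
      have := hKs (hKc.sInf_mem hne)
      have := hKs (hKc.sSup_mem hne)
      intro x hx
      simp only [mem_Ioo, mem_Icc] at *
      constructor <;> linarith
    have hχK : ∀ x, x ∉ Icc a' b' → χ x = 0 := by
      intro x hx
      have hx' : x < a' ∨ b' < x := by
        by_contra! hcon
        exact hx ⟨hcon.1, hcon.2⟩
      have hout : ∀ t, t ∉ Ioo a b → θ t = 0 := fun t ht => hθK t fun h => ht (hKs h)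
      rcases hx' with hx' | hx'
      · apply intervalIntegral.integral_zero_ae
        refine Eventually.of_forall fun t ht => ?_
        by_cases htt : t ∈ K
        · exfalso
          have h4 := hKab htt
          have h5 := hKs htt
          rcases mem_uIoc.1 ht with h6 | h6
          · linarith [h4.1, h6.2]
          · linarith [h5.1, h6.2]
        · exact hθK t htt
      · have h6 : χ x = ∫ t, θ t := by
          rcases le_or_gt a x with hax | hax
          · simp only [χ]
            rw [intervalIntegral.integral_of_le hax]
            apply setIntegral_eq_integral_of_forall_compl_eq_zero
            intro t ht
            apply hθK
            intro htK
            exact ht ⟨(hKs htK).1, ((hKab htK).2.trans hx'.le)⟩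
          · have hKe : ∀ t, t ∉ K := fun t ht => by
              linarith [(hKs ht).1, (hKab ht).2]
            have : θ = 0 := funext fun t => hθK t (hKe t)
            simp [χ, this]
        rw [h6, hθ0]
    have hχ : IsTest (Ioo a b) χ := by
      have hsub : tsupport χ ⊆ Icc a' b' :=
        closure_minimal (fun x hx => by
          by_contra hn
          exact hx (hχK x hn)) isClosed_Icc
      exact ⟨hχs, HasCompactSupport.of_support_subset_isCompact isCompact_Icc
        (subset_closure.trans hsub), hsub.trans hab'⟩
    have h7 := h χ hχ
    simp only [hχ', Pi.zero_apply, smul_zero, integral_zero, neg_zero] at h7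
    simp only [θ, sub_smul, mul_smul] at h7
    have h8 : ∫ x in Ioo a b, (φ x • f x - c • ψ x • f x)
        = (∫ x in Ioo a b, φ x • f x) - ∫ x in Ioo a b, c • ψ x • f x :=
      integral_sub (hφ.integrable hf) ((hψ.integrable hf).smul c)
    rw [h8, integral_smul, sub_eq_zero] at h7
    rw [h7, integral_smul_const]
    congr 1
    rw [hcdef]
    refine (setIntegral_eq_integral_of_forall_compl_eq_zero fun x hx => ?_).symm
    exact image_eq_zero_of_notMem_tsupport fun hx' => hx (h3 hx'))
  filter_upwards [this, ae_restrict_mem measurableSet_Ioo] with x hx hxS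
  exact sub_eq_zero.1 (hx hxS)

theorem HasWeakDerivOn.ae_zero [CompleteSpace E] {a b : ℝ} {f : ℝ → E}
    (hf : LocallyIntegrableOn f (Ioo a b) (volume.restrict (Ioo a b)))
    (h : HasWeakDerivOn (Ioo a b) f 0) (h0 : VanishesAt (Ioo a b) a f) :
    f =ᵐ[volume.restrict (Ioo a b)] 0 := by
  rcases le_or_gt b a with hab | hab
  · rw [Ioo_eq_empty_of_le hab, Measure.restrict_empty]; simp [Filter.EventuallyEq]
  obtain ⟨k, hk⟩ := h.ae_const hf
  obtain ⟨f', hc, hff, hz⟩ := h0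
  have h1 : EqOn f' (fun _ => k) (Ioo a b) :=
    Measure.eqOn_open_of_ae_eq (hff.trans hk) isOpen_Ioo
      (hc.mono (subset_insert _ _)) continuousOn_const
  have h2 : EqOn f' (fun _ => k) (insert a (Ioo a b)) :=
    h1.of_subset_closure hc continuousOn_const (subset_insert _ _)
      (by rw [closure_Ioo hab.ne]
          exact insert_subset (left_mem_Icc.2 hab.le) Ioo_subset_Icc_self)
  have h3 : k = 0 := by rw [← hz]; exact (h2 (mem_insert _ _)).symm
  rw [h3] at hk
  exact hk

/-- The primitive of an integrable function has that function as its weak derivative. -/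
theorem hasWeakDerivOn_primitive [CompleteSpace E] {a b : ℝ} {g : ℝ → E}
    (hg : IntegrableOn g (Ioo a b)) :
    HasWeakDerivOn (Ioo a b) (fun x => ∫ t in Ioo a b, (Iio x).indicator g t) g := by
  intro φ hφ
  have hφ'i : Integrable (deriv φ) (volume.restrict (Ioo a b)) :=
    (hφ.deriv.1.continuous.integrable_of_hasCompactSupport hφ.deriv.2.1).integrableOn
  have hint : Integrable (Function.uncurry fun x t => deriv φ x • (Iio x).indicator g t)
      ((volume.restrict (Ioo a b)).prod (volume.restrict (Ioo a b))) := by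
    have h1 := (hφ'i.smul_prod hg).indicator
      (measurableSet_lt measurable_snd measurable_fst : MeasurableSet {p : ℝ × ℝ | p.2 < p.1})
    refine h1.congr (Eventually.of_forall fun p => ?_)
    by_cases hp : p.2 < p.1 <;> simp [Function.uncurry, indicator, hp]
  simp only [← integral_smul]
  rw [integral_integral_swap hint, ← integral_neg]
  refine setIntegral_congr_fun measurableSet_Ioo fun t ht => ?_
  have h2 : ∀ x, deriv φ x • (Iio x).indicator g t = ((Ioi t).indicator (deriv φ) x) • g t := by
    intro x
    by_cases hx : t < x <;> simp [indicator, hx]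
  simp only [h2]
  rw [integral_smul_const, ← neg_smul]
  congr 1
  rw [setIntegral_indicator measurableSet_Ioi]
  have h3 : Ioo a b ∩ Ioi t = Ioo t b := by
    ext x; simp only [mem_inter_iff, mem_Ioo, mem_Ioi]
    constructor
    · rintro ⟨⟨_, h⟩, h'⟩; exact ⟨h', h⟩
    · rintro ⟨h, h'⟩; exact ⟨⟨ht.1.trans h, h'⟩, h⟩
  rw [h3, ← integral_Ioc_eq_integral_Ioo, ← intervalIntegral.integral_of_le ht.2.le,
    intervalIntegral.integral_deriv_eq_sub'
      φ rfl (fun x _ => hφ.1.differentiable (by simp) x) hφ.deriv.1.continuous.continuousOn]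
  rw [image_eq_zero_of_notMem_tsupport fun h => (hφ.2.2 h).2.false, zero_sub]

end WeakDerivative

/-! ### Sobolev spaces on `(0, L)` -/

/-- The complex space `L²(0, L)`. -/
abbrev L2 (L : ℝ) : Type := Lp ℂ 2 (volume.restrict (Ioo 0 L))

theorem ae_eq_of_nonpos {L : ℝ} (hL : L ≤ 0) (f g : ℝ → ℂ) :
    f =ᵐ[volume.restrict (Ioo 0 L)] g := by
  rw [Ioo_eq_empty_of_le hL, Measure.restrict_empty]
  simp [Filter.EventuallyEq]

theorem L2.integrable {L : ℝ} (u : L2 L) : Integrable u (volume.restrict (Ioo 0 L)) :=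
  (Lp.memLp u).integrable (by norm_num)

theorem L2.loc {L : ℝ} (u : L2 L) :
    LocallyIntegrableOn u (Ioo 0 L) (volume.restrict (Ioo 0 L)) :=
  u.integrable.locallyIntegrable.locallyIntegrableOn _

/-- `H¹(0, L)`, as a subspace of `L²(0, L)`. -/
def H1 (L : ℝ) : Submodule ℂ (L2 L) where
  carrier := {u | ∃ g : L2 L, HasWeakDerivOn (Ioo 0 L) u g}
  zero_mem' := ⟨0, by
    refine HasWeakDerivOn.congr (f := 0) (g := 0) (fun φ _ => by simp)
      (Lp.coeFn_zero _ _ _).symm (Lp.coeFn_zero _ _ _).symm⟩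
  add_mem' := by
    rintro u u' ⟨g, h⟩ ⟨g', h'⟩
    exact ⟨g + g', (HasWeakDerivOn.add u.loc g.loc u'.loc g'.loc h h').congr
      (Lp.coeFn_add _ _).symm (Lp.coeFn_add _ _).symm⟩
  smul_mem' := by
    rintro c u ⟨g, h⟩
    exact ⟨c • g, (h.smul c).congr (Lp.coeFn_smul _ _).symm (Lp.coeFn_smul _ _).symm⟩

open Classical in
/-- The weak derivative `u_x ∈ L²(0, L)` of `u ∈ H¹(0, L)` (zero by convention off `H¹(0, L)`). -/
noncomputable def dx {L : ℝ} (u : L2 L) : L2 L := if h : u ∈ H1 L then h.choose else 0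

theorem dx_spec {L : ℝ} {u : L2 L} (h : u ∈ H1 L) : HasWeakDerivOn (Ioo 0 L) u (dx u) := by
  unfold dx
  rw [dif_pos h]
  exact h.choose_spec

theorem dx_eq {L : ℝ} {u g : L2 L} (h : HasWeakDerivOn (Ioo 0 L) u g) : dx u = g :=
  Lp.ext (HasWeakDerivOn.unique isOpen_Ioo (dx u).loc g.loc (dx_spec ⟨g, h⟩) h)

theorem dx_add {L : ℝ} {u u' : L2 L} (h : u ∈ H1 L) (h' : u' ∈ H1 L) :
    dx (u + u') = dx u + dx u' :=
  dx_eq ((HasWeakDerivOn.add u.loc (dx u).loc u'.loc (dx u').loc (dx_spec h) (dx_spec h')).congr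
      (Lp.coeFn_add _ _).symm (Lp.coeFn_add _ _).symm)

theorem dx_smul {L : ℝ} (c : ℂ) {u : L2 L} (h : u ∈ H1 L) : dx (c • u) = c • dx u :=
  dx_eq (((dx_spec h).smul c).congr (Lp.coeFn_smul _ _).symm (Lp.coeFn_smul _ _).symm)

/-- The trace of `u` at the boundary point `a` of `(0, L)` is zero. -/
def TraceZero {L : ℝ} (a : ℝ) (u : L2 L) : Prop := VanishesAt (Ioo 0 L) a u

theorem TraceZero.zero {L : ℝ} (a : ℝ) : TraceZero a (0 : L2 L) :=
  (VanishesAt.zero _ _).congr (Lp.coeFn_zero _ _ _).symm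

theorem TraceZero.add {L a : ℝ} {u u' : L2 L} (h : TraceZero a u) (h' : TraceZero a u') :
    TraceZero a (u + u') :=
  (VanishesAt.add h h').congr (Lp.coeFn_add _ _).symm

theorem TraceZero.smul {L a : ℝ} (c : ℂ) {u : L2 L} (h : TraceZero a u) : TraceZero a (c • u) :=
  (VanishesAt.smul c h).congr (Lp.coeFn_smul _ _).symm

/-- `H¹_L(0, L) = {u ∈ H¹(0, L) : u(0) = 0}`, as a subspace of `L²(0, L)`. -/
def HL1Sub (L : ℝ) : Submodule ℂ (L2 L) where
  carrier := {u | u ∈ H1 L ∧ TraceZero 0 u}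
  zero_mem' := ⟨zero_mem _, TraceZero.zero 0⟩
  add_mem' := fun h h' => ⟨add_mem h.1 h'.1, h.2.add h'.2⟩
  smul_mem' := fun c _ h => ⟨(H1 L).smul_mem c h.1, h.2.smul c⟩

/-- The space `H¹_L(0, L)` with its own inner product `⟨u, v⟩ = ⟨u_x, v_x⟩_{L²}`. -/
def HL1 (L : ℝ) : Type := HL1Sub L

namespace HL1

variable {L : ℝ}

noncomputable instance : AddCommGroup (HL1 L) := inferInstanceAs (AddCommGroup (HL1Sub L))
noncomputable instance : Module ℂ (HL1 L) := inferInstanceAs (Module ℂ (HL1Sub L))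

/-- The inclusion of `H¹_L(0, L)` into `L²(0, L)`. -/
noncomputable def toL2 : HL1 L →ₗ[ℂ] L2 L := (HL1Sub L).subtype

theorem toL2_mem (u : HL1 L) : u.toL2 ∈ HL1Sub L := u.2

theorem toL2_injective : Function.Injective (toL2 : HL1 L → L2 L) := Subtype.val_injective

/-- An element of `L²(0, L)` that lies in `H¹_L(0, L)`. -/
def mk (u : L2 L) (h : u ∈ HL1Sub L) : HL1 L := ⟨u, h⟩

@[simp] theorem toL2_mk (u : L2 L) (h : u ∈ HL1Sub L) : (mk u h).toL2 = u := rfl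

theorem mk_add (u v : L2 L) (h : u ∈ HL1Sub L) (h' : v ∈ HL1Sub L) (h'' : u + v ∈ HL1Sub L) :
    mk (u + v) h'' = mk u h + mk v h' := rfl

theorem mk_smul (a : ℂ) (u : L2 L) (h : u ∈ HL1Sub L) (h' : a • u ∈ HL1Sub L) :
    mk (a • u) h' = a • mk u h := rfl

/-- The derivative `u ↦ u_x` from `H¹_L(0, L)` to `L²(0, L)`. -/
noncomputable def D : HL1 L →ₗ[ℂ] L2 L where
  toFun u := dx u.toL2
  map_add' u u' := by rw [map_add, dx_add u.toL2_mem.1 u'.toL2_mem.1]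
  map_smul' c u := by rw [map_smul, dx_smul c u.toL2_mem.1, RingHom.id_apply]

theorem eq_zero_of_D {u : HL1 L} (h : u.D = 0) : u = 0 := by
  apply toL2_injective
  rw [map_zero]
  have h1 : HasWeakDerivOn (Ioo 0 L) u.toL2 (0 : ℝ → ℂ) :=
    (dx_spec u.toL2_mem.1).congr ae_eq_rfl (by
      change (u.D : ℝ → ℂ) =ᵐ[_] _
      rw [h]
      exact Lp.coeFn_zero _ _ _)
  exact Lp.ext ((h1.ae_zero u.toL2.loc u.toL2_mem.2).trans (Lp.coeFn_zero _ _ _).symm)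

noncomputable instance core : InnerProductSpace.Core ℂ (HL1 L) where
  inner u v := inner ℂ u.D v.D
  conj_inner_symm u v := inner_conj_symm _ _
  re_inner_nonneg u := inner_self_nonneg
  add_left u v w := by rw [map_add, inner_add_left]
  smul_left u v c := by rw [map_smul, inner_smul_left]
  definite u h := eq_zero_of_D (inner_self_eq_zero.1 h)

noncomputable instance : NormedAddCommGroup (HL1 L) := core.toNormedAddCommGroup
noncomputable instance : InnerProductSpace ℂ (HL1 L) := .ofCore core.toCore

theorem inner_def (u v : HL1 L) : inner ℂ u v = inner ℂ u.D v.D := rfl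

/-- The derivative as a linear isometry. -/
noncomputable def Dᵢ : HL1 L →ₗᵢ[ℂ] L2 L := D.isometryOfInner fun u v => (inner_def u v).symm

end HL1

/-- The functions in `H¹_L(0, L)` that also vanish at `L`, as a subspace of `H¹_L(0, L)`. -/
noncomputable def H01Set (L : ℝ) : Submodule ℂ (HL1 L) where
  carrier := {u | TraceZero L u.toL2}
  zero_mem' := TraceZero.zero L
  add_mem' := fun h h' => TraceZero.add h h'
  smul_mem' := fun c _ h => TraceZero.smul c h

/-- The space `H¹_0(0, L) = {u ∈ H¹(0, L) : u(0) = u(L) = 0}`, with the inner product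
`⟨u, v⟩ = ⟨u_x, v_x⟩_{L²}` of `H¹_L(0, L)`. -/
def H01 (L : ℝ) : Type := H01Set L

namespace H01

variable {L : ℝ}

noncomputable instance : NormedAddCommGroup (H01 L) :=
  inferInstanceAs (NormedAddCommGroup (H01Set L))
noncomputable instance : InnerProductSpace ℂ (H01 L) :=
  inferInstanceAs (InnerProductSpace ℂ (H01Set L))

/-- The inclusion of `H¹_0(0, L)` into `H¹_L(0, L)`. -/
noncomputable def toHL1 : H01 L →ₗᵢ[ℂ] HL1 L := (H01Set L).subtypeₗᵢ

/-- The inclusion of `H¹_0(0, L)` into `L²(0, L)`. -/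
noncomputable def toL2 : H01 L →ₗ[ℂ] L2 L := HL1.toL2.comp toHL1.toLinearMap

theorem toL2_mem (w : H01 L) : w.toL2 ∈ HL1Sub L := w.1.2

theorem toL2_injective : Function.Injective (toL2 : H01 L → L2 L) :=
  HL1.toL2_injective.comp toHL1.injective

end H01

/-- `H¹_0(0, L)`, as a subspace of `L²(0, L)`. -/
def H01Sub (L : ℝ) : Submodule ℂ (L2 L) where
  carrier := {u | u ∈ H1 L ∧ TraceZero 0 u ∧ TraceZero L u}
  zero_mem' := ⟨zero_mem _, TraceZero.zero 0, TraceZero.zero L⟩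
  add_mem' := fun h h' => ⟨add_mem h.1 h'.1, h.2.1.add h'.2.1, h.2.2.add h'.2.2⟩
  smul_mem' := fun c _ h => ⟨(H1 L).smul_mem c h.1, h.2.1.smul c, h.2.2.smul c⟩

/-- An element of `L²(0, L)` that lies in `H¹_0(0, L)`. -/
noncomputable def H01.mk {L : ℝ} (u : L2 L) (h : u ∈ H01Sub L) : H01 L :=
  ⟨HL1.mk u ⟨h.1, h.2.1⟩, h.2.2⟩

@[simp] theorem H01.toL2_mk {L : ℝ} (u : L2 L) (h : u ∈ H01Sub L) : (H01.mk u h).toL2 = u := rfl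

theorem H01.mk_add {L : ℝ} (u v : L2 L) (h : u ∈ H01Sub L) (h' : v ∈ H01Sub L)
    (h'' : u + v ∈ H01Sub L) : H01.mk (u + v) h'' = H01.mk u h + H01.mk v h' :=
  H01.toL2_injective (by rw [map_add]; rfl)

theorem H01.mk_smul {L : ℝ} (a : ℂ) (u : L2 L) (h : u ∈ H01Sub L) (h' : a • u ∈ H01Sub L) :
    H01.mk (a • u) h' = a • H01.mk u h :=
  H01.toL2_injective (by rw [map_smul]; rfl)

/-! ### Completeness of `H¹_0(0, L)` -/

theorem exists_primitive {L : ℝ} (g : L2 L) :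
    ∃ (G : ℝ → ℂ) (u : L2 L), Continuous G ∧ G 0 = 0 ∧ G L = (∫ t in Ioo 0 L, g t) ∧
      u =ᵐ[volume.restrict (Ioo 0 L)] G ∧ HasWeakDerivOn (Ioo 0 L) u g := by
  rcases le_or_gt L 0 with hL | hL
  · have h0 : Ioo 0 L = ∅ := Ioo_eq_empty_of_le hL
    refine ⟨0, 0, continuous_const, rfl, by simp [h0], ae_eq_of_nonpos hL _ _,
      fun φ _ => by simp [h0]⟩
  set k : ℝ → ℂ := (Ioo 0 L).indicator g with hk
  have hki : Integrable k := (integrable_indicator_iff measurableSet_Ioo).2 g.integrable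
  let G : ℝ → ℂ := fun x => ∫ t in (0 : ℝ)..x, k t
  have hGc : Continuous G :=
    intervalIntegral.continuous_primitive (fun _ _ => hki.intervalIntegrable) 0
  have hGeq : ∀ x ∈ Ioo 0 L, ∫ t in Ioo 0 L, (Iio x).indicator g t = G x := by
    intro x hx
    simp only [G, hk]
    rw [intervalIntegral.integral_of_le hx.1.le, integral_Ioc_eq_integral_Ioo,
      setIntegral_indicator measurableSet_Iio, setIntegral_indicator measurableSet_Ioo]
    congr 2
    ext t
    simp only [mem_inter_iff, mem_Ioo, mem_Iio]
    tauto
  have hGm : MemLp G 2 (volume.restrict (Ioo 0 L)) := by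
    obtain ⟨C, hC⟩ := isCompact_Icc.exists_bound_of_continuousOn (hGc.continuousOn (s := Icc 0 L))
    exact MemLp.of_bound hGc.aestronglyMeasurable C
      ((ae_restrict_mem measurableSet_Ioo).mono fun x hx => hC x (Ioo_subset_Icc_self hx))
  refine ⟨G, hGm.toLp, hGc, by simp [G], ?_, hGm.coeFn_toLp, ?_⟩
  · simp only [G, hk]
    rw [intervalIntegral.integral_of_le hL.le, integral_Ioc_eq_integral_Ioo,
      setIntegral_indicator measurableSet_Ioo, inter_self]
  · refine (hasWeakDerivOn_primitive (E := ℂ) g.integrable).congr ?_ ae_eq_rfl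
    refine EventuallyEq.trans ?_ hGm.coeFn_toLp.symm
    filter_upwards [ae_restrict_mem measurableSet_Ioo] with x hx using hGeq x hx

theorem HL1.Dᵢ_surjective {L : ℝ} : Function.Surjective (HL1.Dᵢ (L := L)) := by
  intro g
  obtain ⟨G, u, hc, h0, -, hu, hd⟩ := exists_primitive g
  exact ⟨HL1.mk u ⟨⟨g, hd⟩, G, hc.continuousOn, hu.symm, h0⟩, dx_eq hd⟩

instance {L : ℝ} : CompleteSpace (HL1 L) :=
  (LinearIsometryEquiv.ofSurjective HL1.Dᵢ HL1.Dᵢ_surjective).toIsometryEquiv.completeSpace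

/-- `u ∈ H¹_L(0, L)` vanishes at `L` if and only if the integral of `u_x` is zero. -/
theorem mem_H01Set_iff {L : ℝ} (hL : 0 < L) (u : HL1 L) :
    u ∈ H01Set L ↔ ∫ t in Ioo 0 L, u.D t = 0 := by
  obtain ⟨G, v, hc, h0, h1, hv, hd⟩ := exists_primitive u.D
  have huv : u = HL1.mk v ⟨⟨_, hd⟩, G, hc.continuousOn, hv.symm, h0⟩ := by
    apply HL1.Dᵢ.injective
    exact (dx_eq hd).symm
  rw [← h1]
  have hu : u.toL2 = v := by rw [huv]; rfl
  constructor
  · rintro ⟨f, hfc, hfe, hfz⟩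
    rw [hu] at hfe
    have h2 : EqOn f G (Ioo 0 L) := Measure.eqOn_open_of_ae_eq (hfe.trans hv) isOpen_Ioo
      (hfc.mono (subset_insert _ _)) hc.continuousOn
    have h3 : EqOn f G (insert L (Ioo 0 L)) :=
      h2.of_subset_closure hfc hc.continuousOn (subset_insert _ _)
        (by rw [closure_Ioo hL.ne]
            exact insert_subset (right_mem_Icc.2 hL.le) Ioo_subset_Icc_self)
    rw [← h3 (mem_insert _ _), hfz]
  · intro h
    refine ⟨G, hc.continuousOn, ?_, h⟩
    rw [hu]
    exact hv.symm

instance {L : ℝ} : CompleteSpace (H01 L) := by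
  rcases le_or_gt L 0 with hL | hL
  · have : (H01Set L : Set (HL1 L)) = univ :=
      eq_univ_of_forall fun u => ⟨0, continuousOn_const, ae_eq_of_nonpos hL _ _, rfl⟩
    have := (this ▸ isClosed_univ : IsClosed (H01Set L : Set (HL1 L))).completeSpace_coe
    exact this
  · have hcl : IsClosed (H01Set L : Set (HL1 L)) := by
      have : (H01Set L : Set (HL1 L)) = {u | (inner ℂ ((memLp_const (1 : ℂ)).toLp
          (fun _ : ℝ => (1 : ℂ)) : L2 L) (HL1.Dᵢ u) : ℂ) = 0} := by
        ext u
        rw [SetLike.mem_coe, mem_H01Set_iff hL, mem_ofPred_eq, L2.inner_def]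
        have : ∫ t in Ioo 0 L, u.D t = ∫ t in Ioo 0 L, inner ℂ (((memLp_const (1 : ℂ)).toLp
          (fun _ : ℝ => (1 : ℂ)) : L2 L) t) (HL1.Dᵢ u t) := by
          refine integral_congr_ae ?_
          filter_upwards [(memLp_const (μ := volume.restrict (Ioo 0 L)) (p := 2) (1 : ℂ)).coeFn_toLp]
            with t ht
          rw [ht]
          simp
          rfl
        rw [this]
      rw [this]
      exact isClosed_eq (continuous_const.inner HL1.Dᵢ.continuous) continuous_const
    have := hcl.completeSpace_coe
    exact this

/-! ### The memory space -/

/-- The hypothesis (H) on the memory kernel `σ : (0, ∞) → [0, ∞)`: it is integrable with positive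
integral `g(0)`, of class `C¹` on `(0, ∞)`, has a finite limit at `0⁺`, and satisfies the Dafermos
condition `σ' ≤ -d σ` for some constant `d > 0`. Values of `σ` off `(0, ∞)` play no role. -/
structure ConditionH (σ : ℝ → ℝ) : Prop where
  nonneg : ∀ s, 0 < s → 0 ≤ σ s
  integrable : IntegrableOn σ (Ioi 0)
  contDiff : ContDiffOn ℝ 1 σ (Ioi 0)
  integral_pos : 0 < ∫ r in Ioi 0, σ r
  limit_zero : ∃ l : ℝ, Tendsto σ (𝓝[>] 0) (𝓝 l)
  dafermos : ∃ d : ℝ, 0 < d ∧ ∀ s, 0 < s → deriv σ s ≤ -d * σ s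

/-- The measure `σ(s) ds` on `(0, ∞)`. -/
noncomputable def memMeasure (σ : ℝ → ℝ) : Measure ℝ :=
  (volume.restrict (Ioi 0)).withDensity fun s => ENNReal.ofReal (σ s)

/-- The part of `(0, ∞)` on which `σ` is positive. It is all that the measure `σ(s) ds` sees. -/
def memSupport (σ : ℝ → ℝ) : Set ℝ := {s | 0 < s ∧ 0 < σ s}

/-- The memory space `W = L²_σ((0, ∞); H¹_0(0, L))`. -/
abbrev W (L : ℝ) (σ : ℝ → ℝ) : Type := Lp (H01 L) 2 (memMeasure σ)

theorem ConditionH.isFiniteMeasure {σ : ℝ → ℝ} (hσ : ConditionH σ) :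
    IsFiniteMeasure (memMeasure σ) :=
  isFiniteMeasure_withDensity_ofReal hσ.integrable.2

theorem ConditionH.isOpen_memSupport {σ : ℝ → ℝ} (hσ : ConditionH σ) : IsOpen (memSupport σ) :=
  hσ.contDiff.continuousOn.isOpen_inter_preimage isOpen_Ioi isOpen_Ioi

theorem ConditionH.ae_memMeasure {σ : ℝ → ℝ} (hσ : ConditionH σ) :
    ae (memMeasure σ) = ae (volume.restrict (memSupport σ)) := by
  ext t
  have h1 : t ∈ ae (memMeasure σ) ↔ ∀ᵐ x ∂(memMeasure σ), x ∈ t := Iff.rfl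
  have h2 : t ∈ ae (volume.restrict (memSupport σ)) ↔
    ∀ᵐ x ∂(volume.restrict (memSupport σ)), x ∈ t := Iff.rfl
  rw [h1, h2, ae_restrict_iff' hσ.isOpen_memSupport.measurableSet, memMeasure,
    ae_withDensity_iff' hσ.integrable.aestronglyMeasurable.aemeasurable.ennreal_ofReal,
    ae_restrict_iff' measurableSet_Ioi]
  refine eventually_congr (Eventually.of_forall fun x => ?_)
  simp [memSupport]

theorem W.loc {L : ℝ} {σ : ℝ → ℝ} (hσ : ConditionH σ) (η : W L σ) :
    LocallyIntegrableOn η (memSupport σ) (volume.restrict (memSupport σ)) := by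
  rw [locallyIntegrableOn_iff hσ.isOpen_memSupport.isLocallyClosed]
  intro K hKs hK
  rcases K.eq_empty_or_nonempty with rfl | hne
  · exact integrableOn_empty
  have hKi : K ⊆ Ioi 0 := fun x hx => (hKs hx).1
  obtain ⟨x₀, hx₀, hmin⟩ := hK.exists_isMinOn hne (hσ.contDiff.continuousOn.mono hKi)
  have hpos : 0 < σ x₀ := (hKs hx₀).2
  have hle : (volume.restrict (memSupport σ)).restrict K ≤
      (ENNReal.ofReal (σ x₀))⁻¹ • memMeasure σ := by
    rw [Measure.restrict_restrict hK.measurableSet, inter_eq_left.2 hKs]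
    refine Measure.le_iff.2 fun s hs => ?_
    rw [Measure.smul_apply, smul_eq_mul, memMeasure, withDensity_apply _ hs,
      ← ENNReal.div_eq_inv_mul, ENNReal.le_div_iff_mul_le (Or.inl (by simpa using hpos))
        (Or.inl ENNReal.ofReal_ne_top), Measure.restrict_restrict hs, Measure.restrict_apply hs]
    calc volume (s ∩ K) * ENNReal.ofReal (σ x₀)
        = ∫⁻ _ in s ∩ K, ENNReal.ofReal (σ x₀) := by rw [setLIntegral_const, mul_comm]
      _ ≤ ∫⁻ x in s ∩ K, ENNReal.ofReal (σ x) :=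
          setLIntegral_mono' (hs.inter hK.measurableSet) fun x hx =>
            ENNReal.ofReal_le_ofReal (hmin hx.2)
      _ ≤ ∫⁻ x in s ∩ Ioi 0, ENNReal.ofReal (σ x) :=
          lintegral_mono_set (inter_subset_inter_right _ hKi)
  have h2 : MemLp η 2 ((volume.restrict (memSupport σ)).restrict K) :=
    (Lp.memLp η).of_measure_le_smul (by simpa using hpos) hle
  have : IsFiniteMeasure ((volume.restrict (memSupport σ)).restrict K) :=
    ⟨by
      rw [Measure.restrict_apply_univ]
      exact (Measure.restrict_apply_le _ _).trans_lt hK.measure_lt_top⟩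
  exact h2.integrable (by norm_num)

/-- `ζ ∈ W` is the weak derivative `η_s` of `η ∈ W` with respect to `s`. -/
def HasDs {L : ℝ} {σ : ℝ → ℝ} (η ζ : W L σ) : Prop := HasWeakDerivOn (memSupport σ) η ζ

open Classical in
/-- The weak derivative `η_s ∈ W` of `η ∈ W` (zero by convention if there is none in `W`). -/
noncomputable def ds {L : ℝ} {σ : ℝ → ℝ} (η : W L σ) : W L σ :=
  if h : ∃ ζ, HasDs η ζ then h.choose else 0

theorem ds_spec {L : ℝ} {σ : ℝ → ℝ} {η : W L σ} (h : ∃ ζ, HasDs η ζ) : HasDs η (ds η) := by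
  unfold ds
  rw [dif_pos h]
  exact h.choose_spec

theorem W.ae_restrict {L : ℝ} {σ : ℝ → ℝ} (hσ : ConditionH σ) {f g : ℝ → H01 L}
    (h : f =ᵐ[memMeasure σ] g) : f =ᵐ[volume.restrict (memSupport σ)] g := by
  rwa [EventuallyEq, ← hσ.ae_memMeasure]

theorem ds_eq {L : ℝ} {σ : ℝ → ℝ} (hσ : ConditionH σ) {η ζ : W L σ} (h : HasDs η ζ) : ds η = ζ := by
  apply Lp.ext
  rw [EventuallyEq, hσ.ae_memMeasure]
  exact HasWeakDerivOn.unique hσ.isOpen_memSupport (W.loc hσ _) (W.loc hσ _) (ds_spec ⟨ζ, h⟩) h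

theorem HasDs.add {L : ℝ} {σ : ℝ → ℝ} (hσ : ConditionH σ) {η ζ η' ζ' : W L σ} (h : HasDs η ζ) (h' : HasDs η' ζ') :
    HasDs (η + η') (ζ + ζ') :=
  (HasWeakDerivOn.add (W.loc hσ _) (W.loc hσ _) (W.loc hσ _) (W.loc hσ _) h h').congr
    (W.ae_restrict hσ (Lp.coeFn_add _ _).symm) (W.ae_restrict hσ (Lp.coeFn_add _ _).symm)

theorem HasDs.smul {L : ℝ} {σ : ℝ → ℝ} (hσ : ConditionH σ) (c : ℂ) {η ζ : W L σ} (h : HasDs η ζ) : HasDs (c • η) (c • ζ) :=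
  (HasWeakDerivOn.smul c h).congr
    (W.ae_restrict hσ (Lp.coeFn_smul _ _).symm) (W.ae_restrict hσ (Lp.coeFn_smul _ _).symm)

theorem HasDs.zero {L : ℝ} {σ : ℝ → ℝ} (hσ : ConditionH σ) : HasDs (0 : W L σ) 0 :=
  HasWeakDerivOn.congr (f := 0) (g := 0) (fun φ _ => by simp)
    (W.ae_restrict hσ (Lp.coeFn_zero _ _ _).symm) (W.ae_restrict hσ (Lp.coeFn_zero _ _ _).symm)

/-- `η(·, 0) = 0`, in the sense of traces at `s = 0`. -/
def InitZero {L : ℝ} {σ : ℝ → ℝ} (η : W L σ) : Prop := VanishesAt (memSupport σ) 0 η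

/-- `Λ¹ = ∫₀^∞ σ(s) η(s) ds`, an integral in `H¹_0(0, L)`. -/
noncomputable def Lam {L : ℝ} {σ : ℝ → ℝ} (η : W L σ) : H01 L := ∫ s, η s ∂(memMeasure σ)

theorem W.integrable {L : ℝ} {σ : ℝ → ℝ} (hσ : ConditionH σ) (η : W L σ) :
    Integrable η (memMeasure σ) :=
  haveI := hσ.isFiniteMeasure
  (Lp.memLp η).integrable (by norm_num)

theorem Lam_add {L : ℝ} {σ : ℝ → ℝ} (hσ : ConditionH σ) (η η' : W L σ) :
    Lam (η + η') = Lam η + Lam η' := by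
  simp only [Lam]
  rw [integral_congr_ae (Lp.coeFn_add η η')]
  exact integral_add (W.integrable hσ η) (W.integrable hσ η')

theorem Lam_smul {L : ℝ} {σ : ℝ → ℝ} (c : ℂ) (η : W L σ) : Lam (c • η) = c • Lam η := by
  simp only [Lam]
  rw [integral_congr_ae (Lp.coeFn_smul c η)]
  exact integral_smul c _

/-- An element `w` of `H¹_0(0, L)`, as the function of `s` with constant value `w`, in `W`. -/
noncomputable def constW {L : ℝ} {σ : ℝ → ℝ} (hσ : ConditionH σ) : H01 L →ₗ[ℂ] W L σ :=
  haveI := hσ.isFiniteMeasure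
  Lp.constₗ 2 (memMeasure σ) ℂ

/-! ### The energy space -/

/-- The physical constants: the length `L`, the mass density `ρ`, and the
coefficients `α₁`, `β`, `μ`, `c`, all positive, and the coupling constants `γ`, `δ`, nonzero. -/
structure Params where
  (L ρ α₁ β μ c γ δ : ℝ)
  L_pos : 0 < L
  ρ_pos : 0 < ρ
  α₁_pos : 0 < α₁
  β_pos : 0 < β
  μ_pos : 0 < μ
  c_pos : 0 < c
  γ_ne : γ ≠ 0
  δ_ne : δ ≠ 0

/-- The elastic stiffness `α = α₁ + γ² β`. -/
def Params.α (p : Params) : ℝ := p.α₁ + p.γ ^ 2 * p.β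

/-- The energy space `ℋ = (H¹_L × L²)² × L² × W`; its elements are `U = (u, v, y, z, w, η)`. -/
def State (p : Params) (σ : ℝ → ℝ) : Type :=
  HL1 p.L × L2 p.L × HL1 p.L × L2 p.L × L2 p.L × W p.L σ

namespace State

variable {p : Params} {σ : ℝ → ℝ}

noncomputable instance : AddCommGroup (State p σ) :=
  inferInstanceAs (AddCommGroup (HL1 p.L × L2 p.L × HL1 p.L × L2 p.L × L2 p.L × W p.L σ))
noncomputable instance : Module ℂ (State p σ) :=
  inferInstanceAs (Module ℂ (HL1 p.L × L2 p.L × HL1 p.L × L2 p.L × L2 p.L × W p.L σ))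

/-- The state `(u, v, y, z, w, η)`. -/
def mk (u : HL1 p.L) (v : L2 p.L) (y : HL1 p.L) (z w : L2 p.L) (η : W p.L σ) : State p σ :=
  (u, v, y, z, w, η)

/-- The component `u`. -/
def u (U : State p σ) : HL1 p.L := U.1
/-- The component `v`. -/
def v (U : State p σ) : L2 p.L := U.2.1
/-- The component `y`. -/
def y (U : State p σ) : HL1 p.L := U.2.2.1
/-- The component `z`. -/
def z (U : State p σ) : L2 p.L := U.2.2.2.1
/-- The component `w`. -/
def w (U : State p σ) : L2 p.L := U.2.2.2.2.1
/-- The component `η`. -/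
def η (U : State p σ) : W p.L σ := U.2.2.2.2.2

@[ext] theorem ext {U V : State p σ} (h1 : U.u = V.u) (h2 : U.v = V.v) (h3 : U.y = V.y)
    (h4 : U.z = V.z) (h5 : U.w = V.w) (h6 : U.η = V.η) : U = V :=
  Prod.ext h1 (Prod.ext h2 (Prod.ext h3 (Prod.ext h4 (Prod.ext h5 h6))))

@[simp] theorem u_zero : (0 : State p σ).u = 0 := rfl
@[simp] theorem v_zero : (0 : State p σ).v = 0 := rfl
@[simp] theorem y_zero : (0 : State p σ).y = 0 := rfl
@[simp] theorem z_zero : (0 : State p σ).z = 0 := rfl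
@[simp] theorem w_zero : (0 : State p σ).w = 0 := rfl
@[simp] theorem η_zero : (0 : State p σ).η = 0 := rfl
@[simp] theorem u_add (U V : State p σ) : (U + V).u = U.u + V.u := rfl
@[simp] theorem v_add (U V : State p σ) : (U + V).v = U.v + V.v := rfl
@[simp] theorem y_add (U V : State p σ) : (U + V).y = U.y + V.y := rfl
@[simp] theorem z_add (U V : State p σ) : (U + V).z = U.z + V.z := rfl
@[simp] theorem w_add (U V : State p σ) : (U + V).w = U.w + V.w := rfl
@[simp] theorem η_add (U V : State p σ) : (U + V).η = U.η + V.η := rfl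
@[simp] theorem u_smul (a : ℂ) (U : State p σ) : (a • U).u = a • U.u := rfl
@[simp] theorem v_smul (a : ℂ) (U : State p σ) : (a • U).v = a • U.v := rfl
@[simp] theorem y_smul (a : ℂ) (U : State p σ) : (a • U).y = a • U.y := rfl
@[simp] theorem z_smul (a : ℂ) (U : State p σ) : (a • U).z = a • U.z := rfl
@[simp] theorem w_smul (a : ℂ) (U : State p σ) : (a • U).w = a • U.w := rfl
@[simp] theorem η_smul (a : ℂ) (U : State p σ) : (a • U).η = a • U.η := rfl
@[simp] theorem u_mk (u v y z w) (η : W p.L σ) : (mk u v y z w η : State p σ).u = u := rfl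
@[simp] theorem v_mk (u v y z w) (η : W p.L σ) : (mk u v y z w η : State p σ).v = v := rfl
@[simp] theorem y_mk (u v y z w) (η : W p.L σ) : (mk u v y z w η : State p σ).y = y := rfl
@[simp] theorem z_mk (u v y z w) (η : W p.L σ) : (mk u v y z w η : State p σ).z = z := rfl
@[simp] theorem w_mk (u v y z w) (η : W p.L σ) : (mk u v y z w η : State p σ).w = w := rfl
@[simp] theorem η_mk (u v y z w) (η : W p.L σ) : (mk u v y z w η : State p σ).η = η := rfl

/-- The energy inner product on `ℋ` (conjugate-linear in the first variable, as in Mathlib). -/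
noncomputable def energyInner (U V : State p σ) : ℂ :=
  p.ρ * inner ℂ U.v V.v + p.α₁ * inner ℂ U.u.D V.u.D + p.μ * inner ℂ U.z V.z
    + p.β * inner ℂ ((p.γ : ℂ) • U.u.D - U.y.D) ((p.γ : ℂ) • V.u.D - V.y.D)
    + inner ℂ U.w V.w + p.c * inner ℂ U.η V.η

theorem energyInner_self (U : State p σ) : energyInner U U =
    ((p.ρ * ‖U.v‖ ^ 2 + p.α₁ * ‖U.u.D‖ ^ 2 + p.μ * ‖U.z‖ ^ 2
      + p.β * ‖(p.γ : ℂ) • U.u.D - U.y.D‖ ^ 2 + ‖U.w‖ ^ 2 + p.c * ‖U.η‖ ^ 2 : ℝ) : ℂ) := by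
  simp only [energyInner, inner_self_eq_norm_sq_to_K]
  push_cast
  rfl

noncomputable instance core : InnerProductSpace.Core ℂ (State p σ) where
  inner := energyInner
  conj_inner_symm U V := by
    simp only [energyInner, map_add, map_mul, Complex.conj_ofReal, inner_conj_symm]
  re_inner_nonneg U := by
    rw [energyInner_self]
    have := p.ρ_pos; have := p.α₁_pos; have := p.β_pos; have := p.μ_pos; have := p.c_pos
    have h : 0 ≤ p.ρ * ‖U.v‖ ^ 2 + p.α₁ * ‖U.u.D‖ ^ 2 + p.μ * ‖U.z‖ ^ 2
      + p.β * ‖(p.γ : ℂ) • U.u.D - U.y.D‖ ^ 2 + ‖U.w‖ ^ 2 + p.c * ‖U.η‖ ^ 2 := by positivity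
    exact h
  add_left U V X := by
    have h : (p.γ : ℂ) • (U + V).u.D - (U + V).y.D =
        ((p.γ : ℂ) • U.u.D - U.y.D) + ((p.γ : ℂ) • V.u.D - V.y.D) := by
      simp only [u_add, y_add, map_add]
      module
    simp only [energyInner, h]
    simp only [u_add, v_add, z_add, w_add, η_add, map_add, inner_add_left]
    ring
  smul_left U V a := by
    have h : (p.γ : ℂ) • (a • U).u.D - (a • U).y.D = a • ((p.γ : ℂ) • U.u.D - U.y.D) := by
      simp only [u_smul, y_smul, map_smul]
      module
    simp only [energyInner, h]
    simp only [u_smul, v_smul, z_smul, w_smul, η_smul, map_smul, inner_smul_left]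
    ring
  definite U h := by
    change energyInner U U = 0 at h
    rw [energyInner_self, Complex.ofReal_eq_zero] at h
    have := p.ρ_pos; have := p.α₁_pos; have := p.β_pos; have := p.μ_pos; have := p.c_pos
    have h1 : 0 ≤ p.ρ * ‖U.v‖ ^ 2 := by positivity
    have h2 : 0 ≤ p.α₁ * ‖U.u.D‖ ^ 2 := by positivity
    have h3 : 0 ≤ p.μ * ‖U.z‖ ^ 2 := by positivity
    have h4 : 0 ≤ p.β * ‖(p.γ : ℂ) • U.u.D - U.y.D‖ ^ 2 := by positivity
    have h5 : 0 ≤ ‖U.w‖ ^ 2 := by positivity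
    have h6 : 0 ≤ p.c * ‖U.η‖ ^ 2 := by positivity
    have key : ∀ {X : Type} [NormedAddCommGroup X] {r : ℝ} {x : X}, 0 < r → r * ‖x‖ ^ 2 = 0 →
        x = 0 := by
      intro X _ r x hr hx
      simpa [hr.ne'] using hx
    have hu : U.u.D = 0 := key p.α₁_pos (by linarith)
    have hy : (p.γ : ℂ) • U.u.D - U.y.D = 0 := key p.β_pos (by linarith)
    rw [hu, smul_zero, zero_sub, neg_eq_zero] at hy
    exact ext (HL1.eq_zero_of_D hu) (key p.ρ_pos (by linarith)) (HL1.eq_zero_of_D hy)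
      (key p.μ_pos (by linarith)) (key (x := U.w) one_pos (by linarith)) (key (x := U.η) p.c_pos (by linarith))

noncomputable instance : NormedAddCommGroup (State p σ) := core.toNormedAddCommGroup
noncomputable instance : InnerProductSpace ℂ (State p σ) := .ofCore core.toCore

theorem inner_def (U V : State p σ) : inner ℂ U V = energyInner U V := rfl

end State

/-! ### The operator `𝒜₁` and its resolvent set -/

/-- The domain of `𝒜₁`: `v, z ∈ H¹_L`, `u, y ∈ H²` with `u_x(L) = y_x(L) = 0`, `w ∈ H¹_0`,
`Λ¹_x ∈ H¹`, `η_s ∈ W` and `η(·, 0) = 0`. -/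
noncomputable def domA {p : Params} {σ : ℝ → ℝ} (hσ : ConditionH σ) :
    Submodule ℂ (State p σ) where
  carrier := {U | U.v ∈ HL1Sub p.L ∧ U.z ∈ HL1Sub p.L
    ∧ (dx U.u.toL2 ∈ H1 p.L ∧ TraceZero p.L (dx U.u.toL2))
    ∧ (dx U.y.toL2 ∈ H1 p.L ∧ TraceZero p.L (dx U.y.toL2))
    ∧ U.w ∈ H01Sub p.L ∧ dx ((Lam U.η).toL2) ∈ H1 p.L
    ∧ (∃ ζ, HasDs U.η ζ) ∧ InitZero U.η}
  zero_mem' := by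
    have h0 : dx (0 : L2 p.L) = 0 := by
      simpa using dx_smul (0 : ℂ) (zero_mem (H1 p.L))
    have h1 : Lam (0 : W p.L σ) = 0 := by simpa using Lam_smul (0 : ℂ) (0 : W p.L σ)
    refine ⟨zero_mem _, zero_mem _, ?_, ?_, zero_mem _, ?_, ⟨0, HasDs.zero hσ⟩, ?_⟩
    · simp only [State.u_zero, map_zero, h0]
      exact ⟨zero_mem _, TraceZero.zero _⟩
    · simp only [State.y_zero, map_zero, h0]
      exact ⟨zero_mem _, TraceZero.zero _⟩
    · simp only [State.η_zero, h1, map_zero, h0]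
      exact zero_mem _
    · exact (VanishesAt.zero _ _).congr (W.ae_restrict hσ (Lp.coeFn_zero _ _ _).symm)
  add_mem' := by
    rintro U V ⟨h1, h2, h3, h4, h5, h6, ⟨ζ, h7⟩, h8⟩ ⟨k1, k2, k3, k4, k5, k6, ⟨ζ', k7⟩, k8⟩
    refine ⟨add_mem h1 k1, add_mem h2 k2, ?_, ?_, add_mem h5 k5, ?_,
      ⟨ζ + ζ', HasDs.add hσ h7 k7⟩, ?_⟩
    · rw [State.u_add, map_add, dx_add U.u.toL2_mem.1 V.u.toL2_mem.1]
      exact ⟨add_mem h3.1 k3.1, h3.2.add k3.2⟩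
    · rw [State.y_add, map_add, dx_add U.y.toL2_mem.1 V.y.toL2_mem.1]
      exact ⟨add_mem h4.1 k4.1, h4.2.add k4.2⟩
    · rw [State.η_add, Lam_add hσ, map_add,
        dx_add (Lam U.η).toL2_mem.1 (Lam V.η).toL2_mem.1]
      exact add_mem h6 k6
    · exact (VanishesAt.add h8 k8).congr (W.ae_restrict hσ (Lp.coeFn_add _ _).symm)
  smul_mem' := by
    rintro a U ⟨h1, h2, h3, h4, h5, h6, ⟨ζ, h7⟩, h8⟩
    refine ⟨Submodule.smul_mem _ a h1, Submodule.smul_mem _ a h2, ?_, ?_,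
      Submodule.smul_mem _ a h5, ?_, ⟨a • ζ, HasDs.smul hσ a h7⟩, ?_⟩
    · rw [State.u_smul, map_smul, dx_smul a U.u.toL2_mem.1]
      exact ⟨Submodule.smul_mem _ a h3.1, h3.2.smul a⟩
    · rw [State.y_smul, map_smul, dx_smul a U.y.toL2_mem.1]
      exact ⟨Submodule.smul_mem _ a h4.1, h4.2.smul a⟩
    · rw [State.η_smul, Lam_smul, map_smul, dx_smul a (Lam U.η).toL2_mem.1]
      exact Submodule.smul_mem _ a h6
    · exact (VanishesAt.smul a h8).congr (W.ae_restrict hσ (Lp.coeFn_smul _ _).symm)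

/-- The value of the operator `𝒜₁`:
`𝒜₁ (u, v, y, z, w, η) = (v, ρ⁻¹ (α u_xx - γ β y_xx - δ w_x), z, μ⁻¹ (β y_xx - γ β u_xx),
c Λ¹_xx - δ v_x, -η_s + w)`. -/
noncomputable def A₁Fun {p : Params} {σ : ℝ → ℝ} (hσ : ConditionH σ)
    (U : domA (p := p) hσ) : State p σ := .mk
  (HL1.mk U.1.v U.2.1)
  ((p.ρ⁻¹ : ℂ) • ((p.α : ℂ) • dx (dx U.1.u.toL2) - (p.γ * p.β : ℂ) • dx (dx U.1.y.toL2)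
    - (p.δ : ℂ) • dx U.1.w))
  (HL1.mk U.1.z U.2.2.1)
  ((p.μ⁻¹ : ℂ) • ((p.β : ℂ) • dx (dx U.1.y.toL2) - (p.γ * p.β : ℂ) • dx (dx U.1.u.toL2)))
  ((p.c : ℂ) • dx (dx (Lam U.1.η).toL2) - (p.δ : ℂ) • dx U.1.v)
  (-ds U.1.η + constW hσ (H01.mk U.1.w U.2.2.2.2.2.1))

theorem A₁Fun_add {p : Params} {σ : ℝ → ℝ} (hσ : ConditionH σ) (U V : domA (p := p) hσ) :
    A₁Fun hσ (U + V) = A₁Fun hσ U + A₁Fun hσ V := by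
  obtain ⟨U, h1, h2, h3, h4, h5, h6, h7, h8⟩ := U
  obtain ⟨V, k1, k2, k3, k4, k5, k6, k7, k8⟩ := V
  have e1 : dx (dx (U.u.toL2 + V.u.toL2)) = dx (dx U.u.toL2) + dx (dx V.u.toL2) := by
    rw [dx_add U.u.toL2_mem.1 V.u.toL2_mem.1, dx_add h3.1 k3.1]
  have e2 : dx (dx (U.y.toL2 + V.y.toL2)) = dx (dx U.y.toL2) + dx (dx V.y.toL2) := by
    rw [dx_add U.y.toL2_mem.1 V.y.toL2_mem.1, dx_add h4.1 k4.1]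
  have e3 : dx (dx (Lam (U.η + V.η)).toL2) = dx (dx (Lam U.η).toL2) + dx (dx (Lam V.η).toL2) := by
    rw [Lam_add hσ, map_add, dx_add (Lam U.η).toL2_mem.1 (Lam V.η).toL2_mem.1, dx_add h6 k6]
  have e4 := dx_add h5.1 k5.1
  have e5 := ds_eq hσ (HasDs.add hσ (ds_spec h7) (ds_spec k7))
  have e6 := dx_add h1.1 k1.1
  ext1
  · exact HL1.mk_add _ _ _ _ _
  · simp only [A₁Fun, Submodule.coe_add, State.u_add, State.y_add, State.w_add, State.v_add,
      State.v_mk, map_add, e1, e2, e4]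
    module
  · exact HL1.mk_add _ _ _ _ _
  · simp only [A₁Fun, Submodule.coe_add, State.u_add, State.y_add, State.z_add,
      State.z_mk, map_add, e1, e2]
    module
  · simp only [A₁Fun, Submodule.coe_add, State.v_add, State.w_add, State.η_add,
      State.w_mk, e3, e6]
    module
  · simp only [A₁Fun, Submodule.coe_add, State.w_add, State.η_add, State.η_mk, e5,
      H01.mk_add _ _ h5 k5, map_add]
    abel

theorem A₁Fun_smul {p : Params} {σ : ℝ → ℝ} (hσ : ConditionH σ) (a : ℂ)
    (U : domA (p := p) hσ) : A₁Fun hσ (a • U) = a • A₁Fun hσ U := by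
  obtain ⟨U, h1, h2, h3, h4, h5, h6, h7, h8⟩ := U
  have e1 : dx (dx (a • U.u.toL2)) = a • dx (dx U.u.toL2) := by
    rw [dx_smul a U.u.toL2_mem.1, dx_smul a h3.1]
  have e2 : dx (dx (a • U.y.toL2)) = a • dx (dx U.y.toL2) := by
    rw [dx_smul a U.y.toL2_mem.1, dx_smul a h4.1]
  have e3 : dx (dx (Lam (a • U.η)).toL2) = a • dx (dx (Lam U.η).toL2) := by
    rw [Lam_smul, map_smul, dx_smul a (Lam U.η).toL2_mem.1, dx_smul a h6]
  have e4 := dx_smul a h5.1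
  have e5 := ds_eq hσ (HasDs.smul hσ a (ds_spec h7))
  have e6 := dx_smul a h1.1
  ext1
  · exact HL1.mk_smul _ _ _ _
  · simp only [A₁Fun, Submodule.coe_smul, State.u_smul, State.y_smul, State.w_smul, State.v_smul,
      State.v_mk, map_smul, e1, e2, e4]
    module
  · exact HL1.mk_smul _ _ _ _
  · simp only [A₁Fun, Submodule.coe_smul, State.u_smul, State.y_smul, State.z_smul,
      State.z_mk, map_smul, e1, e2]
    module
  · simp only [A₁Fun, Submodule.coe_smul, State.v_smul, State.w_smul, State.η_smul,
      State.w_mk, e3, e6]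
    module
  · simp only [A₁Fun, Submodule.coe_smul, State.w_smul, State.η_smul, State.η_mk, e5,
      H01.mk_smul _ _ h5, map_smul, smul_add, smul_neg]

/-- The unbounded operator `𝒜₁` on the energy space, with domain `domA`. -/
noncomputable def A₁ (p : Params) {σ : ℝ → ℝ} (hσ : ConditionH σ) :
    State p σ →ₗ.[ℂ] State p σ where
  domain := domA hσ
  toFun :=
    { toFun := A₁Fun hσ
      map_add' := A₁Fun_add hσ
      map_smul' := A₁Fun_smul hσ }

/-- The resolvent set `ρ(A)` of an unbounded operator `A`: the `z ∈ ℂ` for which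
`z I - A : D(A) → H` has a bounded everywhere defined two-sided inverse `R`. -/
def resolventSet {H : Type*} [NormedAddCommGroup H] [NormedSpace ℂ H] (A : H →ₗ.[ℂ] H) : Set ℂ :=
  {z | ∃ R : H →L[ℂ] H, (∀ F : H, ∃ h : R F ∈ A.domain, z • R F - A ⟨R F, h⟩ = F) ∧
    ∀ U : A.domain, R (z • (U : H) - A U) = U}

end Piezo

namespace Piezo

/-! ### Primitives of vector-valued integrable functions -/

section Primitive

/-! Write `z = iλ`. Two facts suffice: an a priori bound `‖U‖ ≤ C ‖(z - 𝒜₁) U‖` for each real `λ`,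
and surjectivity of `𝒜₁`. Given both, the set of `λ` for which `iλ - 𝒜₁` is onto is open (Neumann
series), closed (the bound at a limit point holds nearby with twice the constant) and contains `0`,
so it is all of `ℝ`; the bound then makes the inverse continuous (`range_subset_resolventSet`).

The a priori bound (`tendsto_zero_of_resolvent`) rests on dissipation. Integration by parts cancels
every coupling and leaves `Re⟨𝒜₁U, U⟩ = -c Re⟨η_s, η⟩` (`re_inner_A₁`). Since `σ' ≤ -dσ` and `η(0) =
0`, this is at most `-(c d / 2) ‖η‖²` (`norm_sq_le_re_inner_ds`). Let `U_n` be bounded with `F_n =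
(z - 𝒜₁) U_n → 0`. Then `η → 0`, and smallness travels through the system. Testing `η_s = w - zη +
F.η` in the variable `s` against a bump function of integral one gives `w → 0` in `H¹_0`. In the
heat equation `cΛ_xx = δ v_x + z w - F.w` the term `Λ_xx` stays bounded while `Λ_x → 0`; a trace
inequality makes `Λ_x(0)` small, and integrating the equation from `0` gives `v → 0` in `L²`. The
first wave equation then controls `αu - γβy` in `H¹`, which together with `zu → 0` controls `zy` and
hence the component `z` of the state. The second wave equation controls `βy - γβu`, and the
stiffness matrix is invertible because its determinant is `α₁β > 0`. No compactness is used, and `λ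
= 0` needs no separate treatment because nothing is ever divided by `z`.

Surjectivity of `𝒜₁` (`exists_A₁_eq`) is explicit. The first and third equations give `v` and `y_t =
z` directly, the heat equation becomes a Dirichlet problem for `Λ`, and `η` is a primitive in `s` of
a constant `w` minus the datum. The constant is adjusted to produce the required `Λ`, and the
displacements follow by inverting the stiffness matrix.

The analytic substrate is the fundamental theorem of calculus for functions with values in a Hilbert
space: a weakly differentiable function is almost everywhere a primitive `prim`. The Dafermos
condition also gives a Hardy-type inequality (`memLp_prim`) by which primitives of elements of `W`
stay in `W`. Since `σ` is nonincreasing, the set where it is positive is an initial interval of `(0,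
∞)`, on which all arguments in `s` can be truncated. -/

theorem absolutelyContinuousOnInterval_of_dist_le {X Y : Type*} [PseudoMetricSpace X]
    [PseudoMetricSpace Y] {f : ℝ → X} {g : ℝ → Y} {a b : ℝ}
    (hg : AbsolutelyContinuousOnInterval g a b)
    (h : ∀ x ∈ uIcc a b, ∀ y ∈ uIcc a b, dist (f x) (f y) ≤ dist (g x) (g y)) :
    AbsolutelyContinuousOnInterval f a b := by
  unfold AbsolutelyContinuousOnInterval at hg ⊢
  refine squeeze_zero' (Eventually.of_forall fun _ => Finset.sum_nonneg fun i _ => dist_nonneg)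
    ?_ hg
  rw [eventually_inf_principal]
  refine Eventually.of_forall fun E hE => Finset.sum_le_sum fun i hi => ?_
  exact h _ (hE.1 i hi).1 _ (hE.1 i hi).2

variable {E : Type*} [NormedAddCommGroup E] [InnerProductSpace ℂ E]

/-- The primitive of `ζ` with the value `k` at `a`. -/
noncomputable def prim (a : ℝ) (k : E) (ζ : ℝ → E) (x : ℝ) : E := k + ∫ t in a..x, ζ t

theorem prim_sub_prim {a b : ℝ} {k : E} {ζ : ℝ → E} (hζ : IntervalIntegrable ζ volume a b)
    {x y : ℝ} (hx : x ∈ uIcc a b) (hy : y ∈ uIcc a b) :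
    prim a k ζ y - prim a k ζ x = ∫ t in x..y, ζ t := by
  have h1 : IntervalIntegrable ζ volume a x :=
    hζ.mono_set (uIcc_subset_uIcc left_mem_uIcc hx)
  have h2 : IntervalIntegrable ζ volume a y :=
    hζ.mono_set (uIcc_subset_uIcc left_mem_uIcc hy)
  simp only [prim, add_sub_add_left_eq_sub]
  exact intervalIntegral.integral_interval_sub_left h2 h1

theorem norm_prim_sub_prim_le {a b : ℝ} {k : E} {ζ : ℝ → E}
    (hζ : IntervalIntegrable ζ volume a b) {x y : ℝ} (hx : x ∈ uIcc a b) (hy : y ∈ uIcc a b) :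
    ‖prim a k ζ y - prim a k ζ x‖ ≤ |∫ t in x..y, ‖ζ t‖| := by
  rw [prim_sub_prim hζ hx hy]
  exact intervalIntegral.norm_integral_le_abs_integral_norm

/-- The increments of the vector-valued primitive are dominated by those of the scalar primitive of
`‖ζ‖`, for which absolute continuity is known. -/
theorem absolutelyContinuousOnInterval_prim {a b : ℝ} {k : E} {ζ : ℝ → E}
    (hζ : IntervalIntegrable ζ volume a b) :
    AbsolutelyContinuousOnInterval (prim a k ζ) a b := by
  refine absolutelyContinuousOnInterval_of_dist_le
    (hζ.norm.absolutelyContinuousOnInterval_intervalIntegral left_mem_uIcc) fun x hx y hy => ?_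
  rw [dist_comm, dist_eq_norm, dist_comm, Real.dist_eq]
  refine (norm_prim_sub_prim_le hζ hx hy).trans_eq ?_
  rw [intervalIntegral.integral_interval_sub_left
    (hζ.norm.mono_set (uIcc_subset_uIcc left_mem_uIcc hy))
    (hζ.norm.mono_set (uIcc_subset_uIcc left_mem_uIcc hx))]

theorem ae_hasDerivAt_prim [CompleteSpace E] {a b : ℝ} {k : E} {ζ : ℝ → E}
    (hζ : IntervalIntegrable ζ volume a b) :
    ∀ᵐ x, x ∈ uIcc a b → HasDerivAt (prim a k ζ) (ζ x) x := by
  filter_upwards [hζ.ae_hasDerivAt_integral] with x hx hxab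
  exact (hx hxab a left_mem_uIcc).const_add k

/-- Both factors are bounded, so an increment of the inner product is at most `C` times an increment
of `g` plus `D` times one of `f`. This reduces vector-valued integration by parts to the scalar
fundamental theorem. -/
theorem absolutelyContinuousOnInterval_re_inner {f g : ℝ → E} {a b : ℝ}
    (hf : AbsolutelyContinuousOnInterval f a b) (hg : AbsolutelyContinuousOnInterval g a b) :
    AbsolutelyContinuousOnInterval (fun x => (inner ℂ (f x) (g x)).re) a b := by
  obtain ⟨C, hC⟩ := hf.exists_bound
  obtain ⟨D, hD⟩ := hg.exists_bound
  unfold AbsolutelyContinuousOnInterval at hf hg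
  refine squeeze_zero' (Eventually.of_forall fun _ => Finset.sum_nonneg fun i _ => dist_nonneg)
    ?_ (by simpa using (hg.const_mul C).add (hf.const_mul D))
  rw [eventually_inf_principal]
  refine Eventually.of_forall fun I hI => ?_
  rw [Finset.mul_sum, Finset.mul_sum, ← Finset.sum_add_distrib]
  refine Finset.sum_le_sum fun i hi => ?_
  obtain ⟨hx, hy⟩ := hI.1 i hi
  set x := (I.2 i).1
  set y := (I.2 i).2
  have h1 : inner ℂ (f x) (g x) - inner ℂ (f y) (g y)
      = inner ℂ (f x) (g x - g y) + inner ℂ (f x - f y) (g y) := by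
    rw [inner_sub_right, inner_sub_left]; ring
  rw [Real.dist_eq, ← Complex.sub_re, h1, dist_eq_norm, dist_eq_norm]
  refine (Complex.abs_re_le_norm _).trans ((norm_add_le _ _).trans (add_le_add ?_ ?_))
  · exact (norm_inner_le_norm _ _).trans (by gcongr; exact hC _ hx)
  · refine (norm_inner_le_norm _ _).trans ?_
    rw [mul_comm]
    gcongr
    exact hD _ hy

theorem ae_hasDerivAt_re_inner_prim [CompleteSpace E] {a b : ℝ} {k l : E} {ζ ξ : ℝ → E}
    (hζ : IntervalIntegrable ζ volume a b) (hξ : IntervalIntegrable ξ volume a b) :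
    ∀ᵐ x, x ∈ uIcc a b → HasDerivAt (fun x => (inner ℂ (prim a k ζ x) (prim a l ξ x)).re)
      ((inner ℂ (prim a k ζ x) (ξ x)).re + (inner ℂ (ζ x) (prim a l ξ x)).re) x := by
  filter_upwards [ae_hasDerivAt_prim (k := k) hζ, ae_hasDerivAt_prim (k := l) hξ] with x h1 h2 hx
  have h3 := (h1 hx).inner ℂ (h2 hx)
  have h4 := Complex.reCLM.hasFDerivAt.comp_hasDerivAt x h3
  simpa [Function.comp_def] using h4

/-- Integration by parts for the real part of the inner product of two primitives. -/
theorem integral_re_inner_prim [CompleteSpace E] {a b : ℝ} {k l : E} {ζ ξ : ℝ → E}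
    (hζ : IntervalIntegrable ζ volume a b) (hξ : IntervalIntegrable ξ volume a b) :
    ∫ x in a..b, ((inner ℂ (prim a k ζ x) (ξ x)).re + (inner ℂ (ζ x) (prim a l ξ x)).re)
      = (inner ℂ (prim a k ζ b) (prim a l ξ b)).re - (inner ℂ k l).re := by
  have h := (absolutelyContinuousOnInterval_re_inner
    (absolutelyContinuousOnInterval_prim (k := k) hζ)
    (absolutelyContinuousOnInterval_prim (k := l) hξ)).integral_deriv_eq_sub
  have h0 : ∀ k : E, ∀ ζ : ℝ → E, prim a k ζ a = k := fun k ζ => by simp [prim]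
  simp only [h0] at h
  rw [← h]
  refine intervalIntegral.integral_congr_ae ?_
  filter_upwards [ae_hasDerivAt_re_inner_prim (k := k) (l := l) hζ hξ] with x hx hxab
  exact (hx (uIoc_subset_uIcc hxab)).deriv.symm

/-- The weighted energy inequality: if `σ' ≤ -d σ` on `[a, b]`, then the weight `σ` makes the
derivative accretive, up to a boundary term at `a`. -/
theorem weighted_energy_le [CompleteSpace E] {a b d : ℝ} (hab : a ≤ b) {σ : ℝ → ℝ} {k : E}
    {ζ : ℝ → E} (hσ : ContDiffOn ℝ 1 σ (Icc a b)) (hσ' : ∀ x ∈ Ioo a b, deriv σ x ≤ -d * σ x)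
    (hσb : 0 ≤ σ b) (hζ : IntervalIntegrable ζ volume a b) :
    d * ∫ x in a..b, σ x * ‖prim a k ζ x‖ ^ 2
      ≤ 2 * (∫ x in a..b, σ x * (inner ℂ (ζ x) (prim a k ζ x)).re) + σ a * ‖k‖ ^ 2 := by
  set h : ℝ → ℝ := fun x => (inner ℂ (prim a k ζ x) (prim a k ζ x)).re with hh
  have hn : ∀ x, h x = ‖prim a k ζ x‖ ^ 2 := fun x => by
    simp only [hh]
    rw [inner_self_eq_norm_sq_to_K]
    norm_cast
  have hac : AbsolutelyContinuousOnInterval h a b := absolutelyContinuousOnInterval_re_inner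
    (absolutelyContinuousOnInterval_prim (k := k) hζ)
    (absolutelyContinuousOnInterval_prim (k := k) hζ)
  have hσac : AbsolutelyContinuousOnInterval σ a b :=
    ContDiffOn.absolutelyContinuousOnInterval (by rwa [uIcc_of_le hab])
  -- The integral of `(σh)'` with `h = ‖prim‖²`. The term `∫ σ' h` is at most `-d ∫ σ h`, and the
  -- boundary term at `b` has a favourable sign and is dropped.
  have h1 := hσac.integral_deriv_mul_eq_sub hac
  have hda : ∀ᵐ x, x ∈ uIcc a b → deriv h x = 2 * (inner ℂ (ζ x) (prim a k ζ x)).re := by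
    filter_upwards [ae_hasDerivAt_re_inner_prim (k := k) (l := k) hζ hζ] with x hx hxab
    have h2 := inner_re_symm (𝕜 := ℂ) (prim a k ζ x) (ζ x)
    simp only [RCLike.re_eq_complex_re] at h2
    rw [(hx hxab).deriv]
    linarith
  have i1 : IntervalIntegrable (fun x => deriv σ x * h x) volume a b :=
    hσac.intervalIntegrable_deriv.mul_continuousOn hac.continuousOn
  have i2 : IntervalIntegrable (fun x => σ x * deriv h x) volume a b :=
    hac.intervalIntegrable_deriv.continuousOn_mul hσac.continuousOn
  have i3 : IntervalIntegrable (fun x => σ x * h x) volume a b :=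
    (hσac.continuousOn.mul hac.continuousOn).intervalIntegrable
  rw [intervalIntegral.integral_add i1 i2] at h1
  have h2 : ∫ x in a..b, σ x * deriv h x
      = 2 * ∫ x in a..b, σ x * (inner ℂ (ζ x) (prim a k ζ x)).re := by
    rw [← intervalIntegral.integral_const_mul]
    refine intervalIntegral.integral_congr_ae ?_
    filter_upwards [hda] with x hx hxab
    rw [hx (uIoc_subset_uIcc hxab)]
    ring
  have h3 : ∫ x in a..b, deriv σ x * h x ≤ -d * ∫ x in a..b, σ x * h x := by
    rw [← intervalIntegral.integral_const_mul]
    refine intervalIntegral.integral_mono_on_of_le_Ioo hab i1 (i3.const_mul _) fun x hx => ?_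
    rw [← mul_assoc]
    exact mul_le_mul_of_nonneg_right (hσ' x hx) (by rw [hn]; positivity)
  have h4 : h a = ‖k‖ ^ 2 := by rw [hn]; simp [prim]
  have h5 : 0 ≤ σ b * h b := mul_nonneg hσb (by rw [hn]; positivity)
  simp only [← hn]
  rw [← h4, ← h2]
  linarith

end Primitive

/-! ### Continuous representatives -/

section Representative

/-- Two continuous functions that agree almost everywhere on the open interval agree everywhere on
it, and then by density at the endpoint. So the trace may be read off from any continuous
representative. -/
theorem VanishesAt.eq_zero_of_ae_eq {E : Type*} [NormedAddCommGroup E] {a b c : ℝ} (hab : a < b)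
    {f F : ℝ → E} (hF : ContinuousOn F (Icc a b)) (hc : c ∈ Icc a b)
    (hfF : f =ᵐ[volume.restrict (Ioo a b)] F) (h : VanishesAt (Ioo a b) c f) : F c = 0 := by
  obtain ⟨k, hk, hke, hkc⟩ := h
  have h1 : EqOn k F (Ioo a b) := Measure.eqOn_open_of_ae_eq (hke.trans hfF) isOpen_Ioo
    (hk.mono (subset_insert _ _)) (hF.mono Ioo_subset_Icc_self)
  have hsub : insert c (Ioo a b) ⊆ Icc a b := insert_subset hc Ioo_subset_Icc_self
  have h2 : EqOn k F (insert c (Ioo a b)) :=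
    h1.of_subset_closure hk (hF.mono hsub) (subset_insert _ _) (by rwa [closure_Ioo hab.ne])
  rw [← h2 (mem_insert _ _), hkc]

/-- Cauchy–Schwarz for the real functions `‖f‖` and `‖g‖`, so that `f` and `g` may take values in
different spaces. -/
theorem integral_norm_mul_norm_le {E F α : Type*} [NormedAddCommGroup E] [NormedAddCommGroup F]
    [MeasurableSpace α] {μ : Measure α} (f : Lp E 2 μ) (g : Lp F 2 μ) :
    ∫ x, ‖f x‖ * ‖g x‖ ∂μ ≤ ‖f‖ * ‖g‖ := by
  have hf := (Lp.memLp f).norm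
  have hg := (Lp.memLp g).norm
  have h := real_inner_le_norm hf.toLp hg.toLp
  rw [Lp.norm_toLp, Lp.norm_toLp, eLpNorm_norm, eLpNorm_norm, ← Lp.norm_def, ← Lp.norm_def] at h
  refine le_trans (le_of_eq ?_) h
  rw [MeasureTheory.L2.inner_def]
  refine integral_congr_ae ?_
  filter_upwards [hf.coeFn_toLp, hg.coeFn_toLp] with x h1 h2
  rw [h1, h2]
  simp [mul_comm]

theorem integrable_norm_mul_norm {E F α : Type*} [NormedAddCommGroup E] [NormedAddCommGroup F]
    [MeasurableSpace α] {μ : Measure α} (f : Lp E 2 μ) (g : Lp F 2 μ) :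
    Integrable (fun x => ‖f x‖ * ‖g x‖) μ :=
  (Lp.memLp f).norm.integrable_mul (Lp.memLp g).norm

theorem integral_norm_le_norm {E α : Type*} [NormedAddCommGroup E] [MeasurableSpace α]
    {μ : Measure α} [IsFiniteMeasure μ] (f : Lp E 2 μ) :
    ∫ x, ‖f x‖ ∂μ ≤ √(μ.real univ) * ‖f‖ := by
  have h := integral_norm_mul_norm_le f (Lp.const 2 μ (1 : ℝ))
  have h1 : ‖Lp.const 2 μ (1 : ℝ)‖ ≤ √(μ.real univ) := by
    refine (Lp.norm_const_le 2 μ (1 : ℝ)).trans_eq ?_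
    simp [Real.sqrt_eq_rpow]
  refine le_trans (le_of_eq ?_) (h.trans ((mul_comm _ _).trans_le
    (mul_le_mul_of_nonneg_right h1 (norm_nonneg _))))
  refine integral_congr_ae ?_
  filter_upwards [Lp.coeFn_const 2 μ (1 : ℝ)] with x hx
  rw [hx]
  simp

variable {E : Type*} [NormedAddCommGroup E] [InnerProductSpace ℂ E]

theorem continuousOn_prim {a b : ℝ} {k : E} {ζ : ℝ → E} (hζ : IntervalIntegrable ζ volume a b) :
    ContinuousOn (prim a k ζ) (uIcc a b) :=
  (absolutelyContinuousOnInterval_prim hζ).continuousOn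

theorem hasWeakDerivOn_prim [CompleteSpace E] {b : ℝ} {g : ℝ → E}
    (hg : IntegrableOn g (Ioo 0 b)) : HasWeakDerivOn (Ioo 0 b) (prim 0 0 g) g := by
  refine (hasWeakDerivOn_primitive hg).congr ?_ ae_eq_rfl
  filter_upwards [ae_restrict_mem measurableSet_Ioo] with x hx
  rw [prim, zero_add, intervalIntegral.integral_of_le hx.1.le, integral_Ioc_eq_integral_Ioo,
    setIntegral_indicator measurableSet_Iio]
  congr 2
  ext t
  simp only [mem_inter_iff, mem_Ioo, mem_Iio]
  exact ⟨fun h => ⟨h.1.1, h.2⟩, fun h => ⟨⟨h.1, h.2.trans hx.2⟩, h.2⟩⟩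

/-- Subtracting the primitive of `g` leaves a function with zero weak derivative, which is constant.
-/
theorem HasWeakDerivOn.exists_ae_eq_prim [CompleteSpace E] {b : ℝ} (hb : 0 < b) {f g : ℝ → E}
    (hf : LocallyIntegrableOn f (Ioo 0 b) (volume.restrict (Ioo 0 b)))
    (hg : IntegrableOn g (Ioo 0 b)) (h : HasWeakDerivOn (Ioo 0 b) f g) :
    ∃ k, f =ᵐ[volume.restrict (Ioo 0 b)] prim 0 k g := by
  have hgi : IntervalIntegrable g volume 0 b :=
    (intervalIntegrable_iff_integrableOn_Ioo_of_le hb.le).2 hg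
  have hgl : LocallyIntegrableOn g (Ioo 0 b) (volume.restrict (Ioo 0 b)) :=
    (show Integrable g (volume.restrict (Ioo 0 b)) from hg).locallyIntegrable.locallyIntegrableOn _
  have hpi : IntegrableOn (prim 0 0 g) (Ioo 0 b) :=
    ((continuousOn_prim hgi).integrableOn_compact isCompact_uIcc).mono_set
      (by rw [uIcc_of_le hb.le]; exact Ioo_subset_Icc_self)
  have hpl : LocallyIntegrableOn (prim 0 0 g) (Ioo 0 b) (volume.restrict (Ioo 0 b)) :=
    (show Integrable _ (volume.restrict (Ioo 0 b)) from hpi).locallyIntegrable.locallyIntegrableOn _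
  have h1 := HasWeakDerivOn.add hf hgl (hpl.smul (-1 : ℝ)) (hgl.smul (-1 : ℝ)) h
    ((hasWeakDerivOn_prim hg).smul (-1 : ℝ))
  have h2 : g + (-1 : ℝ) • g = 0 := by simp
  rw [h2] at h1
  obtain ⟨k, hk⟩ := h1.ae_const (hf.add (hpl.smul (-1 : ℝ)))
  refine ⟨k, ?_⟩
  filter_upwards [hk] with x hx
  simp only [Pi.add_apply, neg_smul, one_smul, Pi.neg_apply, prim, zero_add] at hx
  rw [prim, ← hx]
  abel

end Representative

/-! ### Calculus in `H¹(0, L)` -/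

section Sobolev

variable {L : ℝ}

theorem L2.intervalIntegrable (hL : 0 < L) (g : L2 L) : IntervalIntegrable g volume 0 L :=
  (intervalIntegrable_iff_integrableOn_Ioo_of_le hL.le).2 g.integrable

/-- The continuous representative of an element of `H¹(0, L)`. -/
theorem exists_ae_eq_prim (hL : 0 < L) {u : L2 L} (hu : u ∈ H1 L) :
    ∃ k : ℂ, u =ᵐ[volume.restrict (Ioo 0 L)] prim 0 k (dx u) ∧ (TraceZero 0 u → k = 0) ∧
      (TraceZero L u → prim 0 k (dx u) L = 0) := by
  obtain ⟨k, hk⟩ := (dx_spec hu).exists_ae_eq_prim hL u.loc (dx u).integrable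
  have hc := continuousOn_prim (k := k) ((dx u).intervalIntegrable hL)
  rw [uIcc_of_le hL.le] at hc
  refine ⟨k, hk, fun h => ?_, fun h => ?_⟩
  · simpa [prim] using VanishesAt.eq_zero_of_ae_eq hL hc (left_mem_Icc.2 hL.le) hk h
  · exact VanishesAt.eq_zero_of_ae_eq hL hc (right_mem_Icc.2 hL.le) hk h

theorem L2.re_inner_eq_integral (hL : 0 < L) {f g : L2 L} {F G : ℝ → ℂ}
    (hF : f =ᵐ[volume.restrict (Ioo 0 L)] F) (hG : g =ᵐ[volume.restrict (Ioo 0 L)] G) :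
    (inner ℂ f g).re = ∫ x in 0..L, (inner ℂ (F x) (G x)).re := by
  rw [MeasureTheory.L2.inner_def, intervalIntegral.integral_of_le hL.le,
    integral_Ioc_eq_integral_Ioo]
  rw [← RCLike.re_eq_complex_re, ← integral_re (L2.integrable_inner f g)]
  refine integral_congr_ae ?_
  filter_upwards [hF, hG] with x h1 h2
  rw [h1, h2]

theorem L2.intervalIntegrable_re_inner (hL : 0 < L) {f g : L2 L} {F G : ℝ → ℂ}
    (hF : f =ᵐ[volume.restrict (Ioo 0 L)] F) (hG : g =ᵐ[volume.restrict (Ioo 0 L)] G) :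
    IntervalIntegrable (fun x => (inner ℂ (F x) (G x)).re) volume 0 L := by
  rw [intervalIntegrable_iff_integrableOn_Ioo_of_le hL.le]
  refine (MeasureTheory.L2.integrable_inner (𝕜 := ℂ) f g).re.congr ?_
  filter_upwards [hF, hG] with x h1 h2
  rw [h1, h2, RCLike.re_eq_complex_re]

/-- Integration by parts in `H¹(0, L)`. -/
theorem re_inner_dx_add (hL : 0 < L) {f g : L2 L} {k l : ℂ}
    (hf : f =ᵐ[volume.restrict (Ioo 0 L)] prim 0 k (dx f))
    (hg : g =ᵐ[volume.restrict (Ioo 0 L)] prim 0 l (dx g)) :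
    (inner ℂ f (dx g)).re + (inner ℂ (dx f) g).re
      = (inner ℂ (prim 0 k (dx f) L) (prim 0 l (dx g) L)).re - (inner ℂ k l).re := by
  have hfi := (dx f).intervalIntegrable hL
  have hgi := (dx g).intervalIntegrable hL
  rw [← integral_re_inner_prim hfi hgi, L2.re_inner_eq_integral hL hf ae_eq_rfl,
    L2.re_inner_eq_integral hL ae_eq_rfl hg, intervalIntegral.integral_add]
  · exact L2.intervalIntegrable_re_inner hL hf ae_eq_rfl
  · exact L2.intervalIntegrable_re_inner hL ae_eq_rfl hg

/-- The boundary term at `L` is killed by `f` and the one at `0` by `g`. This is the pairing of the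
stresses `u_x`, `y_x` with the velocities. -/
theorem re_inner_dx_of_traceZero (hL : 0 < L) {f g : L2 L} (hf : f ∈ H1 L) (hf' : TraceZero L f)
    (hg : g ∈ HL1Sub L) : (inner ℂ (dx f) g).re = -(inner ℂ f (dx g)).re := by
  obtain ⟨k, hk, -, hk'⟩ := exists_ae_eq_prim hL hf
  obtain ⟨l, hl, hl', -⟩ := exists_ae_eq_prim hL hg.1
  have := re_inner_dx_add hL hk hl
  rw [hk' hf', hl' hg.2, inner_zero_left, inner_zero_right] at this
  simp only [Complex.zero_re] at this
  linarith

/-- Here both boundary terms are killed by `g`, as needed for the temperature, where nothing is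
known about the endpoint values of `Λ_x` and `v(L)`. -/
theorem re_inner_dx_of_mem_H01 (hL : 0 < L) {f g : L2 L} (hf : f ∈ H1 L) (hg : g ∈ H01Sub L) :
    (inner ℂ (dx f) g).re = -(inner ℂ f (dx g)).re := by
  obtain ⟨k, hk, -, -⟩ := exists_ae_eq_prim hL hf
  obtain ⟨l, hl, hl', hl''⟩ := exists_ae_eq_prim hL hg.1
  have := re_inner_dx_add hL hk hl
  rw [hl'' hg.2.2, hl' hg.2.1, inner_zero_right, inner_zero_right] at this
  simp only [Complex.zero_re] at this
  linarith

theorem integral_norm_le (hL : 0 < L) (g : L2 L) :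
    ∫ x in 0..L, ‖g x‖ ≤ √L * ‖g‖ := by
  have h := integral_norm_le_norm g
  rwa [measureReal_restrict_apply_univ, Real.volume_real_Ioo_of_le hL.le, sub_zero,
    ← integral_Ioc_eq_integral_Ioo, ← intervalIntegral.integral_of_le hL.le] at h

/-- The Poincaré inequality. -/
theorem norm_le_norm_dx (hL : 0 < L) {u : L2 L} (hu : u ∈ H1 L)
    (h : TraceZero 0 u ∨ TraceZero L u) : ‖u‖ ≤ L * ‖dx u‖ := by
  obtain ⟨k, hk, h0, h1⟩ := exists_ae_eq_prim hL hu
  have hi := (dx u).intervalIntegrable hL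
  -- Cauchy–Schwarz bounds every increment of `u` by `√L ‖u_x‖`, hence also `u` itself since it
  -- vanishes at one endpoint. The second factor `√L` comes from the `L²` norm of a constant.
  have hbd : ∀ x ∈ Icc 0 L, ∀ y ∈ Icc 0 L, |∫ t in x..y, ‖dx u t‖| ≤ √L * ‖dx u‖ := by
    intro x hx y hy
    refine le_trans ?_ (integral_norm_le hL (dx u))
    refine (intervalIntegral.abs_integral_mono_interval (a := x) (b := y) (c := 0) (d := L) ?_
      (Eventually.of_forall fun t => norm_nonneg _) hi.norm).trans_eq (abs_of_nonneg ?_)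
    · rw [uIoc_of_le hL.le]
      exact Ioc_subset_Ioc (le_min hx.1 hy.1) (max_le hx.2 hy.2)
    · exact intervalIntegral.integral_nonneg hL.le fun t _ => norm_nonneg _
  have h2 : ∀ᵐ x ∂(volume.restrict (Ioo 0 L)), ‖u x‖ ≤ √L * ‖dx u‖ := by
    filter_upwards [hk, ae_restrict_mem measurableSet_Ioo] with x hx hxL
    have hxc : x ∈ uIcc 0 L := by rw [uIcc_of_le hL.le]; exact Ioo_subset_Icc_self hxL
    rw [hx]
    rcases h with h | h
    · have h3 := norm_prim_sub_prim_le (k := k) hi left_mem_uIcc hxc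
      rw [show prim 0 k (dx u) 0 = 0 by simp [prim, h0 h], sub_zero] at h3
      exact h3.trans (hbd _ (left_mem_Icc.2 hL.le) _ (Ioo_subset_Icc_self hxL))
    · have h3 := norm_prim_sub_prim_le (k := k) hi right_mem_uIcc hxc
      rw [h1 h, sub_zero] at h3
      exact h3.trans (hbd _ (right_mem_Icc.2 hL.le) _ (Ioo_subset_Icc_self hxL))
  have h3 := Lp.norm_le_of_ae_bound (f := u) (by positivity) h2
  refine h3.trans_eq ?_
  have h4 : (measureUnivNNReal (volume.restrict (Ioo 0 L)) : ℝ) = L := by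
    change (volume.restrict (Ioo 0 L)).real univ = L
    rw [measureReal_restrict_apply_univ, Real.volume_real_Ioo_of_le hL.le, sub_zero]
  rw [← mul_assoc, h4]
  congr 1
  rw [ENNReal.toReal_ofNat, ← one_div, ← Real.sqrt_eq_rpow, Real.mul_self_sqrt hL.le]

/-- The trace inequality. -/
theorem trace_sq_le (hL : 0 < L) {f : L2 L} {k : ℂ}
    (hf : f =ᵐ[volume.restrict (Ioo 0 L)] prim 0 k (dx f)) :
    L * ‖k‖ ^ 2 ≤ ‖f‖ ^ 2 + 2 * L * (‖f‖ * ‖dx f‖) := by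
  have hi := (dx f).intervalIntegrable hL
  set F := prim 0 k (dx f) with hF
  have hre : ∀ z : ℂ, (inner ℂ z z).re = ‖z‖ ^ 2 := fun z => by
    rw [inner_self_eq_norm_sq_to_K]; norm_cast
  have hbi : IntervalIntegrable (fun x => ‖F x‖ * ‖dx f x‖) volume 0 L := by
    rw [intervalIntegrable_iff_integrableOn_Ioo_of_le hL.le]
    refine (integrable_norm_mul_norm f (dx f)).congr ?_
    filter_upwards [hf] with x hx
    rw [hx]
  have hb : ∫ x in 0..L, ‖F x‖ * ‖dx f x‖ ≤ ‖f‖ * ‖dx f‖ := by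
    rw [intervalIntegral.integral_of_le hL.le, integral_Ioc_eq_integral_Ioo]
    refine le_trans (le_of_eq (integral_congr_ae ?_)) (integral_norm_mul_norm_le f (dx f))
    filter_upwards [hf] with x hx
    rw [hx]
  -- The boundary value is compared with `F x` by integrating the derivative of `‖F‖²` over `(0,
  -- x)`. Averaging over `x ∈ (0, L)` then turns `‖F x‖²` into `‖f‖²`.
  have hpt : ∀ x ∈ Icc 0 L, ‖k‖ ^ 2 ≤ ‖F x‖ ^ 2 + 2 * (‖f‖ * ‖dx f‖) := by
    intro x hx
    have hsub : uIcc 0 x ⊆ uIcc 0 L := by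
      rw [uIcc_of_le hx.1, uIcc_of_le hL.le]; exact Icc_subset_Icc_right hx.2
    have hix := hi.mono_set hsub
    have h1 := integral_re_inner_prim (k := k) (l := k) hix hix
    rw [← hF, hre, hre] at h1
    have h2 : ‖∫ y in 0..x, ((inner ℂ (F y) (dx f y)).re + (inner ℂ (dx f y) (F y)).re)‖
        ≤ ∫ y in 0..x, 2 * (‖F y‖ * ‖dx f y‖) := by
      refine intervalIntegral.norm_integral_le_of_norm_le hx.1
        (Eventually.of_forall fun y _ => ?_) ((hbi.mono_set hsub).const_mul 2)
      rw [Real.norm_eq_abs]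
      refine (abs_add_le _ _).trans ?_
      have h3 := (Complex.abs_re_le_norm _).trans (norm_inner_le_norm (𝕜 := ℂ) (F y) (dx f y))
      have h4 := (Complex.abs_re_le_norm _).trans (norm_inner_le_norm (𝕜 := ℂ) (dx f y) (F y))
      linarith
    have h3 : ∫ y in 0..x, 2 * (‖F y‖ * ‖dx f y‖) ≤ 2 * (‖f‖ * ‖dx f‖) := by
      rw [intervalIntegral.integral_const_mul]
      refine mul_le_mul_of_nonneg_left (le_trans ?_ hb) zero_le_two
      exact intervalIntegral.integral_mono_interval le_rfl hx.1 hx.2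
        (Eventually.of_forall fun y => by positivity) hbi
    rw [h1] at h2
    have h4 := neg_le_of_abs_le (h2.trans h3)
    linarith
  have hFi : IntervalIntegrable (fun x => ‖F x‖ ^ 2) volume 0 L := by
    have := L2.intervalIntegrable_re_inner hL hf hf
    simpa only [hre] using this
  have h5 := intervalIntegral.integral_mono_on hL.le
    (intervalIntegrable_const (c := ‖k‖ ^ 2))
    (hFi.add (intervalIntegrable_const (c := 2 * (‖f‖ * ‖dx f‖)))) hpt
  rw [intervalIntegral.integral_add hFi intervalIntegrable_const,
    intervalIntegral.integral_const, intervalIntegral.integral_const] at h5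
  have h6 : ‖f‖ ^ 2 = ∫ x in 0..L, ‖F x‖ ^ 2 := by
    have := L2.re_inner_eq_integral hL hf hf
    simp only [hre] at this
    rw [← this, inner_self_eq_norm_sq_to_K]
    norm_cast
  rw [h6]
  simp only [sub_zero, smul_eq_mul] at h5
  linarith

end Sobolev

/-! ### The memory kernel -/

namespace ConditionH

variable {σ : ℝ → ℝ}

/-- The Dafermos condition and `σ ≥ 0` give `σ' ≤ 0`. -/
theorem antitoneOn (hσ : ConditionH σ) : AntitoneOn σ (Ioi 0) := by
  obtain ⟨d, hd, h⟩ := hσ.dafermos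
  refine antitoneOn_of_deriv_nonpos (convex_Ioi 0) hσ.contDiff.continuousOn
    ((hσ.contDiff.differentiableOn (by simp)).mono interior_subset) fun x hx => ?_
  rw [interior_Ioi] at hx
  have := mul_nonneg hd.le (hσ.nonneg x hx)
  linarith [h x hx]

theorem exists_le (hσ : ConditionH σ) : ∃ M, 0 ≤ M ∧ ∀ s, 0 < s → σ s ≤ M := by
  obtain ⟨l, hl⟩ := hσ.limit_zero
  have h : ∀ s, 0 < s → σ s ≤ l := fun s hs => by
    refine ge_of_tendsto hl ?_
    filter_upwards [Ioo_mem_nhdsGT hs] with r hr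
    exact hσ.antitoneOn hr.1 hs hr.2.le
  exact ⟨l, (hσ.nonneg 1 one_pos).trans (h 1 one_pos), h⟩

/-- By monotonicity the positivity set of `σ` is an initial interval of `(0, ∞)`, bounded or not. -/
theorem Ioc_subset (hσ : ConditionH σ) {b : ℝ} (hb : b ∈ memSupport σ) :
    Ioc 0 b ⊆ memSupport σ :=
  fun _ hs => ⟨hs.1, hb.2.trans_le (hσ.antitoneOn hs.1 hb.1 hs.2)⟩

theorem Ioo_subset (hσ : ConditionH σ) {b : ℝ} (hb : b ∈ memSupport σ) :
    Ioo 0 b ⊆ memSupport σ := Ioo_subset_Ioc_self.trans (hσ.Ioc_subset hb)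

theorem nonempty_memSupport (hσ : ConditionH σ) : (memSupport σ).Nonempty := by
  by_contra h
  rw [not_nonempty_iff_eq_empty] at h
  have h0 : ∫ r in Ioi 0, σ r = 0 := setIntegral_eq_zero_of_forall_eq_zero fun x hx =>
    le_antisymm (not_lt.1 fun hlt => (h ▸ (⟨hx, hlt⟩ : x ∈ memSupport σ) : x ∈ (∅ : Set ℝ)))
      (hσ.nonneg x hx)
  exact hσ.integral_pos.ne' h0

theorem exists_gt (hσ : ConditionH σ) {s : ℝ} (hs : s ∈ memSupport σ) :
    ∃ b ∈ memSupport σ, s < b := by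
  obtain ⟨ε, hε, h⟩ := Metric.isOpen_iff.1 hσ.isOpen_memSupport s hs
  refine ⟨s + ε / 2, h ?_, by linarith⟩
  rw [Metric.mem_ball, Real.dist_eq, add_sub_cancel_left, abs_of_pos (by linarith)]
  linarith

/-- An exhaustion of the positivity set by intervals `(0, b n)` that avoids deciding whether this
set is bounded. The `b n` are running maxima of an enumeration of its rational points; a finite
maximum is attained, so it remains in the set. -/
theorem exists_seq (hσ : ConditionH σ) :
    ∃ b : ℕ → ℝ, Monotone b ∧ (∀ n, b n ∈ memSupport σ) ∧ ∀ s ∈ memSupport σ, ∃ n, s < b n := by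
  set Q : Set ℝ := memSupport σ ∩ range ((↑) : ℚ → ℝ) with hQ
  have hQd : ∀ s ∈ memSupport σ, ∃ q ∈ Q, s < q := fun s hs => by
    obtain ⟨b, hb, hsb⟩ := hσ.exists_gt hs
    obtain ⟨q, hq1, hq2⟩ := exists_rat_btwn hsb
    exact ⟨q, ⟨hσ.Ioc_subset hb ⟨hs.1.trans hq1, hq2.le⟩, mem_range_self q⟩, hq1⟩
  have hne : Q.Nonempty := by
    obtain ⟨s, hs⟩ := hσ.nonempty_memSupport
    obtain ⟨q, hq, -⟩ := hQd s hs
    exact ⟨q, hq⟩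
  obtain ⟨f, hf⟩ := ((countable_range ((↑) : ℚ → ℝ)).mono inter_subset_right).exists_eq_range hne
  refine ⟨partialSups f, (partialSups f).monotone, fun n => ?_, fun s hs => ?_⟩
  · obtain ⟨m, -, hm⟩ := exists_partialSups_eq f n
    rw [hm]
    exact (hf.symm ▸ mem_range_self m : f m ∈ memSupport σ ∩ range ((↑) : ℚ → ℝ)).1
  · obtain ⟨q, hq, hsq⟩ := hQd s hs
    rw [hQ, hf] at hq
    obtain ⟨m, rfl⟩ := hq
    exact ⟨m, hsq.trans_le (le_partialSups f m)⟩

theorem ae_mem_memSupport (hσ : ConditionH σ) : ∀ᵐ s ∂(memMeasure σ), s ∈ memSupport σ := by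
  have h := ae_restrict_mem (μ := volume) hσ.isOpen_memSupport.measurableSet
  rwa [← hσ.ae_memMeasure] at h

theorem aecover (hσ : ConditionH σ) {b : ℕ → ℝ} (hb : Monotone b)
    (hb' : ∀ s ∈ memSupport σ, ∃ n, s < b n) :
    AECover (memMeasure σ) atTop fun n => Ioo 0 (b n) where
  ae_eventually_mem := by
    filter_upwards [hσ.ae_mem_memSupport] with s hs
    obtain ⟨n, hn⟩ := hb' s hs
    filter_upwards [eventually_ge_atTop n] with m hm
    exact ⟨hs.1, hn.trans_le (hb hm)⟩
  measurableSet n := measurableSet_Ioo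

theorem ae_restrict_Ioo {E : Type*} (hσ : ConditionH σ) {b : ℝ} (hb : b ∈ memSupport σ)
    {f g : ℝ → E} (h : f =ᵐ[memMeasure σ] g) : f =ᵐ[volume.restrict (Ioo 0 b)] g := by
  rw [EventuallyEq, hσ.ae_memMeasure] at h
  exact ae_restrict_of_ae_restrict_of_subset (hσ.Ioo_subset hb) h

/-- On `(0, b)` monotonicity gives `σ ≥ σ b > 0`. Hence elements of `W` are square integrable for
Lebesgue measure on `(0, b)`, down to `s = 0`, and can be integrated from `0`. -/
theorem restrict_Ioo_le (hσ : ConditionH σ) {b : ℝ} (hb : b ∈ memSupport σ) :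
    volume.restrict (Ioo 0 b) ≤ (ENNReal.ofReal (σ b))⁻¹ • memMeasure σ := by
  refine Measure.le_iff.2 fun s hs => ?_
  rw [Measure.smul_apply, smul_eq_mul, memMeasure, withDensity_apply _ hs,
    ← ENNReal.div_eq_inv_mul, ENNReal.le_div_iff_mul_le (Or.inl (by simpa using hb.2))
      (Or.inl ENNReal.ofReal_ne_top), Measure.restrict_restrict hs, Measure.restrict_apply hs]
  calc volume (s ∩ Ioo 0 b) * ENNReal.ofReal (σ b)
      = ∫⁻ _ in s ∩ Ioo 0 b, ENNReal.ofReal (σ b) := by rw [setLIntegral_const, mul_comm]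
    _ ≤ ∫⁻ x in s ∩ Ioo 0 b, ENNReal.ofReal (σ x) :=
        setLIntegral_mono' (hs.inter measurableSet_Ioo) fun x hx =>
          ENNReal.ofReal_le_ofReal (hσ.antitoneOn hx.2.1 hb.1 hx.2.2.le)
    _ ≤ ∫⁻ x in s ∩ Ioi 0, ENNReal.ofReal (σ x) :=
        lintegral_mono_set (inter_subset_inter_right _ Ioo_subset_Ioi_self)

theorem setIntegral_memMeasure {E : Type*} [NormedAddCommGroup E] [NormedSpace ℝ E]
    (hσ : ConditionH σ) {b : ℝ} (hb : 0 < b) (f : ℝ → E) :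
    ∫ s in Ioo 0 b, f s ∂(memMeasure σ) = ∫ s in 0..b, σ s • f s := by
  have hm : AEMeasurable (fun s => ENNReal.ofReal (σ s)) (volume.restrict (Ioi 0)) :=
    hσ.integrable.aestronglyMeasurable.aemeasurable.ennreal_ofReal
  have hsub : Ioo 0 b ∩ Ioi 0 = Ioo 0 b := inter_eq_left.2 Ioo_subset_Ioi_self
  rw [memMeasure, restrict_withDensity measurableSet_Ioo,
    Measure.restrict_restrict measurableSet_Ioo, hsub,
    integral_withDensity_eq_integral_toReal_smul₀
      (hm.mono_measure (Measure.restrict_mono Ioo_subset_Ioi_self le_rfl))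
      (Eventually.of_forall fun _ => ENNReal.ofReal_lt_top),
    intervalIntegral.integral_of_le hb.le, integral_Ioc_eq_integral_Ioo]
  refine setIntegral_congr_fun measurableSet_Ioo fun s hs => ?_
  simp only [ENNReal.toReal_ofReal (hσ.nonneg s hs.1)]

theorem memMeasure_ne_zero (hσ : ConditionH σ) : memMeasure σ ≠ 0 := by
  intro h
  have h1 := hσ.ae_mem_memSupport
  obtain ⟨b, hb⟩ := hσ.nonempty_memSupport
  have h2 := hσ.restrict_Ioo_le hb univ
  simp only [h, Measure.restrict_apply MeasurableSet.univ, univ_inter,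
    Real.volume_Ioo, Measure.coe_zero, Pi.zero_apply, smul_zero, sub_zero] at h2
  exact absurd hb.1 (not_lt.2 (ENNReal.ofReal_eq_zero.1 (le_antisymm h2 zero_le)))

end ConditionH

/-! ### The energy inequality for the memory -/

section Energy

variable {E : Type*} [NormedAddCommGroup E] [InnerProductSpace ℂ E] {σ : ℝ → ℝ}

theorem W.intervalIntegrable {E : Type*} [NormedAddCommGroup E] (hσ : ConditionH σ) {b : ℝ}
    (hb : b ∈ memSupport σ)
    (f : Lp E 2 (memMeasure σ)) : IntervalIntegrable f volume 0 b := by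
  rw [intervalIntegrable_iff_integrableOn_Ioo_of_le hb.1.le]
  have h2 : MemLp f 2 (volume.restrict (Ioo 0 b)) :=
    (Lp.memLp f).of_measure_le_smul (by simpa using hb.2) (hσ.restrict_Ioo_le hb)
  exact h2.integrable (by norm_num)

theorem intervalIntegrable_kernel_mul (hσ : ConditionH σ) {b : ℝ} (hb : 0 < b) {h : ℝ → ℝ}
    (hh : IntervalIntegrable h volume 0 b) :
    IntervalIntegrable (fun s => σ s * h s) volume 0 b := by
  obtain ⟨M, hM, hσM⟩ := hσ.exists_le
  rw [intervalIntegrable_iff_integrableOn_Ioo_of_le hb.le] at hh ⊢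
  refine hh.bdd_mul (c := M) (hσ.integrable.aestronglyMeasurable.mono_measure
    (Measure.restrict_mono Ioo_subset_Ioi_self le_rfl)) ?_
  filter_upwards [ae_restrict_mem measurableSet_Ioo] with s hs
  rw [Real.norm_of_nonneg (hσ.nonneg s hs.1)]
  exact hσM s hs.1

/-- Multiplication of an equation `η_s = ζ`, `η(0) = 0`, by `σ η` on a bounded interval. -/
theorem energy_le_truncated [CompleteSpace E] (hσ : ConditionH σ) {d b : ℝ}
    (hd : ∀ s, 0 < s → deriv σ s ≤ -d * σ s) (hb : 0 < b) {ζ : ℝ → E}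
    (hζ : IntervalIntegrable ζ volume 0 b) :
    d * ∫ s in 0..b, σ s * ‖prim 0 0 ζ s‖ ^ 2
      ≤ 2 * ∫ s in 0..b, σ s * (inner ℂ (ζ s) (prim 0 0 ζ s)).re := by
  obtain ⟨M, hM, hσM⟩ := hσ.exists_le
  set F := prim 0 0 ζ with hF
  have hFc : ContinuousOn F (uIcc 0 b) := continuousOn_prim hζ
  have i1 : IntervalIntegrable (fun s => σ s * ‖F s‖ ^ 2) volume 0 b :=
    intervalIntegrable_kernel_mul hσ hb (hFc.norm.pow 2).intervalIntegrable
  have i2 : IntervalIntegrable (fun s => σ s * (inner ℂ (ζ s) (F s)).re) volume 0 b := by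
    refine intervalIntegrable_kernel_mul hσ hb ?_
    obtain ⟨C, hC⟩ := isCompact_uIcc.exists_bound_of_continuousOn hFc
    refine (hζ.norm.mul_const C).mono_fun ?_ ?_
    · have h1 : AEStronglyMeasurable F (volume.restrict (uIoc 0 b)) :=
        (hFc.mono uIoc_subset_uIcc).aestronglyMeasurable measurableSet_uIoc
      exact Complex.continuous_re.comp_aestronglyMeasurable
        (hζ.aestronglyMeasurable_restrict_uIoc.inner h1)
    · filter_upwards [ae_restrict_mem measurableSet_uIoc] with s hs
      refine (Complex.abs_re_le_norm _).trans ((norm_inner_le_norm _ _).trans ?_)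
      refine le_trans ?_ (le_abs_self _)
      exact mul_le_mul_of_nonneg_left (hC s (uIoc_subset_uIcc hs)) (norm_nonneg _)
  -- `σ` is of class `C¹` only on the open half-line, so the weighted inequality is applied on `[a,
  -- b]` with `a > 0`. As `a → 0⁺` the boundary term `σ a ‖F a‖² ≤ M ‖F a‖²` disappears because `F 0
  -- = 0`.
  have key : ∀ a ∈ Ioo 0 b, d * ∫ s in a..b, σ s * ‖F s‖ ^ 2
      ≤ 2 * (∫ s in a..b, σ s * (inner ℂ (ζ s) (F s)).re) + M * ‖F a‖ ^ 2 := by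
    intro a ha
    have ha' : a ∈ uIcc 0 b := by rw [uIcc_of_le hb.le]; exact Ioo_subset_Icc_self ha
    have h1 := weighted_energy_le (d := d) (k := F a) ha.2.le
      (hσ.contDiff.mono fun s hs => ha.1.trans_le hs.1)
      (fun x hx => hd x (ha.1.trans hx.1)) (hσ.nonneg b hb)
      (hζ.mono_set (uIcc_subset_uIcc ha' right_mem_uIcc))
    have h2 : ∀ s ∈ uIcc a b, prim a (F a) ζ s = F s := fun s hs => by
      rw [prim, ← prim_sub_prim (k := 0) hζ ha' (uIcc_subset_uIcc ha' right_mem_uIcc hs)]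
      simp only [F]
      abel
    have e1 : ∫ s in a..b, σ s * ‖prim a (F a) ζ s‖ ^ 2 = ∫ s in a..b, σ s * ‖F s‖ ^ 2 :=
      intervalIntegral.integral_congr fun s hs => by simp only [h2 s hs]
    have e2 : ∫ s in a..b, σ s * (inner ℂ (ζ s) (prim a (F a) ζ s)).re
        = ∫ s in a..b, σ s * (inner ℂ (ζ s) (F s)).re :=
      intervalIntegral.integral_congr fun s hs => by simp only [h2 s hs]
    rw [e1, e2] at h1
    have := mul_le_mul_of_nonneg_right (hσM a ha.1) (sq_nonneg ‖F a‖)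
    linarith
  have lim : ∀ {h : ℝ → ℝ}, IntervalIntegrable h volume 0 b →
      Tendsto (fun a => ∫ s in a..b, h s) (𝓝[>] 0) (𝓝 (∫ s in 0..b, h s)) := by
    intro h hh
    have h1 : ContinuousOn (fun a => ∫ s in b..a, h s) (uIcc 0 b) :=
      intervalIntegral.continuousOn_primitive_interval' hh right_mem_uIcc
    have h2 := ((h1.neg 0 left_mem_uIcc).mono (uIcc_of_le hb.le ▸ Ioo_subset_Icc_self)).tendsto
    rw [nhdsWithin_Ioo_eq_nhdsGT hb] at h2
    refine (h2.congr fun a => ?_).trans_eq ?_ <;>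
      simp only [Pi.neg_apply, ← intervalIntegral.integral_symm]
  have limF : Tendsto (fun a => M * ‖F a‖ ^ 2) (𝓝[>] 0) (𝓝 0) := by
    have h2 := ((hFc 0 left_mem_uIcc).mono (uIcc_of_le hb.le ▸ Ioo_subset_Icc_self)).tendsto
    rw [nhdsWithin_Ioo_eq_nhdsGT hb] at h2
    have h3 : F 0 = 0 := by simp [hF, prim]
    simpa [h3] using (h2.norm.pow 2).const_mul M
  have h5 := le_of_tendsto_of_tendsto ((lim i1).const_mul d)
    (((lim i2).const_mul 2).add limF) (by
      filter_upwards [Ioo_mem_nhdsGT hb] with a ha using key a ha)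
  simpa using h5

end Energy

/-! ### The memory space -/

section Memory

variable {L : ℝ} {σ : ℝ → ℝ}

theorem HasWeakDerivOn.mono_Ioo {E : Type*} [NormedAddCommGroup E] [NormedSpace ℝ E]
    {S T : Set ℝ} (hS : MeasurableSet S) (hTS : T ⊆ S) {f g : ℝ → E}
    (h : HasWeakDerivOn S f g) : HasWeakDerivOn T f g := by
  intro φ hφ
  have h1 : ∀ {ψ : ℝ → ℝ} {k : ℝ → E}, tsupport ψ ⊆ T →
      ∫ x in T, ψ x • k x = ∫ x in S, ψ x • k x := fun {ψ k} hψ => by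
    refine (setIntegral_eq_of_subset_of_forall_sdiff_eq_zero hS hTS fun x hx => ?_).symm
    rw [image_eq_zero_of_notMem_tsupport fun hx' => hx.2 (hψ hx'), zero_smul]
  rw [h1 hφ.deriv.2.2, h1 hφ.2.2]
  exact h φ ⟨hφ.1, hφ.2.1, hφ.2.2.trans hTS⟩

/-- On each truncated interval `η` is a primitive of `ζ` up to a constant, and the zero trace at `s
= 0` removes the constant. -/
theorem ae_eq_prim_of_hasDs (hσ : ConditionH σ) {η ζ : W L σ} (h : HasDs η ζ)
    (h0 : InitZero η) {b : ℝ} (hb : b ∈ memSupport σ) :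
    η =ᵐ[volume.restrict (Ioo 0 b)] prim 0 0 ζ := by
  have hi : ∀ f : W L σ, IntegrableOn f (Ioo 0 b) := fun f =>
    (intervalIntegrable_iff_integrableOn_Ioo_of_le hb.1.le).1 (W.intervalIntegrable hσ hb f)
  have hl : LocallyIntegrableOn η (Ioo 0 b) (volume.restrict (Ioo 0 b)) :=
    (show Integrable η (volume.restrict (Ioo 0 b)) from hi η).locallyIntegrable.locallyIntegrableOn
      _
  obtain ⟨k, hk⟩ := (HasWeakDerivOn.mono_Ioo hσ.isOpen_memSupport.measurableSet
    (hσ.Ioo_subset hb) h).exists_ae_eq_prim hb.1 hl (hi ζ)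
  have hc := continuousOn_prim (k := k) (W.intervalIntegrable hσ hb ζ)
  rw [uIcc_of_le hb.1.le] at hc
  have h1 : VanishesAt (Ioo 0 b) 0 η := by
    obtain ⟨f, hf, hfe, hf0⟩ := h0
    exact ⟨f, hf.mono (insert_subset_insert (hσ.Ioo_subset hb)),
      ae_restrict_of_ae_restrict_of_subset (hσ.Ioo_subset hb) hfe, hf0⟩
  have h2 := VanishesAt.eq_zero_of_ae_eq hb.1 hc (left_mem_Icc.2 hb.1.le) hk h1
  have h3 : k = 0 := by simpa [prim] using h2
  rwa [h3] at hk

/-- The operator `-∂_s` on the memory space is dissipative. -/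
theorem norm_sq_le_re_inner_ds (hσ : ConditionH σ) {d : ℝ}
    (hd : ∀ s, 0 < s → deriv σ s ≤ -d * σ s) {η ζ : W L σ} (h : HasDs η ζ)
    (h0 : InitZero η) : d * ‖η‖ ^ 2 ≤ 2 * (inner ℂ ζ η).re := by
  obtain ⟨b, hbm, hb, hb'⟩ := hσ.exists_seq
  have hcov := hσ.aecover hbm hb'
  have i1 : Integrable (fun s => ‖η s‖ ^ 2) (memMeasure σ) :=
    (memLp_two_iff_integrable_sq_norm (Lp.memLp η).1).1 (Lp.memLp η)
  have i2 : Integrable (fun s => (inner ℂ (ζ s) (η s)).re) (memMeasure σ) :=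
    (MeasureTheory.L2.integrable_inner (𝕜 := ℂ) ζ η).re
  have e1 : ‖η‖ ^ 2 = ∫ s, ‖η s‖ ^ 2 ∂(memMeasure σ) := by
    have h1 : ‖η‖ ^ 2 = (inner ℂ η η).re := by
      rw [inner_self_eq_norm_sq_to_K]; norm_cast
    rw [h1, MeasureTheory.L2.inner_def, ← RCLike.re_eq_complex_re,
      ← integral_re (MeasureTheory.L2.integrable_inner (𝕜 := ℂ) η η)]
    refine integral_congr_ae (Eventually.of_forall fun s => ?_)
    simp only
    rw [inner_self_eq_norm_sq_to_K, RCLike.re_eq_complex_re]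
    norm_cast
  have e2 : (inner ℂ ζ η).re = ∫ s, (inner ℂ (ζ s) (η s)).re ∂(memMeasure σ) := by
    rw [MeasureTheory.L2.inner_def, ← RCLike.re_eq_complex_re,
      ← integral_re (MeasureTheory.L2.integrable_inner (𝕜 := ℂ) ζ η)]
  rw [e1, e2]
  -- Both sides are integrable against `σ ds` on the whole half-line, so the truncated inequalities
  -- pass to the limit along the exhaustion.
  refine le_of_tendsto_of_tendsto' ((hcov.integral_tendsto_of_countably_generated i1).const_mul d)
    ((hcov.integral_tendsto_of_countably_generated i2).const_mul 2) fun n => ?_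
  have h1 := energy_le_truncated hσ hd (hb n).1 (W.intervalIntegrable hσ (hb n) ζ)
  have h2 := ae_eq_prim_of_hasDs hσ h h0 (hb n)
  rw [hσ.setIntegral_memMeasure (hb n).1, hσ.setIntegral_memMeasure (hb n).1]
  simp only [intervalIntegral.integral_of_le (hb n).1.le, integral_Ioc_eq_integral_Ioo,
    smul_eq_mul] at h1 ⊢
  refine (le_of_eq ?_).trans (h1.trans (le_of_eq ?_))
  · congr 1
    exact integral_congr_ae (h2.mono fun s hs => by simp only [hs])
  · congr 1
    exact integral_congr_ae (h2.mono fun s hs => by simp only [hs])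

theorem aestronglyMeasurable_prim (hσ : ConditionH σ) (f : W L σ) :
    AEStronglyMeasurable (prim 0 0 f) (memMeasure σ) := by
  have hc : ContinuousOn (prim 0 0 f) (memSupport σ) := by
    intro s hs
    obtain ⟨b, hb, hsb⟩ := hσ.exists_gt hs
    have h1 := continuousOn_prim (k := 0) (W.intervalIntegrable hσ hb f)
    rw [uIcc_of_le hb.1.le] at h1
    exact (h1.continuousAt (Icc_mem_nhds hs.1 hsb)).continuousWithinAt
  have h1 := hc.aestronglyMeasurable (μ := volume) hσ.isOpen_memSupport.measurableSet
  refine h1.mono_ac ?_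
  rw [← Measure.ae_le_iff_absolutelyContinuous, hσ.ae_memMeasure]

/-- The Hardy-type inequality behind the inversion of `∂_s`. -/
theorem memLp_prim (hσ : ConditionH σ) (f : W L σ) :
    MemLp (prim 0 0 f) 2 (memMeasure σ) := by
  obtain ⟨d, hd, hdσ⟩ := hσ.dafermos
  obtain ⟨b, hbm, hb, hb'⟩ := hσ.exists_seq
  have hcov := hσ.aecover hbm hb'
  have := hσ.isFiniteMeasure
  rw [memLp_two_iff_integrable_sq_norm (aestronglyMeasurable_prim hσ f)]
  set F := prim 0 0 f with hF
  have i1 : Integrable (fun s => ‖f s‖ ^ 2) (memMeasure σ) :=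
    (memLp_two_iff_integrable_sq_norm (Lp.memLp f).1).1 (Lp.memLp f)
  -- On `(0, b n)` the primitive is bounded and the measure is finite. This a priori finiteness is
  -- what allows its norm to be absorbed below.
  have iF : ∀ n, IntegrableOn (fun s => ‖F s‖ ^ 2) (Ioo 0 (b n)) (memMeasure σ) := fun n => by
    have hc := continuousOn_prim (k := 0) (W.intervalIntegrable hσ (hb n) f)
    rw [uIcc_of_le (hb n).1.le] at hc
    obtain ⟨C, hC⟩ := isCompact_Icc.exists_bound_of_continuousOn (hc.norm.pow 2)
    refine Measure.integrableOn_of_bounded (M := C) (measure_ne_top _ _)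
      ((aestronglyMeasurable_prim hσ f).norm.pow 2) ?_
    filter_upwards [ae_restrict_mem measurableSet_Ioo] with s hs
      using hC s (Ioo_subset_Icc_self hs)
  -- The truncated energy inequality gives `d ∫ ‖F‖² ≤ 2 ∫ Re⟨f, F⟩ ≤ (d/2) ∫ ‖F‖² + (2/d) ∫ ‖f‖²`.
  -- Absorbing the first term yields the bound `4 / d²`, uniform in `n`.
  refine hcov.integrable_of_integral_norm_bounded
    (4 / d ^ 2 * ∫ s, ‖f s‖ ^ 2 ∂(memMeasure σ)) iF (Eventually.of_forall fun n => ?_)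
  have h1 := energy_le_truncated hσ hdσ (hb n).1 (W.intervalIntegrable hσ (hb n) f)
  have h0 : ∀ g : ℝ → ℝ, ∫ s in 0..b n, σ s * g s = ∫ s in Ioo 0 (b n), g s ∂(memMeasure σ) :=
    fun g => by rw [hσ.setIntegral_memMeasure (hb n).1]; rfl
  rw [h0, h0, ← hF] at h1
  have h2 : ∫ s in Ioo 0 (b n), (inner ℂ (f s) (F s)).re ∂(memMeasure σ)
      ≤ ∫ s in Ioo 0 (b n), (d / 4 * ‖F s‖ ^ 2 + 1 / d * ‖f s‖ ^ 2) ∂(memMeasure σ) := by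
    have hbd : ∀ s, |(inner ℂ (f s) (F s)).re| ≤ d / 4 * ‖F s‖ ^ 2 + 1 / d * ‖f s‖ ^ 2 := by
      intro s
      refine (Complex.abs_re_le_norm _).trans ((norm_inner_le_norm _ _).trans ?_)
      rw [← sub_nonneg]
      have e : d / 4 * ‖F s‖ ^ 2 + 1 / d * ‖f s‖ ^ 2 - ‖f s‖ * ‖F s‖
          = 1 / d * (d / 2 * ‖F s‖ - ‖f s‖) ^ 2 := by field_simp; ring
      rw [e]
      positivity
    have ib := ((iF n).const_mul (d / 4)).add
      ((i1.integrableOn (s := Ioo 0 (b n))).const_mul (1 / d))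
    refine integral_mono (ib.mono' ?_ (Eventually.of_forall hbd)) ib
      fun s => (le_abs_self _).trans (hbd s)
    exact Complex.continuous_re.comp_aestronglyMeasurable
      ((Lp.memLp f).1.inner (aestronglyMeasurable_prim hσ f)).restrict
  rw [integral_add ((iF n).const_mul _) (i1.integrableOn.const_mul _), integral_const_mul,
    integral_const_mul] at h2
  have h3 : ∫ s in Ioo 0 (b n), ‖f s‖ ^ 2 ∂(memMeasure σ) ≤ ∫ s, ‖f s‖ ^ 2 ∂(memMeasure σ) :=
    setIntegral_le_integral i1 (Eventually.of_forall fun s => by positivity)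
  have h4 : ∫ s in Ioo 0 (b n), ‖‖F s‖ ^ 2‖ ∂(memMeasure σ)
      = ∫ s in Ioo 0 (b n), ‖F s‖ ^ 2 ∂(memMeasure σ) :=
    integral_congr_ae (Eventually.of_forall fun s => by simp)
  rw [h4]
  have h5 : 1 / d * ∫ s in Ioo 0 (b n), ‖f s‖ ^ 2 ∂(memMeasure σ)
      ≤ 1 / d * ∫ s, ‖f s‖ ^ 2 ∂(memMeasure σ) := mul_le_mul_of_nonneg_left h3 (by positivity)
  have h6 : d / 2 * ∫ s in Ioo 0 (b n), ‖F s‖ ^ 2 ∂(memMeasure σ)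
      ≤ 2 * (1 / d * ∫ s, ‖f s‖ ^ 2 ∂(memMeasure σ)) := by linarith
  have h7 := mul_le_mul_of_nonneg_left h6 (by positivity : 0 ≤ 2 / d)
  refine (le_of_eq ?_).trans (h7.trans (le_of_eq ?_))
  · field_simp
  · field_simp
    ring

/-- The primitive `s ↦ ∫₀^s f` of `f ∈ W`, as an element of `W`. -/
noncomputable def primW (hσ : ConditionH σ) (f : W L σ) : W L σ := (memLp_prim hσ f).toLp

theorem coeFn_primW (hσ : ConditionH σ) (f : W L σ) :
    primW hσ f =ᵐ[memMeasure σ] prim 0 0 f := (memLp_prim hσ f).coeFn_toLp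

/-- Near any `s ≥ 0` in question the primitive is continuous on a closed interval `[0, b]` with `b >
s` in the positivity set, so it is continuous up to `s = 0`, where it vanishes. -/
theorem initZero_primW (hσ : ConditionH σ) (f : W L σ) : InitZero (primW hσ f) := by
  refine ⟨prim 0 0 f, ?_, W.ae_restrict hσ (coeFn_primW hσ f).symm, by simp [prim]⟩
  have h : ∀ s b, 0 ≤ s → s < b → b ∈ memSupport σ →
      ContinuousWithinAt (prim 0 0 f) (insert 0 (memSupport σ)) s := by
    intro s b hs hsb hb
    have h1 := continuousOn_prim (k := 0) (W.intervalIntegrable hσ hb f)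
    rw [uIcc_of_le hb.1.le] at h1
    refine (h1 s ⟨hs, hsb.le⟩).mono_of_mem_nhdsWithin ?_
    filter_upwards [self_mem_nhdsWithin, mem_nhdsWithin_of_mem_nhds (Iio_mem_nhds hsb)]
      with r hr hrb
    refine ⟨?_, (show r < b from hrb).le⟩
    rcases hr with rfl | hr
    · exact le_rfl
    · exact hr.1.le
  intro s hs
  rcases hs with rfl | hs
  · obtain ⟨b, hb⟩ := hσ.nonempty_memSupport
    exact h 0 b le_rfl hb.1 hb
  · obtain ⟨b, hb, hsb⟩ := hσ.exists_gt hs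
    exact h s b hs.1.le hsb hb

/-- The compact support has a largest point, and the positivity set is open, so it contains some `b`
beyond that point. -/
theorem IsTest.exists_tsupport_subset {φ : ℝ → ℝ} (hσ : ConditionH σ)
    (hφ : IsTest (memSupport σ) φ) : ∃ b ∈ memSupport σ, IsTest (Ioo 0 b) φ := by
  rcases (tsupport φ).eq_empty_or_nonempty with h | h
  · obtain ⟨b, hb⟩ := hσ.nonempty_memSupport
    exact ⟨b, hb, hφ.1, hφ.2.1, by simp [h]⟩
  · have hc : IsCompact (tsupport φ) := hφ.2.1
    obtain ⟨b, hb, hsb⟩ := hσ.exists_gt (hφ.2.2 (hc.sSup_mem h))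
    exact ⟨b, hb, hφ.1, hφ.2.1, fun s hs =>
      ⟨(hφ.2.2 hs).1, (le_csSup hc.bddAbove hs).trans_lt hsb⟩⟩

theorem IsTest.setIntegral_smul_eq {E : Type*} [NormedAddCommGroup E] [NormedSpace ℝ E]
    {S T : Set ℝ} (hS : MeasurableSet S) (hTS : T ⊆ S) {φ : ℝ → ℝ} (hφ : IsTest T φ)
    (f : ℝ → E) : ∫ x in S, φ x • f x = ∫ x in T, φ x • f x :=
  setIntegral_eq_of_subset_of_forall_sdiff_eq_zero hS hTS fun x hx => by
    rw [image_eq_zero_of_notMem_tsupport fun hx' => hx.2 (hφ.2.2 hx'), zero_smul]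

theorem hasDs_primW (hσ : ConditionH σ) (f : W L σ) : HasDs (primW hσ f) f := by
  refine HasWeakDerivOn.congr (f := prim 0 0 f) (g := f) (fun φ hφ => ?_)
    (W.ae_restrict hσ (coeFn_primW hσ f).symm) ae_eq_rfl
  obtain ⟨b, hb, hφb⟩ := hφ.exists_tsupport_subset hσ
  have hm := hσ.isOpen_memSupport.measurableSet
  rw [hφb.deriv.setIntegral_smul_eq hm (hσ.Ioo_subset hb),
    hφb.setIntegral_smul_eq hm (hσ.Ioo_subset hb)]
  exact hasWeakDerivOn_prim ((intervalIntegrable_iff_integrableOn_Ioo_of_le hb.1.le).1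
    (W.intervalIntegrable hσ hb f)) φ hφb

/-- Testing against a test function is bounded on the memory space. -/
theorem exists_norm_integral_test_le (hσ : ConditionH σ) {φ : ℝ → ℝ}
    (hφ : IsTest (memSupport σ) φ) :
    ∃ C, ∀ η : W L σ, ‖∫ s in memSupport σ, φ s • η s‖ ≤ C * ‖η‖ := by
  obtain ⟨b, hb, hφb⟩ := hφ.exists_tsupport_subset hσ
  have := hσ.isFiniteMeasure
  obtain ⟨M, hM⟩ := hφ.1.continuous.bounded_above_of_compact_support hφ.2.1
  have hM0 : 0 ≤ M := (norm_nonneg _).trans (hM 0)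
  refine ⟨M * ((σ b)⁻¹ * √((memMeasure σ).real univ)), fun η => ?_⟩
  rw [hφb.setIntegral_smul_eq hσ.isOpen_memSupport.measurableSet (hσ.Ioo_subset hb)]
  have hi : IntegrableOn η (Ioo 0 b) :=
    (intervalIntegrable_iff_integrableOn_Ioo_of_le hb.1.le).1 (W.intervalIntegrable hσ hb η)
  have h1 : ‖∫ s in Ioo 0 b, φ s • η s‖ ≤ ∫ s in Ioo 0 b, M * ‖η s‖ := by
    refine norm_integral_le_of_norm_le (hi.norm.const_mul M) (Eventually.of_forall fun s => ?_)
    rw [norm_smul]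
    exact mul_le_mul_of_nonneg_right (hM s) (norm_nonneg _)
  have h2 : ∫ s in Ioo 0 b, ‖η s‖ ≤ (σ b)⁻¹ * ∫ s, ‖η s‖ ∂(memMeasure σ) := by
    have h3 := integral_mono_measure (hσ.restrict_Ioo_le hb)
      (Eventually.of_forall fun s => norm_nonneg (η s))
      ((W.integrable hσ η).norm.smul_measure (by simpa using hb.2))
    refine h3.trans_eq ?_
    rw [integral_smul_measure, ENNReal.toReal_inv, ENNReal.toReal_ofReal hb.2.le, smul_eq_mul]
  have h4 := integral_norm_le_norm η
  rw [integral_const_mul] at h1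
  have h5 : 0 ≤ (σ b)⁻¹ := inv_nonneg.2 hb.2.le
  calc _ ≤ _ := h1
    _ ≤ M * ((σ b)⁻¹ * (√((memMeasure σ).real univ) * ‖η‖)) := by
      gcongr
      exact h2.trans (by gcongr)
    _ = _ := by ring

theorem exists_isTest_integral_eq_one (hσ : ConditionH σ) :
    ∃ φ, IsTest (memSupport σ) φ ∧ ∫ s in memSupport σ, φ s = 1 := by
  obtain ⟨s, hs⟩ := hσ.nonempty_memSupport
  obtain ⟨ε, hε, h⟩ := Metric.isOpen_iff.1 hσ.isOpen_memSupport s hs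
  let B : ContDiffBump s := ⟨ε / 4, ε / 2, by linarith, by linarith⟩
  have hsub : tsupport (B.normed volume) ⊆ memSupport σ := by
    rw [B.tsupport_normed_eq]
    exact (Metric.closedBall_subset_ball (by simp only [B]; linarith)).trans h
  refine ⟨B.normed volume, ⟨B.contDiff_normed, B.hasCompactSupport_normed, hsub⟩, ?_⟩
  rw [← B.integral_normed (μ := volume)]
  exact setIntegral_eq_integral_of_forall_compl_eq_zero fun x hx =>
    image_eq_zero_of_notMem_tsupport fun hx' => hx (hsub hx')

theorem norm_Lam_le (hσ : ConditionH σ) (η : W L σ) :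
    ‖Lam η‖ ≤ √((memMeasure σ).real univ) * ‖η‖ :=
  haveI := hσ.isFiniteMeasure
  (norm_integral_le_integral_norm _).trans (integral_norm_le_norm η)

theorem coeFn_constW (hσ : ConditionH σ) (w : H01 L) :
    constW hσ w =ᵐ[memMeasure σ] fun _ => w :=
  haveI := hσ.isFiniteMeasure
  Lp.coeFn_const 2 (memMeasure σ) w

/-- This identity makes the memory term of the energy cancel the coupling `c Λ_xx` in the heat
equation. -/
theorem inner_constW (hσ : ConditionH σ) (w : H01 L) (η : W L σ) :
    inner ℂ (constW hσ w) η = inner ℂ w (Lam η) := by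
  rw [MeasureTheory.L2.inner_def, Lam, ← integral_inner (W.integrable hσ η)]
  refine integral_congr_ae ?_
  filter_upwards [coeFn_constW hσ w] with s hs
  rw [hs]

theorem coeFn_primW_constW (hσ : ConditionH σ) (w : H01 L) :
    primW hσ (constW hσ w) =ᵐ[memMeasure σ] fun s => s • w := by
  filter_upwards [coeFn_primW hσ (constW hσ w), hσ.ae_mem_memSupport] with s hs hsm
  have h : ∫ t in 0..s, constW hσ w t = ∫ _ in 0..s, w := by
    simp only [intervalIntegral.integral_of_le hsm.1.le, integral_Ioc_eq_integral_Ioo]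
    exact integral_congr_ae (hσ.ae_restrict_Ioo hsm (coeFn_constW hσ w))
  rw [hs, prim, h, intervalIntegral.integral_const, zero_add, sub_zero]

theorem Lam_primW_constW (hσ : ConditionH σ) (w : H01 L) :
    Lam (primW hσ (constW hσ w)) = (∫ s, s ∂(memMeasure σ)) • w := by
  rw [← integral_smul_const, Lam]
  exact integral_congr_ae (coeFn_primW_constW hσ w)

/-- On functions `s ↦ s • w` the map `Lam` is multiplication by the first moment of `σ`, which is
positive and finite, so dividing by it solves for `w`. -/
theorem exists_Lam_primW_constW (hσ : ConditionH σ) (X : H01 L) :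
    ∃ w, Lam (primW hσ (constW hσ w)) = X := by
  have hpos : ∀ᵐ s ∂(memMeasure σ), 0 < s := hσ.ae_mem_memSupport.mono fun s hs => hs.1
  rcases eq_or_ne X 0 with rfl | hX
  · exact ⟨0, by rw [Lam_primW_constW, smul_zero]⟩
  -- Finiteness of the first moment comes from the Hardy-type inequality: `s • X` represents the
  -- primitive of the constant `X`, an element of `W`. Recovering the scalar integrand requires `X ≠
  -- 0`.
  have h1 : Integrable (fun s : ℝ => s • X) (memMeasure σ) :=
    (W.integrable hσ (primW hσ (constW hσ X))).congr (coeFn_primW_constW hσ X)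
  rw [integrable_smul_const hX] at h1
  have h2 : 0 < ∫ s, s ∂(memMeasure σ) := by
    rw [integral_pos_iff_support_of_nonneg_ae (hpos.mono fun s hs => hs.le) h1, pos_iff_ne_zero]
    intro h0
    have h3 : ∀ᵐ s ∂(memMeasure σ), s ∉ Function.support fun s : ℝ => s :=
      measure_eq_zero_iff_ae_notMem.1 h0
    have h4 : ∀ᵐ s ∂(memMeasure σ), False := by
      filter_upwards [hpos, h3] with s hs hs'
      exact hs' hs.ne'
    exact hσ.memMeasure_ne_zero (ae_eq_bot.1 (eventually_false_iff_eq_bot.1 h4))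
  refine ⟨(∫ s, s ∂(memMeasure σ))⁻¹ • X, ?_⟩
  rw [Lam_primW_constW, smul_smul, mul_inv_cancel₀ h2.ne', one_smul]

end Memory

/-! ### Norms and inner products in terms of derivatives -/

theorem HL1.norm_D {L : ℝ} (u : HL1 L) : ‖u.D‖ = ‖u‖ := HL1.Dᵢ.norm_map u

theorem H01.norm_dx {L : ℝ} (w : H01 L) : ‖dx w.toL2‖ = ‖w‖ :=
  (HL1.norm_D w.toHL1).trans (H01.toHL1.norm_map w)

theorem H01.inner_eq {L : ℝ} (w w' : H01 L) : inner ℂ w w' = inner ℂ (dx w.toL2) (dx w'.toL2) :=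
  (H01.toHL1.inner_map_map w w').symm

/-! ### The topology of the energy space -/

namespace State

variable {p : Params} {σ : ℝ → ℝ}

theorem norm_sq (U : State p σ) : ‖U‖ ^ 2 = p.ρ * ‖U.v‖ ^ 2 + p.α₁ * ‖U.u.D‖ ^ 2 + p.μ * ‖U.z‖ ^ 2
      + p.β * ‖(p.γ : ℂ) • U.u.D - U.y.D‖ ^ 2 + ‖U.w‖ ^ 2 + p.c * ‖U.η‖ ^ 2 := by
  rw [@norm_sq_eq_re_inner ℂ, inner_def, energyInner_self]
  rfl

/-- The identification of the energy space with a product of Banach spaces, as a linear map. -/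
noncomputable def prodₗ (p : Params) (σ : ℝ → ℝ) :
    State p σ ≃ₗ[ℂ] HL1 p.L × L2 p.L × HL1 p.L × L2 p.L × L2 p.L × W p.L σ where
  toFun U := (U.u, U.v, U.y, U.z, U.w, U.η)
  invFun x := mk x.1 x.2.1 x.2.2.1 x.2.2.2.1 x.2.2.2.2.1 x.2.2.2.2.2
  map_add' _ _ := rfl
  map_smul' _ _ := rfl
  left_inv _ := rfl
  right_inv _ := rfl

theorem norm_le_of_mul_sq_le {X : Type*} [NormedAddCommGroup X] {a N : ℝ} {x : X} (ha : 0 < a)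
    (hN : 0 ≤ N) (h : a * ‖x‖ ^ 2 ≤ N ^ 2) : ‖x‖ ≤ √(a⁻¹) * N := by
  refine abs_le_of_sq_le_sq' ?_ (by positivity) |>.2
  rw [mul_pow, Real.sq_sqrt (by positivity), inv_mul_eq_div, le_div_iff₀' ha]
  exact h

/-- The identification of the energy space with a product of Banach spaces. -/
noncomputable def prodL (p : Params) (σ : ℝ → ℝ) :
    State p σ ≃L[ℂ] HL1 p.L × L2 p.L × HL1 p.L × L2 p.L × L2 p.L × W p.L σ :=
  (prodₗ p σ).toContinuousLinearEquivOfBounds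
    (√(p.ρ⁻¹) + √(p.α₁⁻¹) + √(p.μ⁻¹) + (√(p.β⁻¹) + |p.γ| * √(p.α₁⁻¹)) + √(1⁻¹) + √(p.c⁻¹))
    (√(p.ρ + p.α₁ + p.μ + p.β * (|p.γ| + 1) ^ 2 + 1 + p.c))
    (fun U => by
      have := p.ρ_pos; have := p.α₁_pos; have := p.β_pos; have := p.μ_pos; have := p.c_pos
      have hU := U.norm_sq
      have n1 : 0 ≤ p.ρ * ‖U.v‖ ^ 2 := by positivity
      have n2 : 0 ≤ p.α₁ * ‖U.u.D‖ ^ 2 := by positivity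
      have n3 : 0 ≤ p.μ * ‖U.z‖ ^ 2 := by positivity
      have n4 : 0 ≤ p.β * ‖(p.γ : ℂ) • U.u.D - U.y.D‖ ^ 2 := by positivity
      have n5 : 0 ≤ ‖U.w‖ ^ 2 := by positivity
      have n6 : 0 ≤ p.c * ‖U.η‖ ^ 2 := by positivity
      have h1 := norm_le_of_mul_sq_le (x := U.v) p.ρ_pos (norm_nonneg U) (by linarith)
      have h2 := norm_le_of_mul_sq_le (x := U.u.D) p.α₁_pos (norm_nonneg U) (by linarith)
      have h3 := norm_le_of_mul_sq_le (x := U.z) p.μ_pos (norm_nonneg U) (by linarith)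
      have h4 := norm_le_of_mul_sq_le (x := (p.γ : ℂ) • U.u.D - U.y.D) p.β_pos (norm_nonneg U)
        (by linarith)
      have h5 := norm_le_of_mul_sq_le (x := U.w) one_pos (norm_nonneg U) (by linarith)
      have h6 := norm_le_of_mul_sq_le (x := U.η) p.c_pos (norm_nonneg U) (by linarith)
      -- The energy controls `y_x` only through `γ u_x - y_x`, so it is recovered as `γ u_x - (γ u_x
      -- - y_x)`.
      have h7 : ‖U.y.D‖ ≤ (√(p.β⁻¹) + |p.γ| * √(p.α₁⁻¹)) * ‖U‖ := by
        have e : U.y.D = (p.γ : ℂ) • U.u.D - ((p.γ : ℂ) • U.u.D - U.y.D) := by abel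
        have e1 : ‖(p.γ : ℂ) • U.u.D‖ ≤ |p.γ| * (√(p.α₁⁻¹) * ‖U‖) := by
          rw [norm_smul, Complex.norm_real, Real.norm_eq_abs]
          gcongr
        rw [e]
        refine (norm_sub_le _ _).trans ?_
        linarith
      rw [HL1.norm_D] at h2 h7
      have m1 : 0 ≤ √(p.ρ⁻¹) * ‖U‖ := by positivity
      have m2 : 0 ≤ √(p.α₁⁻¹) * ‖U‖ := by positivity
      have m3 : 0 ≤ √(p.μ⁻¹) * ‖U‖ := by positivity
      have m4 : 0 ≤ (√(p.β⁻¹) + |p.γ| * √(p.α₁⁻¹)) * ‖U‖ := by positivity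
      have m5 : 0 ≤ √(1⁻¹) * ‖U‖ := by positivity
      have m6 : 0 ≤ √(p.c⁻¹) * ‖U‖ := by positivity
      change ‖(U.u, U.v, U.y, U.z, U.w, U.η)‖ ≤ _
      simp only [add_mul _ _ ‖U‖] at *
      simp only [Prod.norm_mk, sup_le_iff]
      refine ⟨?_, ?_, ?_, ?_, ?_, ?_⟩ <;> linarith)
    (fun x => by
      obtain ⟨u, v, y, z, w, η⟩ := x
      have := p.ρ_pos; have := p.α₁_pos; have := p.β_pos; have := p.μ_pos; have := p.c_pos
      set N := ‖(u, v, y, z, w, η)‖ with hN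
      have hN0 : 0 ≤ N := norm_nonneg _
      obtain ⟨h1, h2, h3, h4, h5, h6⟩ : ‖u‖ ≤ N ∧ ‖v‖ ≤ N ∧ ‖y‖ ≤ N ∧ ‖z‖ ≤ N ∧ ‖w‖ ≤ N ∧
          ‖η‖ ≤ N := by
        have := le_refl N
        nth_rewrite 1 [hN] at this
        simpa only [Prod.norm_mk, sup_le_iff] using this
      change ‖mk u v y z w η‖ ≤ _
      refine abs_le_of_sq_le_sq' ?_ (by positivity) |>.2
      have h7 : ‖(p.γ : ℂ) • u.D - y.D‖ ≤ (|p.γ| + 1) * N := by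
        refine (norm_sub_le _ _).trans ?_
        rw [norm_smul, Complex.norm_real, Real.norm_eq_abs, HL1.norm_D, HL1.norm_D, add_mul,
          one_mul]
        gcongr
      rw [norm_sq, mul_pow, Real.sq_sqrt (by positivity)]
      simp only [u_mk, v_mk, y_mk, z_mk, w_mk, η_mk]
      rw [HL1.norm_D]
      have e : (p.ρ + p.α₁ + p.μ + p.β * (|p.γ| + 1) ^ 2 + 1 + p.c) * N ^ 2
        = p.ρ * N ^ 2 + p.α₁ * N ^ 2 + p.μ * N ^ 2 + p.β * ((|p.γ| + 1) * N) ^ 2 + N ^ 2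
          + p.c * N ^ 2 := by ring
      rw [e]
      gcongr)

@[simp] theorem prodL_apply (U : State p σ) :
    prodL p σ U = (U.u, U.v, U.y, U.z, U.w, U.η) := rfl

instance : CompleteSpace (State p σ) :=
  (completeSpace_congr (e := (prodL p σ).toEquiv) (prodL p σ).isUniformEmbedding).2 inferInstance

theorem tendsto_zero_iff {ι : Type*} {l : Filter ι} {U : ι → State p σ} :
    Tendsto U l (𝓝 0) ↔ Tendsto (fun i => (U i).u) l (𝓝 0) ∧ Tendsto (fun i => (U i).v) l (𝓝 0) ∧
      Tendsto (fun i => (U i).y) l (𝓝 0) ∧ Tendsto (fun i => (U i).z) l (𝓝 0) ∧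
      Tendsto (fun i => (U i).w) l (𝓝 0) ∧ Tendsto (fun i => (U i).η) l (𝓝 0) := by
  rw [(prodL p σ).isUniformEmbedding.isInducing.tendsto_nhds_iff, map_zero]
  simp only [← Prod.mk_zero_zero, Function.comp_def, prodL_apply, nhds_prod_eq, tendsto_prod_iff']

theorem exists_norm_u_le (p : Params) (σ : ℝ → ℝ) : ∃ C, ∀ U : State p σ, ‖U.u‖ ≤ C * ‖U‖ :=
  ⟨_, fun U => (norm_fst_le (prodL p σ U)).trans
    ((prodL p σ).toContinuousLinearMap.le_opNorm U)⟩

end State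

/-! ### Dissipativity -/

section Dissipative

variable {p : Params} {σ : ℝ → ℝ}

/-- All terms except the memory term cancel in pairs after integration by parts: the elastic ones
through `α = α₁ + γ²β`, the thermal coupling `δ` between the second and fifth equations, and `c
Λ_xx` against the term `w` of the last equation. -/
theorem re_inner_A₁ (hσ : ConditionH σ) (U : (A₁ p hσ).domain) :
    (inner ℂ (A₁ p hσ U) (U : State p σ)).re
      = -p.c * (inner ℂ (ds U.1.η) U.1.η).re := by
  obtain ⟨U, hU⟩ := U
  obtain ⟨hv, hz, hu, hy, hw, hΛ, hη, hη0⟩ := id hU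
  have hL := p.L_pos
  have hρ : (p.ρ : ℂ) * (p.ρ : ℂ)⁻¹ = 1 := mul_inv_cancel₀ (by exact_mod_cast p.ρ_pos.ne')
  have hμ : (p.μ : ℂ) * (p.μ : ℂ)⁻¹ = 1 := mul_inv_cancel₀ (by exact_mod_cast p.μ_pos.ne')
  have t1 := re_inner_dx_of_traceZero hL hu.1 hu.2 hv
  have t2 := re_inner_dx_of_traceZero hL hy.1 hy.2 hv
  have t3 := re_inner_dx_of_traceZero hL hu.1 hu.2 hz
  have t4 := re_inner_dx_of_traceZero hL hy.1 hy.2 hz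
  have t5 := re_inner_dx_of_mem_H01 hL hv.1 hw
  have t6 := re_inner_dx_of_mem_H01 hL hΛ hw
  have sy : ∀ a b : L2 p.L, (inner ℂ a b).re = (inner ℂ b a).re := fun a b =>
    inner_re_symm (𝕜 := ℂ) a b
  have t7 : inner ℂ (constW hσ (H01.mk U.w hw)) U.η = inner ℂ (dx U.w) (dx (Lam U.η).toL2) := by
    rw [inner_constW, H01.inner_eq]; rfl
  rw [State.inner_def]
  change (State.energyInner (A₁Fun hσ ⟨U, hU⟩) U).re = _
  simp only [State.energyInner, A₁Fun, State.u_mk, State.v_mk, State.y_mk, State.z_mk,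
    State.w_mk, State.η_mk, inner_smul_left, inner_add_left, inner_sub_left, inner_sub_right,
    inner_smul_right, inner_neg_left, t7, map_mul, map_inv₀, Complex.conj_ofReal, ← mul_assoc,
    hρ, hμ, one_mul]
  have hD : ∀ (a : L2 p.L) (h : a ∈ HL1Sub p.L), (HL1.mk a h).D = dx a := fun _ _ => rfl
  have hD' : ∀ a : HL1 p.L, a.D = dx a.toL2 := fun _ => rfl
  simp only [hD, hD']
  simp only [← Complex.ofReal_mul, Complex.add_re, Complex.sub_re, Complex.neg_re, mul_sub,
    mul_add, ← mul_assoc, mul_neg, Complex.re_ofReal_mul]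
  rw [t1, t2, t3, t4, t5, t6, sy U.v (dx U.w), sy (dx U.v) (dx U.u.toL2),
    sy (dx U.v) (dx U.y.toL2), sy (dx U.z) (dx U.u.toL2), sy (dx U.z) (dx U.y.toL2),
    sy (dx U.w) (dx (Lam U.η).toL2)]
  simp only [Params.α]
  ring

end Dissipative

/-! ### The a priori estimate on the imaginary axis -/

section Sobolev

variable {L : ℝ}

theorem HL1.norm_toL2_le (hL : 0 < L) (u : HL1 L) : ‖u.toL2‖ ≤ L * ‖u‖ := by
  rw [← HL1.norm_D]
  exact norm_le_norm_dx hL u.toL2_mem.1 (Or.inl u.toL2_mem.2)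

/-- Subtracting from `g ∈ H¹(0, L)` its value at `0` costs little if `g` is small in `L²(0, L)`. -/
theorem exists_mem_HL1_sub (hL : 0 < L) {g : L2 L} (hg : g ∈ H1 L) :
    ∃ h : HL1 L, h.D = dx g ∧ ‖g - h.toL2‖ ^ 2 ≤ ‖g‖ ^ 2 + 2 * L * (‖g‖ * ‖dx g‖) := by
  obtain ⟨h, hh⟩ := HL1.Dᵢ_surjective (dx g)
  have hD : dx h.toL2 = dx g := hh
  refine ⟨h, hh, ?_⟩
  obtain ⟨k, hk, -, -⟩ := exists_ae_eq_prim hL hg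
  obtain ⟨l, hl, hl0, -⟩ := exists_ae_eq_prim hL h.toL2_mem.1
  have h1 : ∀ᵐ x ∂(volume.restrict (Ioo 0 L)), ‖(g - h.toL2 : L2 L) x‖ ≤ ‖k‖ := by
    filter_upwards [hk, hl, Lp.coeFn_sub g h.toL2] with x e1 e2 e3
    rw [e3, Pi.sub_apply, e1, e2, hl0 h.toL2_mem.2, hD]
    simp [prim]
  have h2 := Lp.norm_le_of_ae_bound (norm_nonneg k) h1
  have h4 : (measureUnivNNReal (volume.restrict (Ioo 0 L)) : ℝ) = L := by
    change (volume.restrict (Ioo 0 L)).real univ = L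
    rw [measureReal_restrict_apply_univ, Real.volume_real_Ioo_of_le hL.le, sub_zero]
  rw [h4, ENNReal.toReal_ofNat, ← one_div, ← Real.sqrt_eq_rpow] at h2
  refine le_trans ?_ (trace_sq_le hL hk)
  refine (pow_le_pow_left₀ (norm_nonneg _) h2 2).trans_eq ?_
  rw [mul_pow, Real.sq_sqrt hL.le]

end Sobolev

section Memory

variable {L : ℝ} {σ : ℝ → ℝ}

/-- Weighted averages in `s` against a test function. -/
theorem test_eq (hσ : ConditionH σ) {φ : ℝ → ℝ} (hφ : IsTest (memSupport σ) φ)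
    (hφ1 : ∫ s in memSupport σ, φ s = 1) {η f : W L σ} {w : H01 L} {z : ℂ}
    (h : HasDs η (constW hσ w - z • η + f)) :
    w = -(∫ s in memSupport σ, deriv φ s • η s) + z • (∫ s in memSupport σ, φ s • η s)
      - ∫ s in memSupport σ, φ s • f s := by
  have h1 := h φ hφ
  have i : ∀ g : W L σ, Integrable (fun s => φ s • g s) (volume.restrict (memSupport σ)) :=
    fun g => hφ.integrable (W.loc hσ g)
  have h2 : ∫ s in memSupport σ, φ s • (constW hσ w - z • η + f : W L σ) s
      = ∫ s in memSupport σ, (φ s • constW hσ w s - z • φ s • η s + φ s • f s) := by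
    refine integral_congr_ae ?_
    filter_upwards [W.ae_restrict hσ (Lp.coeFn_add (constW hσ w - z • η) f),
      W.ae_restrict hσ (Lp.coeFn_sub (constW hσ w) (z • η)),
      W.ae_restrict hσ (Lp.coeFn_smul z η)] with s e1 e2 e3
    simp only [e1, Pi.add_apply, e2, Pi.sub_apply, e3, Pi.smul_apply, smul_add, smul_sub,
      smul_comm (φ s) z]
  have h3 : ∫ s in memSupport σ, φ s • constW hσ w s = w := by
    rw [integral_congr_ae (g := fun s => φ s • w)
      ((W.ae_restrict hσ (coeFn_constW hσ w)).mono fun s hs => by simp only [hs]),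
      integral_smul_const, hφ1, one_smul]
  have i1 : Integrable (fun s => z • φ s • η s) (volume.restrict (memSupport σ)) := (i η).smul z
  have i2 : Integrable (fun s => φ s • constW hσ w s - z • φ s • η s)
      (volume.restrict (memSupport σ)) := (i _).sub i1
  rw [h1, h2, integral_add i2 (i f), integral_sub (i _) i1, h3, integral_smul]
  abel

end Memory

/-! ### Resolvent equations and propagation of smallness through the system -/

section APriori

variable {p : Params} {σ : ℝ → ℝ}

theorem tendsto_norm_of_sq_le {ι X : Type*} [SeminormedAddCommGroup X] {l : Filter ι} {x : ι → X}
    {a : ι → ℝ} (h : ∀ i, ‖x i‖ ^ 2 ≤ a i) (ha : Tendsto a l (𝓝 0)) : Tendsto x l (𝓝 0) := by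
  refine squeeze_zero_norm (fun i => ?_) (by simpa using ha.sqrt)
  exact Real.le_sqrt_of_sq_le (h i)

theorem tendsto_zero_of_tendsto_smul {ι X : Type*} [NormedAddCommGroup X] [NormedSpace ℂ X]
    {l : Filter ι} {x : ι → X} {c : ℂ} (hc : c ≠ 0) (h : Tendsto (fun i => c • x i) l (𝓝 0)) :
    Tendsto x l (𝓝 0) := by
  simpa [smul_smul, inv_mul_cancel₀ hc] using h.const_smul c⁻¹

theorem resolvent_equations (hσ : ConditionH σ) (z : ℂ) (U : (A₁ p hσ).domain) {F : State p σ}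
    (hF : z • (U : State p σ) - A₁ p hσ U = F) :
    HL1.mk U.1.v U.2.1 = z • U.1.u - F.u ∧
    (p.α : ℂ) • dx (dx U.1.u.toL2) - (p.γ * p.β : ℂ) • dx (dx U.1.y.toL2)
      = (p.ρ : ℂ) • (z • U.1.v - F.v) + (p.δ : ℂ) • dx U.1.w ∧
    HL1.mk U.1.z U.2.2.1 = z • U.1.y - F.y ∧
    (p.β : ℂ) • dx (dx U.1.y.toL2) - (p.γ * p.β : ℂ) • dx (dx U.1.u.toL2)
      = (p.μ : ℂ) • (z • U.1.z - F.z) ∧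
    (p.c : ℂ) • dx (dx (Lam U.1.η).toL2) = (p.δ : ℂ) • dx U.1.v + z • U.1.w - F.w ∧
    ds U.1.η = constW hσ (H01.mk U.1.w U.2.2.2.2.2.1) - z • U.1.η + F.η := by
  have hρ : (p.ρ : ℂ) ≠ 0 := by exact_mod_cast p.ρ_pos.ne'
  have hμ : (p.μ : ℂ) ≠ 0 := by exact_mod_cast p.μ_pos.ne'
  have e1 : F.u = z • U.1.u - HL1.mk U.1.v U.2.1 := hF ▸ rfl
  have e2 : F.v = z • U.1.v - (p.ρ⁻¹ : ℂ) • ((p.α : ℂ) • dx (dx U.1.u.toL2)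
      - (p.γ * p.β : ℂ) • dx (dx U.1.y.toL2) - (p.δ : ℂ) • dx U.1.w) := hF ▸ rfl
  have e3 : F.y = z • U.1.y - HL1.mk U.1.z U.2.2.1 := hF ▸ rfl
  have e4 : F.z = z • U.1.z - (p.μ⁻¹ : ℂ) • ((p.β : ℂ) • dx (dx U.1.y.toL2)
      - (p.γ * p.β : ℂ) • dx (dx U.1.u.toL2)) := hF ▸ rfl
  have e5 : F.w = z • U.1.w - ((p.c : ℂ) • dx (dx (Lam U.1.η).toL2) - (p.δ : ℂ) • dx U.1.v) :=
    hF ▸ rfl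
  have e6 : F.η = z • U.1.η - (-ds U.1.η + constW hσ (H01.mk U.1.w U.2.2.2.2.2.1)) := hF ▸ rfl
  refine ⟨?_, ?_, ?_, ?_, ?_, ?_⟩
  · rw [e1]; abel
  · rw [e2, sub_sub_cancel, smul_smul, mul_inv_cancel₀ hρ, one_smul, sub_add_cancel]
  · rw [e3]; abel
  · rw [e4, sub_sub_cancel, smul_smul, mul_inv_cancel₀ hμ, one_smul]
  · rw [e5]; abel
  · rw [e6]; abel

/-- The term `iλ ‖U‖²` is purely imaginary, so only the dissipation survives in the real part. -/
theorem re_inner_resolvent (hσ : ConditionH σ) (r : ℝ) (U : (A₁ p hσ).domain) {F : State p σ}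
    (hF : (Complex.I * r) • (U : State p σ) - A₁ p hσ U = F) :
    (inner ℂ F (U : State p σ)).re = p.c * (inner ℂ (ds U.1.η) U.1.η).re := by
  rw [← hF, inner_sub_left, inner_smul_left, inner_self_eq_norm_sq_to_K, Complex.sub_re,
    re_inner_A₁]
  simp [← Complex.ofReal_pow]

set_option maxHeartbeats 1000000 in
/-- A bounded sequence of approximate solutions of `(iλ - 𝒜₁) U = 0` tends to zero. -/
theorem tendsto_zero_of_resolvent (hσ : ConditionH σ) (r : ℝ) {U : ℕ → (A₁ p hσ).domain}
    (hb : ∀ n, ‖(U n : State p σ)‖ ≤ 1)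
    (hF : Tendsto (fun n => (Complex.I * r) • (U n : State p σ) - A₁ p hσ (U n)) atTop (𝓝 0)) :
    Tendsto (fun n => (U n : State p σ)) atTop (𝓝 0) := by
  have hL := p.L_pos
  have hc := p.c_pos
  set z : ℂ := Complex.I * r with hz
  obtain ⟨F, hFU⟩ : ∃ F : ℕ → State p σ, ∀ n, z • (U n : State p σ) - A₁ p hσ (U n) = F n :=
    ⟨_, fun n => rfl⟩
  simp only [hFU] at hF
  obtain ⟨d, hd, hdσ⟩ := hσ.dafermos
  -- the components of the equation
  have hv : ∀ n, (U n).1.v ∈ HL1Sub p.L := fun n => (U n).2.1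
  have hzc : ∀ n, (U n).1.z ∈ HL1Sub p.L := fun n => (U n).2.2.1
  have hu : ∀ n, dx (U n).1.u.toL2 ∈ H1 p.L ∧ TraceZero p.L (dx (U n).1.u.toL2) :=
    fun n => (U n).2.2.2.1
  have hy : ∀ n, dx (U n).1.y.toL2 ∈ H1 p.L ∧ TraceZero p.L (dx (U n).1.y.toL2) :=
    fun n => (U n).2.2.2.2.1
  have hw : ∀ n, (U n).1.w ∈ H01Sub p.L := fun n => (U n).2.2.2.2.2.1
  have hΛ : ∀ n, dx (Lam (U n).1.η).toL2 ∈ H1 p.L := fun n => (U n).2.2.2.2.2.2.1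
  have hη : ∀ n, HasDs (U n).1.η (ds (U n).1.η) := fun n => ds_spec (U n).2.2.2.2.2.2.2.1
  have hη0 : ∀ n, InitZero (U n).1.η := fun n => (U n).2.2.2.2.2.2.2.2
  choose E1 E2 E3 E4 E5 E6 using fun n => resolvent_equations hσ z (U n) (hFU n)
  obtain ⟨f1, f2, f3, f4, f5, f6⟩ := State.tendsto_zero_iff.1 hF
  have toL2 : ∀ {x : ℕ → HL1 p.L}, Tendsto x atTop (𝓝 0) →
      Tendsto (fun n => (x n).toL2) atTop (𝓝 0) := fun {x} hx =>
    squeeze_zero_norm (fun n => HL1.norm_toL2_le hL (x n)) (by simpa using hx.norm.const_mul p.L)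
  have toD : ∀ {x : ℕ → HL1 p.L}, Tendsto (fun n => (x n).D) atTop (𝓝 0) ↔
      Tendsto x atTop (𝓝 0) := fun {x} => by
    rw [tendsto_zero_iff_norm_tendsto_zero]
    simp only [HL1.norm_D]
    rw [← tendsto_zero_iff_norm_tendsto_zero]
  -- dissipation
  have s1 : Tendsto (fun n => (U n).1.η) atTop (𝓝 0) := by
    refine tendsto_norm_of_sq_le (a := fun n => 2 / (d * p.c) * ‖F n‖) (fun n => ?_)
      (by simpa using hF.norm.const_mul (2 / (d * p.c)))
    have h1 := norm_sq_le_re_inner_ds hσ hdσ (hη n) (hη0 n)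
    have h4 : (inner ℂ (F n) ((U n : State p σ))).re ≤ ‖F n‖ :=
      ((Complex.re_le_norm _).trans (norm_inner_le_norm _ _)).trans
        (mul_le_of_le_one_right (norm_nonneg _) (hb n))
    rw [re_inner_resolvent hσ r (U n) (hFU n)] at h4
    rw [div_mul_eq_mul_div, le_div_iff₀ (by positivity)]
    nlinarith
  -- the temperature
  have s2 : Tendsto (fun n => H01.mk (U n).1.w (hw n)) atTop (𝓝 0) := by
    -- With `∫ φ = 1` the last equation, tested against `φ`, expresses the constant `w` through
    -- integrals of `η` and `F.η`, all of which tend to zero in `H¹_0`.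
    obtain ⟨φ, hφ, hφ1⟩ := exists_isTest_integral_eq_one hσ
    have key : ∀ {ψ : ℝ → ℝ} {x : ℕ → W p.L σ}, IsTest (memSupport σ) ψ → Tendsto x atTop (𝓝 0) →
        Tendsto (fun n => ∫ s in memSupport σ, ψ s • x n s) atTop (𝓝 0) := fun {ψ x} hψ hx => by
      obtain ⟨C, hC⟩ := exists_norm_integral_test_le (L := p.L) hσ hψ
      exact squeeze_zero_norm (fun n => hC (x n)) (by simpa using hx.norm.const_mul C)
    have h1 := ((key hφ.deriv s1).neg.add ((key hφ s1).const_smul z)).sub (key hφ f6)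
    simp only [neg_zero, smul_zero, add_zero, sub_zero] at h1
    refine h1.congr fun n => (test_eq hσ hφ hφ1 ?_).symm
    rw [← E6 n]
    exact hη n
  have s2' : Tendsto (fun n => dx (U n).1.w) atTop (𝓝 0) := by
    rw [tendsto_zero_iff_norm_tendsto_zero] at s2 ⊢
    exact s2.congr fun n => (H01.norm_dx (H01.mk (U n).1.w (hw n))).symm
  have s2'' : Tendsto (fun n => (U n).1.w) atTop (𝓝 0) :=
    squeeze_zero_norm (fun n => norm_le_norm_dx hL (hw n).1 (Or.inl (hw n).2.1))
      (by simpa using s2'.norm.const_mul p.L)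
  -- the velocity
  have s3 : Tendsto (fun n => dx (Lam (U n).1.η).toL2) atTop (𝓝 0) :=
    squeeze_zero_norm (fun n => (H01.norm_dx (Lam (U n).1.η)).trans_le (norm_Lam_le hσ _))
      (by simpa using s1.norm.const_mul _)
  -- The heat equation bounds `Λ_xx` by `v_x`, and `v = z u - F.u` is bounded in `H¹_L` because `u`
  -- is.
  obtain ⟨B, hB⟩ : ∃ B, ∀ᶠ n in atTop, ‖dx (dx (Lam (U n).1.η).toL2)‖ ≤ B := by
    obtain ⟨C, hC⟩ := State.exists_norm_u_le p σ
    have h1 : ∀ n, ‖dx (U n).1.v‖ ≤ ‖z‖ * |C| + ‖(F n).u‖ := fun n => by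
      have h2 : ‖dx (U n).1.v‖ = ‖HL1.mk (U n).1.v (hv n)‖ := HL1.norm_D (HL1.mk (U n).1.v (hv n))
      rw [h2, E1]
      refine (norm_sub_le _ _).trans (add_le_add_left ?_ _)
      rw [norm_smul]
      gcongr
      calc ‖(U n).1.u‖ ≤ C * ‖(U n).1‖ := hC _
        _ ≤ |C| * ‖(U n).1‖ := by gcongr; exact le_abs_self C
        _ ≤ |C| := mul_le_of_le_one_right (abs_nonneg C) (hb n)
    have h2 : ∀ n, ‖dx (dx (Lam (U n).1.η).toL2)‖
        ≤ p.c⁻¹ * (|p.δ| * (‖z‖ * |C| + ‖(F n).u‖) + ‖z‖ * ‖(U n).1.w‖ + ‖(F n).w‖) := fun n => by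
      rw [le_inv_mul_iff₀ hc]
      have h3 := congrArg norm (E5 n)
      rw [norm_smul, Complex.norm_real, Real.norm_of_nonneg hc.le] at h3
      rw [h3]
      refine (norm_sub_le _ _).trans (add_le_add_left ((norm_add_le _ _).trans ?_) _)
      rw [norm_smul, norm_smul, Complex.norm_real, Real.norm_eq_abs]
      gcongr
      exact h1 n
    have h3 := (((((f1.norm.const_add (‖z‖ * |C|)).const_mul |p.δ|).add
      (s2''.norm.const_mul ‖z‖)).add f5.norm).const_mul p.c⁻¹).eventually_le_const (lt_add_one _)
    exact ⟨_, h3.mono fun n hn => (h2 n).trans hn⟩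
  -- `h` is `Λ_x` minus its value at `0`, so that it lies in `H¹_L`. The correction is small because
  -- `Λ_x → 0` while `Λ_xx` stays bounded.
  choose h hh hh' using fun n => exists_mem_HL1_sub hL (hΛ n)
  have s4 : Tendsto (fun n => dx (Lam (U n).1.η).toL2 - (h n).toL2) atTop (𝓝 0) := by
    refine tendsto_norm_of_sq_le hh' ?_
    have h1 : Tendsto (fun n => ‖dx (Lam (U n).1.η).toL2‖ * ‖dx (dx (Lam (U n).1.η).toL2)‖)
        atTop (𝓝 0) :=
      squeeze_zero' (Eventually.of_forall fun n => by positivity)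
        (hB.mono fun n hn => mul_le_mul_of_nonneg_left hn (norm_nonneg _))
        (by simpa using s3.norm.mul_const B)
    simpa using (s3.norm.pow 2).add (h1.const_mul (2 * p.L))
  -- The derivative of `δ v - c h` is `δ v_x - c Λ_xx = F.w - z w`, which tends to zero. Hence so
  -- does the function in `H¹_L`, and then in `L²` by the Poincaré inequality.
  have s5 : Tendsto (fun n => (p.δ : ℂ) • HL1.mk (U n).1.v (hv n) - (p.c : ℂ) • h n) atTop
      (𝓝 0) := by
    rw [← toD]
    have h1 := f5.sub (s2''.const_smul z)
    simp only [smul_zero, sub_zero] at h1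
    refine h1.congr fun n => ?_
    rw [map_sub, map_smul, map_smul, hh, E5]
    change _ = (p.δ : ℂ) • dx (U n).1.v - _
    abel
  have s6 : Tendsto (fun n => (U n).1.v) atTop (𝓝 0) := by
    have h1 := ((toL2 s5).sub (s4.const_smul (p.c : ℂ))).add (s3.const_smul (p.c : ℂ))
    simp only [smul_zero, sub_zero, add_zero] at h1
    refine tendsto_zero_of_tendsto_smul (c := (p.δ : ℂ)) (by exact_mod_cast p.δ_ne)
      (h1.congr fun n => ?_)
    rw [map_sub, map_smul, map_smul, HL1.toL2_mk]
    module
  -- the displacements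
  have s7 : Tendsto (fun n => z • (U n).1.u.toL2) atTop (𝓝 0) := by
    have h1 := s6.add (toL2 f1)
    rw [add_zero] at h1
    refine h1.congr fun n => ?_
    have h2 := congrArg HL1.toL2 (E1 n)
    rw [HL1.toL2_mk, map_sub, map_smul] at h2
    rw [h2]
    abel
  -- The combination of `u_x` and `y_x` vanishes at `L`, so the Poincaré inequality from that
  -- endpoint converts smallness of second derivatives in `L²` into smallness in `H¹_L`.
  have hP : ∀ (a b : ℂ) (u y : ℕ → HL1 p.L),
      (∀ n, (u n).D ∈ H1 p.L ∧ TraceZero p.L (u n).D) →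
      (∀ n, (y n).D ∈ H1 p.L ∧ TraceZero p.L (y n).D) →
      Tendsto (fun n => a • dx (u n).D - b • dx (y n).D) atTop (𝓝 0) →
      Tendsto (fun n => a • u n - b • y n) atTop (𝓝 0) := by
    intro a b u y hu hy h
    rw [← toD]
    have hm : ∀ n, a • (u n).D - b • (y n).D = a • (u n).D + (-b) • (y n).D := fun n => by module
    refine squeeze_zero_norm (a := fun n => p.L * ‖a • dx (u n).D - b • dx (y n).D‖) (fun n => ?_)
      (by simpa using h.norm.const_mul p.L)
    rw [map_sub, map_smul, map_smul, hm]
    refine (norm_le_norm_dx hL (add_mem ((H1 _).smul_mem a (hu n).1) ((H1 _).smul_mem (-b) (hy n).1))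
      (Or.inr (((hu n).2.smul a).add ((hy n).2.smul (-b))))).trans_eq ?_
    rw [dx_add ((H1 _).smul_mem a (hu n).1) ((H1 _).smul_mem (-b) (hy n).1), dx_smul a (hu n).1,
      dx_smul (-b) (hy n).1, neg_smul, sub_eq_add_neg]
  have s8 : Tendsto (fun n => (p.α : ℂ) • (U n).1.u - (p.γ * p.β : ℂ) • (U n).1.y) atTop (𝓝 0) := by
    refine hP _ _ _ _ hu hy ?_
    have h1 := (((s6.const_smul z).sub f2).const_smul (p.ρ : ℂ)).add (s2'.const_smul (p.δ : ℂ))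
    simp only [smul_zero, sub_zero, add_zero] at h1
    exact h1.congr fun n => (E2 n).symm
  -- From `γβ z y = α z u - z (α u - γβ y)`; this is where `γ ≠ 0` enters.
  have s9 : Tendsto (fun n => z • (U n).1.y.toL2) atTop (𝓝 0) := by
    have h1 := (s7.const_smul (p.α : ℂ)).sub ((toL2 s8).const_smul z)
    simp only [smul_zero, sub_zero] at h1
    refine tendsto_zero_of_tendsto_smul (c := (p.γ * p.β : ℂ))
      (mul_ne_zero (by exact_mod_cast p.γ_ne) (by exact_mod_cast p.β_pos.ne')) (h1.congr fun n => ?_)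
    rw [map_sub, map_smul, map_smul]
    module
  have s10 : Tendsto (fun n => (U n).1.z) atTop (𝓝 0) := by
    have h1 := s9.sub (toL2 f3)
    rw [sub_zero] at h1
    refine h1.congr fun n => ?_
    have h2 := congrArg HL1.toL2 (E3 n)
    rw [HL1.toL2_mk, map_sub, map_smul] at h2
    exact h2.symm
  have s11 : Tendsto (fun n => (p.β : ℂ) • (U n).1.y - (p.γ * p.β : ℂ) • (U n).1.u) atTop (𝓝 0) := by
    refine hP _ _ _ _ hy hu ?_
    have h1 := (((s10.const_smul z).sub f4).const_smul (p.μ : ℂ))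
    simp only [smul_zero, sub_zero] at h1
    exact h1.congr fun n => (E4 n).symm
  -- Elimination of `y`: `(α u - γβ y) + γ (β y - γβ u) = α₁ u`.
  have s12 : Tendsto (fun n => (U n).1.u) atTop (𝓝 0) := by
    have h1 := s8.add (s11.const_smul (p.γ : ℂ))
    simp only [smul_zero, add_zero] at h1
    refine tendsto_zero_of_tendsto_smul (c := (p.α₁ : ℂ)) (by exact_mod_cast p.α₁_pos.ne')
      (h1.congr fun n => ?_)
    simp only [Params.α]
    push_cast
    module
  have s13 : Tendsto (fun n => (U n).1.y) atTop (𝓝 0) := by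
    have h1 := s11.add (s12.const_smul (p.γ * p.β : ℂ))
    simp only [smul_zero, add_zero] at h1
    refine tendsto_zero_of_tendsto_smul (c := (p.β : ℂ)) (by exact_mod_cast p.β_pos.ne')
      (h1.congr fun n => ?_)
    abel
  exact State.tendsto_zero_iff.2 ⟨s12, s6, s13, s10, s2'', s1⟩

/-- The a priori estimate for `iλ - 𝒜₁`. -/
theorem exists_norm_le_resolvent (hσ : ConditionH σ) (r : ℝ) :
    ∃ C, 0 < C ∧ ∀ U : (A₁ p hσ).domain, ‖(U : State p σ)‖
      ≤ C * ‖(Complex.I * r) • (U : State p σ) - A₁ p hσ U‖ := by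
  by_contra! hcon
  choose U hU using fun n : ℕ => hcon (n + 1) (by positivity)
  have hpos : ∀ n, 0 < ‖(U n : State p σ)‖ := fun n =>
    lt_of_le_of_lt (by positivity) (hU n)
  -- Normalised counterexamples: unit vectors with residuals below `1 / (n + 1)`, which would have
  -- to tend to zero.
  set V : ℕ → (A₁ p hσ).domain := fun n => ((‖(U n : State p σ)‖⁻¹ : ℝ) : ℂ) • U n with hV
  have hV1 : ∀ n, ‖(V n : State p σ)‖ = 1 := fun n => by
    simp only [hV, Submodule.coe_smul, norm_smul, Complex.norm_real, norm_inv, norm_norm]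
    exact inv_mul_cancel₀ (hpos n).ne'
  have hVF : ∀ n, (Complex.I * r) • (V n : State p σ) - A₁ p hσ (V n)
      = ((‖(U n : State p σ)‖⁻¹ : ℝ) : ℂ) • ((Complex.I * r) • (U n : State p σ) - A₁ p hσ (U n)) :=
    fun n => by
    simp only [hV, LinearPMap.map_smul, Submodule.coe_smul]
    rw [smul_sub, smul_comm]
  have h0 := tendsto_zero_of_resolvent hσ r (U := V) (fun n => (hV1 n).le) (by
    refine squeeze_zero_norm (fun n => ?_) tendsto_one_div_add_atTop_nhds_zero_nat
    rw [hVF, norm_smul, Complex.norm_real, norm_inv, norm_norm, inv_mul_le_iff₀ (hpos n),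
      mul_one_div, le_div_iff₀ (by positivity), mul_comm]
    exact (hU n).le)
  have h1 := h0.norm
  simp only [hV1, norm_zero] at h1
  exact one_ne_zero (tendsto_nhds_unique tendsto_const_nhds h1)

end APriori

/-! ### Inversion of the operator -/

section Sobolev

variable {L : ℝ}

/-- The constant function `1`, as an element of `L²(0, L)`. -/
noncomputable def oneL2 (L : ℝ) : L2 L := Lp.const 2 (volume.restrict (Ioo 0 L)) 1

theorem coeFn_oneL2 (L : ℝ) : oneL2 L =ᵐ[volume.restrict (Ioo 0 L)] fun _ => 1 :=
  Lp.coeFn_const 2 _ _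

theorem hasWeakDerivOn_oneL2 (hL : 0 < L) : HasWeakDerivOn (Ioo 0 L) (oneL2 L) (0 : L2 L) := by
  refine HasWeakDerivOn.congr (f := fun _ => 1) (g := 0) (fun φ hφ => ?_) (coeFn_oneL2 L).symm
    (Lp.coeFn_zero _ _ _).symm
  have h : ∫ x in Ioo 0 L, deriv φ x = 0 := by
    rw [← integral_Ioc_eq_integral_Ioo, ← intervalIntegral.integral_of_le hL.le,
      intervalIntegral.integral_deriv_eq_sub'
        φ rfl (fun x _ => hφ.1.differentiable (by simp) x) hφ.deriv.1.continuous.continuousOn,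
      image_eq_zero_of_notMem_tsupport fun h => (hφ.2.2 h).2.false,
      image_eq_zero_of_notMem_tsupport fun h => (hφ.2.2 h).1.false, sub_zero]
  rw [integral_smul_const, h]
  simp

theorem oneL2_mem_H1 (hL : 0 < L) : oneL2 L ∈ H1 L := ⟨0, hasWeakDerivOn_oneL2 hL⟩

theorem dx_oneL2 (hL : 0 < L) : dx (oneL2 L) = 0 := dx_eq (hasWeakDerivOn_oneL2 hL)

theorem exists_dx_eq_of_traceZero (hL : 0 < L) (g : L2 L) :
    ∃ P, P ∈ H1 L ∧ TraceZero L P ∧ dx P = g := by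
  obtain ⟨G, u, hG, -, -, hu, hd⟩ := exists_primitive g
  have hu1 : u ∈ H1 L := ⟨g, hd⟩
  have h1 := (H1 L).smul_mem (-G L) (oneL2_mem_H1 hL)
  refine ⟨u + (-G L) • oneL2 L, add_mem hu1 h1, ⟨fun x => G x + -G L, by fun_prop, ?_, by simp⟩, ?_⟩
  · filter_upwards [hu, coeFn_oneL2 L, Lp.coeFn_add u ((-G L) • oneL2 L),
      Lp.coeFn_smul (-G L) (oneL2 L)] with x e1 e2 e3 e4
    rw [e3, Pi.add_apply, e4, Pi.smul_apply, e1, e2, smul_eq_mul, mul_one]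
  · rw [dx_add hu1 h1, dx_smul _ (oneL2_mem_H1 hL), dx_oneL2 hL, smul_zero, add_zero, dx_eq hd]

/-- The Dirichlet problem `X_xx = g`, `X(0) = X(L) = 0`. -/
theorem exists_H01_dx_dx_eq (hL : 0 < L) (g : L2 L) :
    ∃ X : H01 L, dx X.toL2 ∈ H1 L ∧ dx (dx X.toL2) = g := by
  obtain ⟨m, hm, -, hmg⟩ := exists_dx_eq_of_traceZero hL g
  -- `κ` is the mean of `m`. Subtracting it gives `X_x` mean zero, which is equivalent to `X(L) =
  -- 0`, and leaves `X_xx` unchanged.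
  set κ : ℂ := (∫ t in Ioo 0 L, m t) / L with hκ
  have h1 := (H1 L).smul_mem (-κ) (oneL2_mem_H1 hL)
  obtain ⟨X, hX⟩ := HL1.Dᵢ_surjective (m + (-κ) • oneL2 L)
  have hXD : dx X.toL2 = m + (-κ) • oneL2 L := hX
  have hmem : X ∈ H01Set L := by
    rw [mem_H01Set_iff hL]
    have e : ∫ t in Ioo 0 L, X.D t = ∫ t in Ioo 0 L, (m t + -κ) := by
      change ∫ t in Ioo 0 L, dx X.toL2 t = _
      rw [hXD]
      refine integral_congr_ae ?_
      filter_upwards [coeFn_oneL2 L, Lp.coeFn_add m ((-κ) • oneL2 L),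
        Lp.coeFn_smul (-κ) (oneL2 L)] with x e2 e3 e4
      rw [e3, Pi.add_apply, e4, Pi.smul_apply, e2, smul_eq_mul, mul_one]
    rw [e, integral_add m.integrable (integrable_const _), setIntegral_const,
      Real.volume_real_Ioo_of_le hL.le, sub_zero, hκ, Complex.real_smul, mul_neg,
      mul_div_cancel₀ _ (by exact_mod_cast hL.ne'), add_neg_cancel]
  have hX1 : dx X.toL2 ∈ H1 L := hXD ▸ add_mem hm h1
  refine ⟨⟨X, hmem⟩, hX1, ?_⟩
  change dx (dx X.toL2) = g
  rw [hXD, dx_add hm h1, dx_smul _ (oneL2_mem_H1 hL), dx_oneL2 hL, smul_zero, add_zero, hmg]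

end Sobolev

/-! ### Explicit solution of the stationary problem -/

section Surjective

variable {p : Params} {σ : ℝ → ℝ}

theorem exists_A₁_eq (hσ : ConditionH σ) (F : State p σ) : ∃ U, A₁ p hσ U = F := by
  have hL := p.L_pos
  have hρ : (p.ρ : ℂ) ≠ 0 := by exact_mod_cast p.ρ_pos.ne'
  have hμ : (p.μ : ℂ) ≠ 0 := by exact_mod_cast p.μ_pos.ne'
  have hα : (p.α₁ : ℂ) ≠ 0 := by exact_mod_cast p.α₁_pos.ne'
  have hβ : (p.β : ℂ) ≠ 0 := by exact_mod_cast p.β_pos.ne'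
  have hc : (p.c : ℂ) ≠ 0 := by exact_mod_cast p.c_pos.ne'
  -- the memory and the temperature
  obtain ⟨X, hX, hXg⟩ := exists_H01_dx_dx_eq hL ((p.c : ℂ)⁻¹ • (F.w + (p.δ : ℂ) • F.u.D))
  -- The last equation forces `η = s w - ∫₀^s F.η`. Applying `Lam` shows which `w` makes `Lam η =
  -- X`.
  obtain ⟨w, hw⟩ := exists_Lam_primW_constW hσ (X + Lam (primW hσ F.η))
  set η : W p.L σ := primW hσ (constW hσ w) + (-1 : ℂ) • primW hσ F.η with hηdef
  have hη : HasDs η (constW hσ w + (-1 : ℂ) • F.η) :=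
    HasDs.add hσ (hasDs_primW hσ _) (HasDs.smul hσ _ (hasDs_primW hσ _))
  have hη0 : InitZero η :=
    (VanishesAt.add (initZero_primW hσ (constW hσ w)) ((VanishesAt.smul (-1 : ℂ)
      (initZero_primW hσ F.η)).congr (W.ae_restrict hσ (Lp.coeFn_smul _ _).symm))).congr
      (W.ae_restrict hσ (Lp.coeFn_add _ _).symm)
  have hΛ : Lam η = X := by
    rw [hηdef, Lam_add hσ, Lam_smul, hw]
    module
  have hwm : w.toL2 ∈ H01Sub p.L := ⟨w.toL2_mem.1, w.toL2_mem.2, w.2⟩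
  -- the displacements
  obtain ⟨P, hP, hP0, hPx⟩ :=
    exists_dx_eq_of_traceZero hL ((p.ρ : ℂ) • F.v + (p.δ : ℂ) • dx w.toL2)
  obtain ⟨Q, hQ, hQ0, hQx⟩ := exists_dx_eq_of_traceZero hL ((p.μ : ℂ) • F.z)
  -- `P` and `Q` are the stresses `α u_x - γβ y_x` and `β y_x - γβ u_x`. The coefficients `a`, `aγ`,
  -- `b` are the entries of the inverse of the stiffness matrix, whose determinant is `α₁β`; its
  -- lower right entry `α / (α₁β)` is written as `β⁻¹ + γ² a`.
  set a : ℂ := (p.α₁ : ℂ)⁻¹ with ha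
  set b : ℂ := (p.β : ℂ)⁻¹ + p.γ ^ 2 * a with hb
  obtain ⟨u, hu⟩ := HL1.Dᵢ_surjective (a • P + (a * p.γ) • Q)
  obtain ⟨y, hy⟩ := HL1.Dᵢ_surjective ((p.γ * a) • P + b • Q)
  have hu' : dx u.toL2 = a • P + (a * p.γ) • Q := hu
  have hy' : dx y.toL2 = (p.γ * a) • P + b • Q := hy
  have mem : ∀ s t : ℂ, s • P + t • Q ∈ H1 p.L ∧ TraceZero p.L (s • P + t • Q) := fun s t =>
    ⟨add_mem ((H1 _).smul_mem s hP) ((H1 _).smul_mem t hQ), (hP0.smul s).add (hQ0.smul t)⟩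
  have hdx : ∀ s t : ℂ, dx (s • P + t • Q) = s • ((p.ρ : ℂ) • F.v + (p.δ : ℂ) • dx w.toL2)
      + t • (p.μ : ℂ) • F.z := fun s t => by
    rw [dx_add ((H1 _).smul_mem s hP) ((H1 _).smul_mem t hQ), dx_smul s hP, dx_smul t hQ, hPx, hQx]
  have e1 : p.α * a - p.γ * p.β * (p.γ * a) = (1 : ℂ) := by
    rw [ha, Params.α]; push_cast; field_simp; ring
  have e2 : p.α * (a * p.γ) - p.γ * p.β * b = (0 : ℂ) := by
    rw [hb, ha, Params.α]; push_cast; field_simp; ring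
  have e3 : p.β * (p.γ * a) - p.γ * p.β * a = (0 : ℂ) := by ring
  have e4 : p.β * b - p.γ * p.β * (a * p.γ) = (1 : ℂ) := by
    rw [hb]; field_simp; ring
  have comb : ∀ (r s t t' k k' : ℂ) (x x' : L2 p.L), r * t - s * k = 1 → r * t' - s * k' = 0 →
      r • (t • x + t' • x') - s • (k • x + k' • x') = x := by
    intro r s t t' k k' x x' h h'
    have : r • (t • x + t' • x') - s • (k • x + k' • x')
      = (r * t - s * k) • x + (r * t' - s * k') • x' := by module
    rw [this, h, h', one_smul, zero_smul, add_zero]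
  have comb' : ∀ (r s t t' k k' : ℂ) (x x' : L2 p.L), r * t - s * k = 0 → r * t' - s * k' = 1 →
      r • (t • x + t' • x') - s • (k • x + k' • x') = x' := by
    intro r s t t' k k' x x' h h'
    rw [add_comm (t • x), add_comm (k • x)]
    exact comb _ _ _ _ _ _ _ _ h' h
  set U : State p σ := .mk u F.u.toL2 y F.y.toL2 w.toL2 η with hU
  have hUd : U ∈ domA hσ := by
    refine ⟨F.u.toL2_mem, F.y.toL2_mem, ?_, ?_, hwm, ?_, ⟨_, hη⟩, hη0⟩
    · change dx u.toL2 ∈ H1 p.L ∧ TraceZero p.L (dx u.toL2)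
      rw [hu']
      exact mem _ _
    · change dx y.toL2 ∈ H1 p.L ∧ TraceZero p.L (dx y.toL2)
      rw [hy']
      exact mem _ _
    · change dx (Lam η).toL2 ∈ H1 p.L
      rw [hΛ]
      exact hX
  refine ⟨⟨U, hUd⟩, State.ext rfl ?_ rfl ?_ ?_ ?_⟩
  · change (p.ρ⁻¹ : ℂ) • ((p.α : ℂ) • dx (dx u.toL2) - (p.γ * p.β : ℂ) • dx (dx y.toL2)
      - (p.δ : ℂ) • dx w.toL2) = F.v
    rw [hu', hy', hdx, hdx, comb _ _ _ _ _ _ _ _ e1 e2, add_sub_cancel_right, smul_smul,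
      inv_mul_cancel₀ hρ, one_smul]
  · change (p.μ⁻¹ : ℂ) • ((p.β : ℂ) • dx (dx y.toL2) - (p.γ * p.β : ℂ) • dx (dx u.toL2)) = F.z
    rw [hu', hy', hdx, hdx, comb' _ _ _ _ _ _ _ _ e3 e4, smul_smul, inv_mul_cancel₀ hμ, one_smul]
  · change (p.c : ℂ) • dx (dx (Lam η).toL2) - (p.δ : ℂ) • F.u.D = F.w
    rw [hΛ, hXg, smul_smul, mul_inv_cancel₀ hc, one_smul, add_sub_cancel_right]
  · change -ds η + constW hσ (H01.mk w.toL2 hwm) = F.η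
    rw [ds_eq hσ hη, show H01.mk w.toL2 hwm = w from H01.toL2_injective rfl]
    module

end Surjective

/-! ### The method of continuity along the imaginary axis -/

section Continuity

variable {H : Type*} [NormedAddCommGroup H] [NormedSpace ℂ H]

/-- The lower bound gives injectivity and bounds the inverse by `C`. The maximum with `0` appears
because `C` is not assumed nonnegative. -/
theorem mem_resolventSet_of_surjective {A : H →ₗ.[ℂ] H} {z : ℂ} {C : ℝ}
    (hC : ∀ U : A.domain, ‖(U : H)‖ ≤ C * ‖z • (U : H) - A U‖)
    (hs : ∀ F, ∃ U : A.domain, z • (U : H) - A U = F) :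
    ∃ R : H →L[ℂ] H, ‖R‖ ≤ max C 0 ∧ (∀ F : H, ∃ h : R F ∈ A.domain, z • R F - A ⟨R F, h⟩ = F) ∧
      ∀ U : A.domain, R (z • (U : H) - A U) = U := by
  let T : A.domain →ₗ[ℂ] H := z • A.domain.subtype - A.toFun
  have hT : ∀ U, T U = z • (U : H) - A U := fun U => rfl
  have hTi : Function.Injective T := by
    rw [← LinearMap.ker_eq_bot, LinearMap.ker_eq_bot']
    intro U hU
    have h1 := hC U
    rw [← hT, hU, norm_zero, mul_zero] at h1
    exact Subtype.ext (norm_le_zero_iff.1 h1)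
  let e : A.domain ≃ₗ[ℂ] H := LinearEquiv.ofBijective T ⟨hTi, hs⟩
  have heT : ∀ F, T (e.symm F) = F := fun F => e.apply_symm_apply F
  have heT' : ∀ U, e.symm (T U) = U := fun U => e.symm_apply_apply U
  let R : H →L[ℂ] H := (A.domain.subtype.comp e.symm.toLinearMap).mkContinuous (max C 0) fun F => by
    change ‖((e.symm F : A.domain) : H)‖ ≤ _
    refine (hC (e.symm F)).trans ?_
    rw [← hT, heT]
    gcongr
    exact le_max_left _ _
  refine ⟨R, LinearMap.mkContinuous_norm_le _ (le_max_right _ _) _,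
    fun F => ⟨(e.symm F).2, heT F⟩, fun U => ?_⟩
  rw [← hT]
  exact congrArg Subtype.val (heT' U)

/-- With `U = R G` the equation becomes `(1 - (z - z') R) G = F`, solvable by a Neumann series. -/
theorem exists_resolvent_eq_of_norm_lt [CompleteSpace H] {A : H →ₗ.[ℂ] H} {z z' : ℂ} {R : H →L[ℂ] H}
    (hR : ∀ F : H, ∃ h : R F ∈ A.domain, z • R F - A ⟨R F, h⟩ = F) (hz : ‖z - z'‖ * ‖R‖ < 1)
    (F : H) : ∃ U : A.domain, z' • (U : H) - A U = F := by
  have h1 : ‖(z - z') • R‖ < 1 := by rwa [norm_smul]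
  obtain ⟨u, hu⟩ := isUnit_one_sub_of_norm_lt_one h1
  set G : H := (↑u⁻¹ : H →L[ℂ] H) F
  have hG : G - (z - z') • R G = F := by
    have h2 : (u : H →L[ℂ] H) ((↑u⁻¹ : H →L[ℂ] H) F) = F := by
      rw [← mul_apply_eq_comp, Units.mul_inv, one_apply_eq_self]
    rw [hu] at h2
    exact h2
  obtain ⟨h, hGR⟩ := hR G
  refine ⟨⟨R G, h⟩, ?_⟩
  rw [← hG]
  nth_rewrite 3 [← hGR]
  module

/-- If `iλ - A` is bounded below for every real `λ` and `A` is onto, then the imaginary axis lies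
in the resolvent set of `A`. -/
theorem range_subset_resolventSet [CompleteSpace H] {A : H →ₗ.[ℂ] H}
    (hA : ∀ r : ℝ, ∃ C, 0 < C ∧ ∀ U : A.domain, ‖(U : H)‖
      ≤ C * ‖(Complex.I * r) • (U : H) - A U‖)
    (hs : ∀ F, ∃ U, A U = F) :
    range (fun r : ℝ => Complex.I * (r : ℂ)) ⊆ resolventSet A := by
  let S : Set ℝ := {r | ∀ F, ∃ U : A.domain, (Complex.I * r) • (U : H) - A U = F}
  have hnorm : ∀ r s : ℝ, ‖Complex.I * (r : ℂ) - Complex.I * s‖ = |r - s| := fun r s => by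
    rw [← mul_sub, norm_mul, Complex.norm_I, one_mul, ← Complex.ofReal_sub, Complex.norm_real,
      Real.norm_eq_abs]
  have hstep : ∀ (r s C : ℝ), 0 < C → (∀ U : A.domain, ‖(U : H)‖
      ≤ C * ‖(Complex.I * r) • (U : H) - A U‖) → r ∈ S → |r - s| * C < 1 → s ∈ S := by
    intro r s C hC hrC hr hrs
    obtain ⟨R, hRC, hR, -⟩ := mem_resolventSet_of_surjective hrC hr
    rw [max_eq_left hC.le] at hRC
    refine fun F => exists_resolvent_eq_of_norm_lt hR ?_ F
    rw [hnorm]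
    exact (mul_le_mul_of_nonneg_left hRC (abs_nonneg _)).trans_lt hrs
  have hopen : IsOpen S := by
    rw [Metric.isOpen_iff]
    intro r hr
    obtain ⟨C, hC, hrC⟩ := hA r
    refine ⟨C⁻¹, inv_pos.2 hC, fun s hsr => hstep r s C hC hrC hr ?_⟩
    rw [Metric.mem_ball, dist_comm, Real.dist_eq] at hsr
    rwa [← lt_inv_mul_iff₀' hC, mul_one]
  -- If `s ∈ S` lies within `1 / (2C)` of `r`, the bound at `r` transfers to `s` with constant `2C`,
  -- since the perturbation `C |s - r| ‖U‖` is at most half of `‖U‖`. The Neumann step from `s` then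
  -- reaches back to `r`.
  have hclosed : IsClosed S := by
    rw [← isOpen_compl_iff, Metric.isOpen_iff]
    intro r hr
    obtain ⟨C, hC, hrC⟩ := hA r
    refine ⟨(2 * C)⁻¹, by positivity, fun s hsr hsS => hr ?_⟩
    rw [Metric.mem_ball, Real.dist_eq] at hsr
    have h2 : |s - r| * (2 * C) < 1 := by
      rwa [← lt_inv_mul_iff₀' (by positivity), mul_one]
    refine hstep s r (2 * C) (by positivity) (fun U => ?_) hsS h2
    have e : (Complex.I * r) • (U : H) - A U
        = ((Complex.I * s) • (U : H) - A U) + (Complex.I * r - Complex.I * s) • (U : H) := by module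
    have h3 : ‖(Complex.I * r) • (U : H) - A U‖
        ≤ ‖(Complex.I * s) • (U : H) - A U‖ + |s - r| * ‖(U : H)‖ := by
      rw [e]
      refine (norm_add_le _ _).trans_eq ?_
      rw [norm_smul, hnorm, abs_sub_comm]
    have h4 := (hrC U).trans (mul_le_mul_of_nonneg_left h3 hC.le)
    have h5 := mul_le_mul_of_nonneg_right h2.le (norm_nonneg (U : H))
    linarith
  have huniv : S = univ := IsClopen.eq_univ ⟨hclosed, hopen⟩ ⟨0, fun F => by
    obtain ⟨U, hU⟩ := hs (-F)
    exact ⟨U, by rw [hU]; simp⟩⟩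
  rintro _ ⟨r, rfl⟩
  obtain ⟨C, -, hrC⟩ := hA r
  obtain ⟨R, -, hR⟩ := mem_resolventSet_of_surjective hrC (huniv ▸ mem_univ r : r ∈ S)
  exact ⟨R, hR⟩

end Continuity

end Piezo

theorem mainTheorem4 (p : Piezo.Params) (σ : ℝ → ℝ) (hσ : Piezo.ConditionH σ) :
    Set.range (fun l : ℝ => Complex.I * (l : ℂ)) ⊆ Piezo.resolventSet (Piezo.A₁ p hσ) :=
  Piezo.range_subset_resolventSet (Piezo.exists_norm_le_resolvent hσ) (Piezo.exists_A₁_eq hσ)
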